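/- Let $1\le q\le p\le 2$, $0<\varepsilon<\frac12$ and $R>1$. Let $h(x)=\frac1\pi\int_0^\infty\cos(tx)e^{-t^p}\,dt$ be the density of the standard symmetric $p$-stable law, and put $$Q=2\int_0^\infty u^q h(u)\,du\quad(q<p),\qquad Q_a=2\int_0^{\sqrt\varepsilon/a}u^p h(u)\,du\quad(q=p).$$ There are a constant $C>0$ depending only on $p$ and a constant $A\ge 1$ depending only on $p$ and $q$ such that the following holds. Set $$s=A\,R\,\varepsilon^{-1/2}\bigl(1+(p-q)\varepsilon^{-(q/2+1)}\bigr)^{1/(p-q)}\quad\text{if } q<p,$$ $$s=A\max\Bigl\{R^{1/\varepsilon},\,R\,\varepsilon^{-1/2}e^{\varepsilon^{-(q/2+1)}}\Bigr\}\quad\text{if } q=p.$$ Then for every $n$ there is an integer $$0\le k\le C\,\frac{\log n}{\varepsilon^2}\cdot\min\Bigl\{s^{2q},\ \max\Bigl\{\frac{s^{2q-p}}{2q-p},\ \varepsilon s^q\Bigr\}\Bigr\}$$ (the quotient being read as $+\infty$ when $2q=p$) such that for every $m$ there is an oblivious (random) embedding $f:\ell_p^m\to\ell_q^k$ with the properties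 below. Oblivious means that $f$ is determined by independent random numbers, each standard symmetric $p$-stable or uniform on $[0,2\pi]$, which are drawn once without knowledge of any point set, and that $f(v)$ is computed from $v$ and these numbers alone. Once they are drawn, $f(v)$ is computed for each point $v$ by a fixed straight-line program of at most $Cmk$ unit-cost steps (reading an input coordinate, a random number or a constant; addition; multiplication; sine). For every $n$-point set $S\subset\ell_p^m$, with probability at least $\frac23$, all pairs $v,w\in S$ satisfy, with $t=\|v-w\|_p$: (a) Threshold: $\|f(v)-f(w)\|_q^q\le s^q/Q$ if $q<p$, and $\|f(v)-f(w)\|_q^q\le s^q/Q_{R/s}$ if $q=p$. (b) Large scales: if $t>R$, then $\|f(v)-f(w)\|_q^q\le C\,t^q$; moreover $\|f(v)-f(w)\|_q^q\ge(1+\frac\varepsilon2)R^q$ if $q<p$, and $\|f(v)-f(w)\|_q^q\ge(1-\varepsilon)R^q$ if $q=p$. (c) Intermediate scales: if $1\le t\le R$, then $(1-\varepsilon)t^q\le\|f(v)-f(w)\|_q^q\le(1+\varepsilon)t^q$. (d) Small scales: if $t<1$, then $\|f(v)-f(w)\|_q^q\le 1+\varepsilon$. -/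

import Mathlib

open MeasureTheory Set

noncomputable section

/-- The space `ℓ_p^m`: real vectors of length `m` with the `p`-norm. -/
abbrev EllP (p : ℝ) (m : ℕ) : Type := PiLp (ENNReal.ofReal p) (fun _ : Fin m => ℝ)

/-- Density of the standard symmetric `p`-stable law:
`h(x) = (1/π) ∫_0^∞ cos(tx) exp(-t^p) dt`. -/
def stableDensity (p x : ℝ) : ℝ :=
  (1 / Real.pi) * ∫ t in Ioi (0 : ℝ), Real.cos (t * x) * Real.exp (-t ^ p)

/-- The standard symmetric `p`-stable law. -/
def stableLaw (p : ℝ) : Measure ℝ :=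
  volume.withDensity fun x => ENNReal.ofReal (stableDensity p x)

/-- `Q = 2 ∫_0^∞ u^q h(u) du`, the absolute `q`-th moment of a symmetric `p`-stable variable
(finite for `q < p`). -/
def stableMoment (p q : ℝ) : ℝ :=
  2 * ∫ u in Ioi (0 : ℝ), u ^ q * stableDensity p u

/-- `Q_a = 2 ∫_0^{√ε / a} u^p h(u) du`, the truncated absolute `p`-th moment. -/
def truncatedMoment (p ε a : ℝ) : ℝ :=
  2 * ∫ u in Ioc (0 : ℝ) (Real.sqrt ε / a), u ^ p * stableDensity p u

/-- The normalizing constant of the threshold bound: `Q` if `q < p`, and `Q_{R/s}` if `q = p`. -/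
def thresholdNormalizer (p q ε R s : ℝ) : ℝ :=
  if q < p then stableMoment p q else truncatedMoment p ε (R / s)

/-- The function of `R` and `ε` to which the threshold `s` is proportional. -/
def thresholdScale (p q ε R : ℝ) : ℝ :=
  if q < p then
    R * ε ^ (-(1 / 2) : ℝ) * (1 + (p - q) * ε ^ (-(q / 2 + 1))) ^ (1 / (p - q))
  else
    max (R ^ (1 / ε)) (R * ε ^ (-(1 / 2) : ℝ) * Real.exp (ε ^ (-(q / 2 + 1))))

/-- `min {s^{2q}, max {s^{2q-p}/(2q-p), ε s^q}}`. When `2q = p` (that is, `q = 1`, `p = 2`) the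
quotient is read as `+∞`, so that the value is `s^{2q}`. -/
def dimFactor (p q ε s : ℝ) : ℝ :=
  if p < 2 * q then
    min (s ^ (2 * q)) (max (s ^ (2 * q - p) / (2 * q - p)) (ε * s ^ q))
  else s ^ (2 * q)

/-- The two sources of randomness: a standard symmetric `p`-stable number, or an angle that is
uniform on `[0, 2π]`. -/
inductive SeedKind
  | stable
  | angle

/-- The law of a random number of each kind. -/
def SeedKind.law (p : ℝ) : SeedKind → Measure ℝ
  | .stable => stableLaw p
  | .angle => ProbabilityTheory.cond volume (Icc 0 (2 * Real.pi))

/-- One unit-cost instruction of a straight-line real-arithmetic program with `m` inputs and `r`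
stored random numbers. It computes one new number; `a`, `b` are addresses of numbers computed
earlier. -/
inductive Instr (m r : ℕ)
  | const (c : ℝ)
  | input (i : Fin m)
  | seed (j : Fin r)
  | add (a b : ℕ)
  | mul (a b : ℕ)
  | sin (a : ℕ)

/-- The number computed by an instruction, for input `x`, random numbers `ω` and memory `mem`
(an address beyond the memory reads `0`). -/
def Instr.eval {m r : ℕ} (x : Fin m → ℝ) (ω : Fin r → ℝ) (mem : List ℝ) : Instr m r → ℝ
  | .const c => c
  | .input i => x i
  | .seed j => ω j
  | .add a b => mem.getD a 0 + mem.getD b 0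
  | .mul a b => mem.getD a 0 * mem.getD b 0
  | .sin a => Real.sin (mem.getD a 0)

/-- A randomized straight-line program computing a map from `ℝ^m` to `ℝ^k`. Its random numbers are
drawn once, independently, and are then shared by all points on which the program is run. -/
structure RandProgram (m k : ℕ) where
  /-- the number of random numbers -/
  r : ℕ
  /-- the kind of each of them -/
  kind : Fin r → SeedKind
  /-- the instructions -/
  code : List (Instr m r)
  /-- the addresses of the `k` output numbers -/
  out : Fin k → ℕ

namespace RandProgram

variable {m k : ℕ}

/-- The joint law of the independent random numbers of the program. -/
def seedLaw (P : RandProgram m k) (p : ℝ) : Measure (Fin P.r → ℝ) :=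
  Measure.pi fun j => (P.kind j).law p

/-- The memory after the program has been run on the point `x`. -/
def memory (P : RandProgram m k) (ω : Fin P.r → ℝ) (x : Fin m → ℝ) : List ℝ :=
  P.code.foldl (fun mem c => mem ++ [c.eval x ω mem]) []

/-- The map from `ℓ_p^m` to `ℓ_q^k` computed by the program with random numbers `ω`. It is applied
to each point without reference to any other point. -/
def toMap (P : RandProgram m k) (p q : ℝ) (ω : Fin P.r → ℝ) (x : EllP p m) : EllP q k :=
  WithLp.toLp (ENNReal.ofReal q) fun i => (P.memory ω x.ofLp).getD (P.out i) 0

/-- The time that one run of the program (the embedding of one point) takes. -/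
def steps (P : RandProgram m k) : ℕ := P.code.length

end RandProgram

/-- The guarantees of the range embedding `f` on the point set `S`, with `C` the constant of the
bound `O(t^q)`. -/
structure IsRangeEmbedding (p q ε R s C : ℝ) {m k : ℕ} (S : Finset (EllP p m))
    (f : EllP p m → EllP q k) : Prop where
  /-- threshold -/
  threshold : ∀ v ∈ S, ∀ w ∈ S,
    ‖f v - f w‖ ^ q ≤ s ^ q / thresholdNormalizer p q ε R s
  /-- bounded expansion for large scales -/
  large_expansion : ∀ v ∈ S, ∀ w ∈ S, R < ‖v - w‖ → ‖f v - f w‖ ^ q ≤ C * ‖v - w‖ ^ q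
  /-- bounded contraction for large scales, target norm smaller than the source norm -/
  large_contraction_of_lt : q < p → ∀ v ∈ S, ∀ w ∈ S, R < ‖v - w‖ →
    (1 + ε / 2) * R ^ q ≤ ‖f v - f w‖ ^ q
  /-- bounded contraction for large scales, equal norms -/
  large_contraction_of_eq : q = p → ∀ v ∈ S, ∀ w ∈ S, R < ‖v - w‖ →
    (1 - ε) * R ^ q ≤ ‖f v - f w‖ ^ q
  /-- bi-Lipschitz for intermediate scales -/
  intermediate : ∀ v ∈ S, ∀ w ∈ S, 1 ≤ ‖v - w‖ → ‖v - w‖ ≤ R →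
    (1 - ε) * ‖v - w‖ ^ q ≤ ‖f v - f w‖ ^ q ∧ ‖f v - f w‖ ^ q ≤ (1 + ε) * ‖v - w‖ ^ q
  /-- bounded expansion for small scales -/
  small_expansion : ∀ v ∈ S, ∀ w ∈ S, ‖v - w‖ < 1 → ‖f v - f w‖ ^ q ≤ 1 + ε

end

/-! Coordinate `j` of the embedding is `β sin ((2/s) ∑ g_i v_i + φ)`, with fresh stable `g_i` and a
fresh uniform angle `φ` for each `j`. Since `sin x - sin y = 2 sin ((x-y)/2) cos ((x+y)/2)`, the
`q`-th power of the difference of two images is, coordinatewise, `(2β)^q |sin ((1/s) ∑ (v-w)_i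
g_i)|^q |cos (φ + ...)|^q`. Averaging over `φ` turns the cosine factor into a constant, and by
`p`-stability the linear form has the law of `t Z` with `t = ‖v - w‖_p`. So after normalization the
mean of `‖f v - f w‖^q` depends on `t` alone: it is `meanDist`, a multiple of `s^q E |sin (t Z /
s)|^q`.

Four facts about `sinMoment p q a = E |sin (a Z)|^q` give the guarantees for the mean. It increases
with `a` (`sinMoment_mono`), so lower bounds at `t = R` carry over to all larger scales. It is at
most `1/√2`, which yields the threshold. It is bounded above by `a^q` times a (truncated) moment
plus a tail term, and below by nearly `a^q` times the moment truncated at `√θ / a`. Hence for `1 ≤ t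
≤ R` the mean is `t^q` up to a factor `1 ± O(ε)` as soon as `s / R` is so large that truncation
costs only a fraction `ε` of the moment. For `q < p` the tail of the moment decays like `b^(q-p) /
(p-q)`. For `q = p < 2` the truncated moment grows like `2 c log b`, and one needs `log (R/√ε)` to
be at most about `ε` times `log b`; this is the origin of `R^(1/ε)`. These estimates are collected
in `ScaleEstimate`.

Concentration comes from Bernstein's inequality over the `k` independent coordinates. With `x = min
1 (t/s)` the mean of a coordinate is at least of order `x^q`, and its second moment is at most of
order `x^p / (2q-p)`, and at most `1`. As `x ≥ 1/s`, a relative deviation of order `ε` has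
probability at most `2 exp (-k ρ)` with `ρ` of order `ε² / dimFactor`; a union bound over `n²` pairs
then fixes `k`. The constants of this step are controlled by `partialMoment p 2 1` and the tail
constant `K`, which do not involve `q`.

The analytic input is that `h` is a probability density with characteristic function `exp (-|a|^p)`
and with `u^(1+p) h(u)` convergent, to a positive limit if `p < 2`. Nonnegativity holds because `exp
(-t^p)` is a limit of powers of Gaussian mixtures. -/

open Filter Topology ProbabilityTheory

noncomputable section

/-! ### Nonnegativity of the cosine transform of `exp (-t^p)` through Gaussian mixtures. -/

/-- The Gaussian cosine transform. -/
theorem integral_cos_mul_exp_neg_mul_sq {w : ℝ} (hw : 0 < w) (x : ℝ) :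
    ∫ t in Ioi (0 : ℝ), Real.cos (t * x) * Real.exp (-w * t ^ 2) =
      Real.sqrt (Real.pi / w) / 2 * Real.exp (-x ^ 2 / (4 * w)) := by
  have h1 := fourierIntegral_gaussian (b := (w : ℂ)) (by simpa using hw) (x : ℂ)
  have h2 := congrArg Complex.re h1
  have hint : Integrable fun t : ℝ => Complex.exp (Complex.I * x * t) *
      Complex.exp (-w * t ^ 2) := by
    refine (integrable_cexp_neg_mul_sq (b := (w : ℂ)) (by simpa using hw)).mono
      (by fun_prop) ?_
    refine Eventually.of_forall fun t => ?_
    rw [norm_mul]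
    have : ‖Complex.exp (Complex.I * x * t)‖ = 1 := by
      rw [show Complex.I * x * t = ((x * t : ℝ) : ℂ) * Complex.I by push_cast; ring]
      exact Complex.norm_exp_ofReal_mul_I _
    rw [this, one_mul]
  rw [show (∫ t : ℝ, Complex.exp (Complex.I * x * t) * Complex.exp (-w * t ^ 2)).re =
    ∫ t : ℝ, (Complex.exp (Complex.I * x * t) * Complex.exp (-w * t ^ 2)).re from
      (integral_re hint).symm] at h2
  have h3 : ∀ t : ℝ, (Complex.exp (Complex.I * x * t) * Complex.exp (-w * t ^ 2)).re =
      Real.cos (|t| * x) * Real.exp (-w * |t| ^ 2) := by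
    intro t
    rw [show Complex.I * x * t = ((x * t : ℝ) : ℂ) * Complex.I by push_cast; ring,
      show (-w * t ^ 2 : ℂ) = ((-w * t ^ 2 : ℝ) : ℂ) by push_cast; ring,
      ← Complex.ofReal_exp, Complex.re_mul_ofReal, Complex.exp_ofReal_mul_I_re, sq_abs]
    congr 1
    rcases abs_cases t with ⟨h, _⟩ | ⟨h, _⟩ <;> rw [h]
    · rw [mul_comm]
    · rw [neg_mul, Real.cos_neg, mul_comm]
  simp_rw [h3] at h2
  rw [integral_comp_abs (f := fun t => Real.cos (t * x) * Real.exp (-w * t ^ 2))] at h2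
  have h4 : ((Real.pi / w : ℂ) ^ (1 / 2 : ℂ) * Complex.exp (-x ^ 2 / (4 * w))).re =
      Real.sqrt (Real.pi / w) * Real.exp (-x ^ 2 / (4 * w)) := by
    rw [show (-x ^ 2 / (4 * w) : ℂ) = ((-x ^ 2 / (4 * w) : ℝ) : ℂ) by push_cast; ring,
      ← Complex.ofReal_exp, Complex.re_mul_ofReal, Real.sqrt_eq_rpow,
      show (Real.pi / w : ℂ) ^ (1 / 2 : ℂ) = ((Real.pi / w) ^ (1 / 2 : ℝ) : ℝ) by
        rw [Complex.ofReal_cpow (by positivity)]; push_cast; rfl, Complex.ofReal_re]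
  rw [h4] at h2
  linarith

theorem integral_cos_mul_exp_neg (x : ℝ) :
    ∫ t in Ioi (0 : ℝ), Real.cos (t * x) * Real.exp (-t) = 1 / (1 + x ^ 2) := by
  have ha : (-1 + x * Complex.I : ℂ).re < 0 := by simp
  have h1 := integral_exp_mul_complex_Ioi ha 0
  have h2 := congrArg Complex.re h1
  rw [show (∫ t : ℝ in Ioi 0, Complex.exp ((-1 + x * Complex.I) * t)).re =
    ∫ t : ℝ in Ioi 0, (Complex.exp ((-1 + x * Complex.I) * t)).re from
      (integral_re (integrableOn_exp_mul_complex_Ioi ha 0)).symm] at h2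
  have h3 : ∀ t : ℝ, (Complex.exp ((-1 + x * Complex.I) * t)).re =
      Real.cos (t * x) * Real.exp (-t) := by
    intro t
    rw [show ((-1 + x * Complex.I) * t : ℂ) = ((-t : ℝ) : ℂ) + ((t * x : ℝ) : ℂ) * Complex.I by
      push_cast; ring, Complex.exp_add, ← Complex.ofReal_exp, Complex.re_ofReal_mul,
      Complex.exp_ofReal_mul_I_re, mul_comm]
  simp_rw [h3] at h2
  rw [h2]
  simp only [Complex.ofReal_zero, mul_zero, Complex.exp_zero]
  rw [Complex.div_re]
  simp [Complex.normSq_apply]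
  ring_nf

/-- `∫_0^∞ (1 - e^{-v}) v^{-1-α} dv`. -/
def levyConst (α : ℝ) : ℝ := ∫ v in Ioi (0 : ℝ), (1 - Real.exp (-v)) * v ^ (-1 - α)

theorem integrableOn_levy {α : ℝ} (h0 : 0 < α) (h1 : α < 1) {y : ℝ} (hy : 0 ≤ y) :
    IntegrableOn (fun v => (1 - Real.exp (-(v * y))) * v ^ (-1 - α)) (Ioi 0) := by
  have hm : ∀ s : Set ℝ, AEStronglyMeasurable
      (fun v => (1 - Real.exp (-(v * y))) * v ^ (-1 - α)) (volume.restrict s) := by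
    intro s
    have : Measurable (fun v : ℝ => (1 - Real.exp (-(v * y))) * v ^ (-1 - α)) := by fun_prop
    exact this.aestronglyMeasurable
  rw [← Ioc_union_Ioi_eq_Ioi (zero_le_one (α := ℝ))]
  refine IntegrableOn.union ?_ ?_
  · have hi : IntegrableOn (fun v : ℝ => y * v ^ (-α)) (Ioc 0 1) := by
      refine Integrable.const_mul ?_ y
      rw [← IntegrableOn, ← intervalIntegrable_iff_integrableOn_Ioc_of_le zero_le_one]
      exact intervalIntegral.intervalIntegrable_rpow' (by linarith)
    refine Integrable.mono' hi (hm _) ?_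
    refine (ae_restrict_iff' measurableSet_Ioc).2 (Eventually.of_forall fun v hv => ?_)
    have hv0 : 0 < v := hv.1
    have he : 1 - Real.exp (-(v * y)) ≤ v * y := by
      have := Real.add_one_le_exp (-(v * y)); linarith
    have he0 : 0 ≤ 1 - Real.exp (-(v * y)) := by
      have : Real.exp (-(v * y)) ≤ 1 := Real.exp_le_one_iff.2 (by nlinarith)
      linarith
    have hp : (0 : ℝ) ≤ v ^ (-1 - α) := by positivity
    rw [Real.norm_eq_abs, abs_of_nonneg (mul_nonneg he0 hp)]
    calc (1 - Real.exp (-(v * y))) * v ^ (-1 - α) ≤ v * y * v ^ (-1 - α) := by gcongr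
      _ = y * (v ^ (1 : ℝ) * v ^ (-1 - α)) := by rw [Real.rpow_one]; ring
      _ = y * v ^ (-α) := by rw [← Real.rpow_add hv0]; ring_nf
  · refine Integrable.mono' (integrableOn_Ioi_rpow_of_lt (a := -1 - α) (by linarith) one_pos)
      (hm _) ?_
    refine (ae_restrict_iff' measurableSet_Ioi).2 (Eventually.of_forall fun v hv => ?_)
    have hv0 : 0 < v := lt_trans one_pos hv
    have he0 : 0 ≤ 1 - Real.exp (-(v * y)) := by
      have : Real.exp (-(v * y)) ≤ 1 := Real.exp_le_one_iff.2 (by nlinarith)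
      linarith
    have hp : (0 : ℝ) ≤ v ^ (-1 - α) := by positivity
    rw [Real.norm_eq_abs, abs_of_nonneg (mul_nonneg he0 hp)]
    have : 1 - Real.exp (-(v * y)) ≤ 1 := by linarith [Real.exp_pos (-(v * y))]
    nlinarith

theorem integral_levy {α : ℝ} {y : ℝ} (h0 : 0 < α) (hy : 0 ≤ y) :
    ∫ v in Ioi (0 : ℝ), (1 - Real.exp (-(v * y))) * v ^ (-1 - α) = levyConst α * y ^ α := by
  rcases hy.eq_or_lt with rfl | hy
  · simp [Real.zero_rpow h0.ne']
  have := integral_comp_mul_left_Ioi (fun v => (1 - Real.exp (-v)) * v ^ (-1 - α)) 0 hy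
  rw [mul_zero, ← levyConst] at this
  have h2 : ∀ v ∈ Ioi (0 : ℝ), (1 - Real.exp (-(v * y))) * v ^ (-1 - α) =
      y ^ (1 + α) * ((1 - Real.exp (-(y * v))) * (y * v) ^ (-1 - α)) := by
    intro v hv
    rw [Real.mul_rpow hy.le (le_of_lt hv), mul_comm v y]
    have : y ^ (1 + α) * y ^ (-1 - α) = 1 := by
      rw [← Real.rpow_add hy]; simp
    linear_combination (- (1 - Real.exp (-(y * v))) * v ^ (-1 - α)) * this
  rw [setIntegral_congr_fun measurableSet_Ioi h2, integral_const_mul, this, Real.rpow_add hy,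
    Real.rpow_one, smul_eq_mul]
  field_simp

theorem levyConst_pos {α : ℝ} (h0 : 0 < α) (h1 : α < 1) : 0 < levyConst α := by
  have hi := integrableOn_levy h0 h1 zero_le_one
  simp only [mul_one] at hi
  rw [levyConst, setIntegral_pos_iff_support_of_nonneg_ae _ hi]
  · have : Ioi (0 : ℝ) ⊆ (Function.support fun v : ℝ => (1 - Real.exp (-v)) * v ^ (-1 - α)) ∩
        Ioi 0 := by
      intro v hv
      refine ⟨?_, hv⟩
      have : Real.exp (-v) < 1 := Real.exp_lt_one_iff.2 (by simpa using hv)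
      have h2 : 0 < v ^ (-1 - α) := Real.rpow_pos_of_pos hv _
      exact (mul_pos (by linarith) h2).ne'
    exact lt_of_lt_of_le (by simp) (measure_mono this)
  · refine (ae_restrict_iff' measurableSet_Ioi).2 (Eventually.of_forall fun v hv => ?_)
    have : Real.exp (-v) < 1 := Real.exp_lt_one_iff.2 (by simpa using hv)
    have h2 : 0 < v ^ (-1 - α) := Real.rpow_pos_of_pos hv _
    exact (mul_pos (by linarith) h2).le

/-- `f`, damped by any Gaussian, has a nonnegative cosine transform. -/
def HasNonnegCosTransform (f : ℝ → ℝ) : Prop :=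
  ∀ w : ℝ, 0 < w → ∀ x : ℝ,
    0 ≤ ∫ t in Ioi (0 : ℝ), Real.cos (t * x) * f t * Real.exp (-w * t ^ 2)

theorem hasNonnegCosTransform_one : HasNonnegCosTransform fun _ => 1 := by
  intro w hw x
  simp only [mul_one]
  rw [integral_cos_mul_exp_neg_mul_sq hw]
  positivity

/-- The property is stable under multiplication by a mixture of centred Gaussians. -/
theorem HasNonnegCosTransform.mul_mixture {f : ℝ → ℝ} (hf : HasNonnegCosTransform f)
    (hm : Measurable f) (hb : ∀ t, |f t| ≤ 1) {μ : Measure ℝ} [SFinite μ] {k : ℝ → ℝ}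
    (hk : Integrable k μ) (hkm : Measurable k) (hk0 : ∀ v, 0 ≤ k v) :
    HasNonnegCosTransform fun t => f t * ∫ v, k v * Real.exp (-|v| * t ^ 2) ∂μ := by
  intro w hw x
  have hF : Integrable (Function.uncurry fun t v : ℝ =>
      Real.cos (t * x) * (f t * (k v * Real.exp (-|v| * t ^ 2))) * Real.exp (-w * t ^ 2))
      ((volume.restrict (Ioi 0)).prod μ) := by
    have hg : Integrable (fun z : ℝ × ℝ => Real.exp (-w * z.1 ^ 2) * k z.2)
        ((volume.restrict (Ioi 0)).prod μ) :=
      Integrable.mul_prod (integrable_exp_neg_mul_sq hw).integrableOn hk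
    refine hg.mono' ?_ (Eventually.of_forall fun z => ?_)
    · have : Measurable (Function.uncurry fun t v : ℝ =>
        Real.cos (t * x) * (f t * (k v * Real.exp (-|v| * t ^ 2))) * Real.exp (-w * t ^ 2)) := by
        unfold Function.uncurry
        fun_prop
      exact this.aestronglyMeasurable
    · obtain ⟨t, v⟩ := z
      simp only [Function.uncurry, Real.norm_eq_abs, abs_mul, Real.abs_exp, abs_of_nonneg (hk0 v)]
      have h1 : |Real.cos (t * x)| ≤ 1 := Real.abs_cos_le_one _
      have h2 : Real.exp (-|v| * t ^ 2) ≤ 1 := Real.exp_le_one_iff.2 (by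
        have : 0 ≤ |v| * t ^ 2 := by positivity
        linarith)
      have h3 := hb t
      have h4 := hk0 v
      calc |Real.cos (t * x)| * (|f t| * (k v * Real.exp (-|v| * t ^ 2))) * Real.exp (-w * t ^ 2)
          ≤ 1 * (1 * (k v * 1)) * Real.exp (-w * t ^ 2) := by gcongr
        _ = Real.exp (-w * t ^ 2) * k v := by ring
  have h1 : ∀ t : ℝ, Real.cos (t * x) * (f t * ∫ v, k v * Real.exp (-|v| * t ^ 2) ∂μ) *
      Real.exp (-w * t ^ 2) =
      ∫ v, Real.cos (t * x) * (f t * (k v * Real.exp (-|v| * t ^ 2))) * Real.exp (-w * t ^ 2) ∂μ := by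
    intro t
    rw [integral_mul_const, integral_const_mul, integral_const_mul]
  simp_rw [h1]
  rw [integral_integral_swap hF]
  refine integral_nonneg fun v => ?_
  -- A Gaussian factor of the mixture merges with the damping factor: `w` is replaced by `|v| + w`.
  -- This is why the property is stated for all dampings at once.
  have h2 : ∀ t : ℝ, Real.cos (t * x) * (f t * (k v * Real.exp (-|v| * t ^ 2))) *
      Real.exp (-w * t ^ 2) = k v * (Real.cos (t * x) * f t * Real.exp (-(|v| + w) * t ^ 2)) := by
    intro t
    rw [show -(|v| + w) * t ^ 2 = -|v| * t ^ 2 + -w * t ^ 2 by ring, Real.exp_add]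
    ring
  simp_rw [h2]
  rw [integral_const_mul]
  exact mul_nonneg (hk0 v) (hf _ (by positivity) x)

theorem HasNonnegCosTransform.of_tendsto {F : ℕ → ℝ → ℝ} {f : ℝ → ℝ}
    (hF : ∀ n, HasNonnegCosTransform (F n)) (hm : ∀ n, Measurable (F n))
    (hb : ∀ n t, |F n t| ≤ 1) (hlim : ∀ t, Tendsto (fun n => F n t) atTop (𝓝 (f t))) :
    HasNonnegCosTransform f := by
  intro w hw x
  have := tendsto_integral_of_dominated_convergence (μ := volume.restrict (Ioi (0 : ℝ)))
    (F := fun n t => Real.cos (t * x) * F n t * Real.exp (-w * t ^ 2))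
    (f := fun t => Real.cos (t * x) * f t * Real.exp (-w * t ^ 2))
    (fun t => Real.exp (-w * t ^ 2)) ?_ ?_ ?_ ?_
  · exact ge_of_tendsto' this fun n => hF n w hw x
  · intro n
    have := hm n
    have h2 : Measurable fun t => Real.cos (t * x) * F n t * Real.exp (-w * t ^ 2) := by fun_prop
    exact h2.aestronglyMeasurable
  · exact (integrable_exp_neg_mul_sq hw).integrableOn
  · refine fun n => Eventually.of_forall fun t => ?_
    rw [norm_mul, norm_mul, Real.norm_eq_abs, Real.norm_eq_abs, Real.norm_eq_abs, Real.abs_exp]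
    calc _ ≤ 1 * 1 * Real.exp (-w * t ^ 2) := by
          gcongr
          · exact Real.abs_cos_le_one _
          · exact hb n t
      _ = _ := by ring
  · exact Eventually.of_forall fun t => ((hlim t).const_mul _).mul_const _

theorem HasNonnegCosTransform.mixture_pow {μ : Measure ℝ} [SFinite μ] {k : ℝ → ℝ}
    (hk : Integrable k μ) (hkm : Measurable k) (hk0 : ∀ v, 0 ≤ k v)
    (hφm : Measurable fun t : ℝ => ∫ v, k v * Real.exp (-|v| * t ^ 2) ∂μ)
    (hφb : ∀ t : ℝ, |∫ v, k v * Real.exp (-|v| * t ^ 2) ∂μ| ≤ 1) (n : ℕ) :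
    HasNonnegCosTransform fun t => (∫ v, k v * Real.exp (-|v| * t ^ 2) ∂μ) ^ n := by
  induction n with
  | zero => simpa using hasNonnegCosTransform_one
  | succ n ih =>
    simp_rw [pow_succ]
    exact ih.mul_mixture (hφm.pow_const n)
      (fun t => by rw [abs_pow]; exact pow_le_one₀ (abs_nonneg _) (hφb t)) hk hkm hk0

/-- `exp (-c |t|^{2α})` has a nonnegative cosine transform for `0 < α < 1`. -/
theorem hasNonnegCosTransform_exp_neg_rpow {α : ℝ} (h0 : 0 < α) (h1 : α < 1) :
    HasNonnegCosTransform fun t => Real.exp (-(α * (levyConst α * (t ^ 2) ^ α))) := by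
  -- Chosen so that `δ n ^ (-α) = n + 1`, which makes the Lévy density `v^(-1-α)`, cut off below `δ
  -- n` and weighted by `α / (n + 1)`, a probability density. The `(n + 1)`-st power of its Gaussian
  -- mixture is a compound approximation of the stable characteristic function.
  set δ : ℕ → ℝ := fun n => ((n : ℝ) + 1) ^ (-1 / α) with hδ
  have hδ0 : ∀ n, 0 < δ n := fun n => by positivity
  set k : ℕ → ℝ → ℝ := fun n v => α / (n + 1) * |v| ^ (-1 - α) with hk
  have hkm : ∀ n, Measurable (k n) := fun n => by
    simp only [hk]; fun_prop
  have hk0 : ∀ n v, 0 ≤ k n v := fun n v => by simp only [hk]; positivity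
  have habs : ∀ n, ∀ v ∈ Ioi (δ n), |v| = v := fun n v hv =>
    abs_of_pos (lt_trans (hδ0 n) hv)
  have hki : ∀ n, IntegrableOn (k n) (Ioi (δ n)) := fun n => by
    refine ((integrableOn_Ioi_rpow_of_lt (a := -1 - α) (by linarith) (hδ0 n)).const_mul
      (α / (n + 1))).congr ?_
    refine (ae_restrict_iff' measurableSet_Ioi).2 (Eventually.of_forall fun v hv => ?_)
    simp only [hk, habs n v hv]
  have hk1 : ∀ n, ∫ v in Ioi (δ n), k n v = 1 := fun n => by
    rw [setIntegral_congr_fun (g := fun v => α / (n + 1) * v ^ (-1 - α)) measurableSet_Ioi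
      (fun v hv => by simp only [hk, habs n v hv]), integral_const_mul,
      integral_Ioi_rpow_of_lt (by linarith) (hδ0 n)]
    have : δ n ^ (-1 - α + 1) = n + 1 := by
      simp only [hδ]
      rw [← Real.rpow_mul (by positivity)]
      rw [show -1 / α * (-1 - α + 1) = 1 by field_simp; ring, Real.rpow_one]
    rw [this, show -1 - α + 1 = -α by ring]
    have : (n : ℝ) + 1 ≠ 0 := by positivity
    field_simp
  set φ : ℕ → ℝ → ℝ := fun n t => ∫ v in Ioi (δ n), k n v * Real.exp (-|v| * t ^ 2) with hφ
  have hexp : ∀ v t : ℝ, Real.exp (-|v| * t ^ 2) ≤ 1 := fun v t => Real.exp_le_one_iff.2 (by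
    have : 0 ≤ |v| * t ^ 2 := by positivity
    linarith)
  have hki2 : ∀ n t, IntegrableOn (fun v => k n v * Real.exp (-|v| * t ^ 2)) (Ioi (δ n)) :=
    fun n t => by
    refine (hki n).mono' ?_ (Eventually.of_forall fun v => ?_)
    · have := hkm n
      have h : Measurable fun v => k n v * Real.exp (-|v| * t ^ 2) := by fun_prop
      exact h.aestronglyMeasurable
    · rw [norm_mul, Real.norm_eq_abs, Real.norm_eq_abs, Real.abs_exp, abs_of_nonneg (hk0 n v)]
      exact mul_le_of_le_one_right (hk0 n v) (hexp v t)
  have hφm : ∀ n, Measurable (φ n) := fun n => by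
    have h : StronglyMeasurable (Function.uncurry fun t v : ℝ =>
        k n v * Real.exp (-|v| * t ^ 2)) := by
      have := hkm n
      have h : Measurable (Function.uncurry fun t v : ℝ =>
        k n v * Real.exp (-|v| * t ^ 2)) := by
        unfold Function.uncurry; fun_prop
      exact h.stronglyMeasurable
    exact h.integral_prod_right.measurable
  have hφ0 : ∀ n t, 0 ≤ φ n t := fun n t =>
    integral_nonneg fun v => mul_nonneg (hk0 n v) (Real.exp_pos _).le
  have hφ1 : ∀ n t, φ n t ≤ 1 := fun n t => by
    rw [← hk1 n]
    exact integral_mono (hki2 n t) (hki n) fun v => mul_le_of_le_one_right (hk0 n v) (hexp v t)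
  have hφb : ∀ n t, |φ n t| ≤ 1 := fun n t => by
    rw [abs_of_nonneg (hφ0 n t)]; exact hφ1 n t
  have hpos : ∀ n : ℕ, HasNonnegCosTransform fun t => φ n t ^ (n + 1) := fun n =>
    HasNonnegCosTransform.mixture_pow (hki n) (hkm n) (hk0 n) (hφm n) (hφb n) _
  refine HasNonnegCosTransform.of_tendsto hpos (fun n => (hφm n).pow_const _)
    (fun n t => by rw [abs_pow]; exact pow_le_one₀ (abs_nonneg _) (hφb n t)) fun t => ?_
  have hlev := integrableOn_levy h0 h1 (sq_nonneg t)
  have hδlim : Tendsto δ atTop (𝓝 0) := by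
    have : Tendsto (fun n : ℕ => (n : ℝ) + 1) atTop atTop :=
      tendsto_atTop_add_const_right _ _ tendsto_natCast_atTop_atTop
    have h2 := (tendsto_rpow_neg_atTop (y := 1 / α) (by positivity)).comp this
    refine h2.congr fun n => ?_
    simp only [Function.comp, hδ]
    congr 1
    ring
  have hcov := (aecover_Ioi_of_Ioi (μ := volume) hδlim)
  have hlim := hcov.integral_tendsto_of_countably_generated hlev
  rw [integral_levy h0 (sq_nonneg t)] at hlim
  -- With total mass one, `φ n t - 1` is a Lévy integral over `(δ n, ∞)`. Its multiple by `n + 1`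
  -- converges, and `(1 + x/n)^n → exp x` gives the limit of the powers.
  have key : ∀ n : ℕ, ((n : ℝ) + 1) * (φ n t - 1) =
      -(α * ∫ v in Ioi (δ n), (1 - Real.exp (-(v * t ^ 2))) * v ^ (-1 - α)) := fun n => by
    have hn : (n : ℝ) + 1 ≠ 0 := by positivity
    have : φ n t - 1 = ∫ v in Ioi (δ n), -(α / (n + 1)) *
        ((1 - Real.exp (-(v * t ^ 2))) * v ^ (-1 - α)) := by
      rw [show φ n t - 1 = φ n t - ∫ v in Ioi (δ n), k n v by rw [hk1 n]]
      simp only [hφ]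
      rw [← integral_sub (hki2 n t) (hki n)]
      refine setIntegral_congr_fun measurableSet_Ioi fun v hv => ?_
      simp only [hk, habs n v hv, neg_mul]
      ring
    rw [this, integral_const_mul]
    generalize ∫ v in Ioi (δ n), (1 - Real.exp (-(v * t ^ 2))) * v ^ (-1 - α) = I
    field_simp
  have hlim2 : Tendsto (fun n : ℕ => (n : ℝ) * (φ (n - 1) t - 1)) atTop
      (𝓝 (-(α * (levyConst α * (t ^ 2) ^ α)))) := by
    rw [← tendsto_add_atTop_iff_nat 1]
    have : ∀ n : ℕ, ((n + 1 : ℕ) : ℝ) * (φ (n + 1 - 1) t - 1) =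
      -(α * ∫ v in Ioi (δ n), (1 - Real.exp (-(v * t ^ 2))) * v ^ (-1 - α)) := fun n => by
        rw [← key n]; simp
    simp_rw [this]
    refine ((hlim.congr fun n => ?_).const_mul α).neg
    rw [Measure.restrict_restrict measurableSet_Ioi, Ioi_inter_Ioi, max_eq_left (hδ0 n).le]
  have := Real.tendsto_one_add_pow_exp_of_tendsto hlim2
  rw [← tendsto_add_atTop_iff_nat 1] at this
  simpa using this

/-- The cosine transform of `exp (-t^p)` is nonnegative for `0 < p < 2`. -/
theorem cosTransform_exp_neg_rpow_nonneg {p : ℝ} (h0 : 0 < p) (h2 : p < 2) (x : ℝ) :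
    0 ≤ ∫ t in Ioi (0 : ℝ), Real.cos (t * x) * Real.exp (-t ^ p) := by
  have hα0 : 0 < p / 2 := by positivity
  have hα1 : p / 2 < 1 := by linarith
  have hpos := hasNonnegCosTransform_exp_neg_rpow hα0 hα1
  set c := (p / 2) * levyConst (p / 2) with hc
  have hc0 : 0 < c := mul_pos hα0 (levyConst_pos hα0 hα1)
  have hint : IntegrableOn (fun t : ℝ => Real.exp (-c * t ^ p)) (Ioi 0) := by
    have := integrableOn_rpow_mul_exp_neg_mul_rpow (s := 0) (by norm_num) h0 hc0
    simpa using this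
  have hsq : ∀ t ∈ Ioi (0 : ℝ), (t ^ 2) ^ (p / 2) = t ^ p := fun t ht => by
    rw [← Real.rpow_natCast, ← Real.rpow_mul (le_of_lt ht)]
    congr 1
    push_cast; ring
  -- The damping is removed by letting `w = 1 / (n + 1)` tend to zero; rescaling `t` by `c^(1/p)`
  -- afterwards removes the constant `c`.
  have hall : ∀ y : ℝ, 0 ≤ ∫ t in Ioi (0 : ℝ), Real.cos (t * y) * Real.exp (-c * t ^ p) := by
    intro y
    have hw : Tendsto (fun n : ℕ => 1 / ((n : ℝ) + 1)) atTop (𝓝 0) :=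
      tendsto_one_div_add_atTop_nhds_zero_nat
    have := tendsto_integral_of_dominated_convergence (μ := volume.restrict (Ioi (0 : ℝ)))
      (F := fun (n : ℕ) t => Real.cos (t * y) * Real.exp (-c * t ^ p) *
        Real.exp (-(1 / ((n : ℝ) + 1)) * t ^ 2))
      (f := fun t => Real.cos (t * y) * Real.exp (-c * t ^ p))
      (fun t => Real.exp (-c * t ^ p)) ?_ hint ?_ ?_
    · refine ge_of_tendsto' this fun n => ?_
      have := hpos (1 / ((n : ℝ) + 1)) (by positivity) y
      refine this.trans_eq (setIntegral_congr_fun measurableSet_Ioi fun t ht => ?_)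
      simp only [hsq t ht, hc]
      congr 3
      ring
    · intro n
      have h : Measurable fun t => Real.cos (t * y) * Real.exp (-c * t ^ p) *
        Real.exp (-(1 / ((n : ℝ) + 1)) * t ^ 2) := by fun_prop
      exact h.aestronglyMeasurable
    · refine fun n => Eventually.of_forall fun t => ?_
      rw [norm_mul, norm_mul, Real.norm_eq_abs, Real.norm_eq_abs, Real.norm_eq_abs, Real.abs_exp,
        Real.abs_exp]
      calc _ ≤ 1 * Real.exp (-c * t ^ p) * 1 := by
            gcongr
            · exact Real.abs_cos_le_one _
            · refine Real.exp_le_one_iff.2 ?_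
              have : 0 ≤ 1 / ((n : ℝ) + 1) * t ^ 2 := by positivity
              linarith
        _ = _ := by ring
    · refine Eventually.of_forall fun t => ?_
      have : Tendsto (fun n : ℕ => Real.exp (-(1 / ((n : ℝ) + 1)) * t ^ 2)) atTop
          (𝓝 (Real.exp (-0 * t ^ 2))) :=
        (Real.continuous_exp.tendsto _).comp (hw.neg.mul_const _)
      simpa using this.const_mul (Real.cos (t * y) * Real.exp (-c * t ^ p))
  have hb : 0 < c ^ (1 / p) := by positivity
  have h3 := integral_comp_mul_left_Ioi
    (fun t => Real.cos (t * x) * Real.exp (-t ^ p)) 0 hb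
  rw [mul_zero] at h3
  have h4 : ∫ t in Ioi (0 : ℝ), Real.cos (c ^ (1 / p) * t * x) *
      Real.exp (-(c ^ (1 / p) * t) ^ p) =
      ∫ t in Ioi (0 : ℝ), Real.cos (t * (c ^ (1 / p) * x)) * Real.exp (-c * t ^ p) := by
    refine setIntegral_congr_fun measurableSet_Ioi fun t ht => ?_
    rw [Real.mul_rpow hb.le (le_of_lt ht), ← Real.rpow_mul hc0.le, one_div,
      inv_mul_cancel₀ h0.ne', Real.rpow_one]
    congr 2 <;> ring
  rw [h4] at h3
  have h5 := hall (c ^ (1 / p) * x)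
  rw [h3, smul_eq_mul] at h5
  exact nonneg_of_mul_nonneg_right h5 (by positivity)

/-! ### Tail asymptotics of the cosine transform by integration by parts. -/

theorem integrableOn_Ioc_rpow {a : ℝ} (ha : -1 < a) : IntegrableOn (fun v : ℝ => v ^ a) (Ioc 0 1) := by
  rw [← intervalIntegrable_iff_integrableOn_Ioc_of_le zero_le_one]
  exact intervalIntegral.intervalIntegrable_rpow' ha

/-- A function dominated by `K x^a` near zero and by `K x^b` at infinity is integrable. -/
theorem integrableOn_Ioi_of_abs_le_rpow {f : ℝ → ℝ} (hf : Measurable f) {a b K : ℝ} (ha : -1 < a)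
    (hb : b < -1) (h0 : ∀ x, 0 < x → x ≤ 1 → |f x| ≤ K * x ^ a)
    (h1 : ∀ x, 1 < x → |f x| ≤ K * x ^ b) : IntegrableOn f (Ioi 0) := by
  rw [← Ioc_union_Ioi_eq_Ioi (zero_le_one (α := ℝ))]
  refine IntegrableOn.union ?_ ?_
  · refine Integrable.mono' ((integrableOn_Ioc_rpow ha).const_mul K) hf.aestronglyMeasurable ?_
    exact (ae_restrict_iff' measurableSet_Ioc).2 (Eventually.of_forall fun x hx => h0 x hx.1 hx.2)
  · refine Integrable.mono' ((integrableOn_Ioi_rpow_of_lt hb one_pos).const_mul K)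
      hf.aestronglyMeasurable ?_
    exact (ae_restrict_iff' measurableSet_Ioi).2 (Eventually.of_forall fun x hx => h1 x hx)

theorem integrableOn_sin_mul_rpow {p : ℝ} (h1 : 1 < p) (h2 : p < 2) :
    IntegrableOn (fun x : ℝ => Real.sin x * x ^ (p - 3)) (Ioi 0) := by
  refine integrableOn_Ioi_of_abs_le_rpow (by fun_prop) (a := p - 2) (b := p - 3) (K := 1)
    (by linarith) (by linarith) (fun x hx _ => ?_) (fun x hx => ?_)
  · rw [abs_mul, abs_of_pos (Real.rpow_pos_of_pos hx _), one_mul]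
    calc |Real.sin x| * x ^ (p - 3) ≤ x * x ^ (p - 3) := by
          gcongr
          have := Real.abs_sin_le_abs (x := x)
          rwa [abs_of_pos hx] at this
      _ = x ^ (p - 2) := by
          nth_rewrite 1 [← Real.rpow_one x]
          rw [← Real.rpow_add hx]; ring_nf
  · have hx0 : 0 < x := by linarith
    rw [abs_mul, abs_of_pos (Real.rpow_pos_of_pos hx0 _)]
    gcongr
    exact Real.abs_sin_le_one x

theorem one_sub_cos_le (x : ℝ) : 1 - Real.cos x ≤ x ^ 2 / 2 := by
  have := Real.one_sub_sq_div_two_le_cos (x := x)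
  linarith

theorem integrableOn_one_sub_cos_mul_rpow {p : ℝ} (h1 : 1 < p) (h2 : p < 2) :
    IntegrableOn (fun x : ℝ => (1 - Real.cos x) * x ^ (p - 4)) (Ioi 0) := by
  refine integrableOn_Ioi_of_abs_le_rpow (by fun_prop) (a := p - 2) (b := p - 4) (K := 2)
    (by linarith) (by linarith) (fun x hx _ => ?_) (fun x hx => ?_)
  · rw [abs_mul, abs_of_pos (Real.rpow_pos_of_pos hx _),
      abs_of_nonneg (by linarith [Real.cos_le_one x])]
    calc (1 - Real.cos x) * x ^ (p - 4) ≤ 2 * x ^ 2 * x ^ (p - 4) := by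
          gcongr
          have := one_sub_cos_le x
          nlinarith
      _ = 2 * x ^ (p - 2) := by
          rw [mul_assoc, ← Real.rpow_natCast, ← Real.rpow_add hx]
          push_cast; ring_nf
  · have hx0 : 0 < x := by linarith
    rw [abs_mul, abs_of_pos (Real.rpow_pos_of_pos hx0 _),
      abs_of_nonneg (by linarith [Real.cos_le_one x])]
    gcongr
    linarith [Real.neg_one_le_cos x]

/-- Integration by parts turns the oscillating integral into `3 - p` times the integral of `(1 - cos
x) x^(p-4)`, whose integrand is nonnegative. The result makes the tail constant of the stable
density positive. -/
theorem integral_sin_mul_rpow_pos {p : ℝ} (h1 : 1 < p) (h2 : p < 2) :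
    0 < ∫ x in Ioi (0 : ℝ), Real.sin x * x ^ (p - 3) := by
  have i1 := integrableOn_sin_mul_rpow h1 h2
  have i2 := integrableOn_one_sub_cos_mul_rpow h1 h2
  have hI : 0 < ∫ x in Ioi (0 : ℝ), (1 - Real.cos x) * x ^ (p - 4) := by
    rw [setIntegral_pos_iff_support_of_nonneg_ae _ i2]
    · have : Ioo (0 : ℝ) 1 ⊆ (Function.support fun x : ℝ => (1 - Real.cos x) * x ^ (p - 4)) ∩
          Ioi 0 := by
        intro v hv
        refine ⟨?_, hv.1⟩
        have : Real.cos v < 1 := by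
          have := Real.cos_lt_cos_of_nonneg_of_le_pi le_rfl
            (by linarith [hv.2, Real.pi_gt_three]) hv.1
          simpa using this
        have h2 : 0 < v ^ (p - 4) := Real.rpow_pos_of_pos hv.1 _
        exact (mul_pos (by linarith) h2).ne'
      exact lt_of_lt_of_le (by simp) (measure_mono this)
    · refine (ae_restrict_iff' measurableSet_Ioi).2 (Eventually.of_forall fun v hv => ?_)
      have h2 : 0 < v ^ (p - 4) := Real.rpow_pos_of_pos hv _
      exact mul_nonneg (by linarith [Real.cos_le_one v]) h2.le
  have hF := integral_Ioi_of_hasDerivAt_of_tendsto (a := 0) (m := 0)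
    (f := fun x : ℝ => (1 - Real.cos x) * x ^ (p - 3))
    (f' := fun x : ℝ => Real.sin x * x ^ (p - 3) - (3 - p) * ((1 - Real.cos x) * x ^ (p - 4)))
    ?_ ?_ ?_ ?_
  · rw [integral_sub i1 (i2.const_mul _), integral_const_mul] at hF
    simp only [Real.cos_zero, sub_self, zero_mul] at hF
    have : 0 < (3 - p) * ∫ x in Ioi (0 : ℝ), (1 - Real.cos x) * x ^ (p - 4) :=
      mul_pos (by linarith) hI
    linarith
  · rw [← continuousWithinAt_Ioi_iff_Ici, ContinuousWithinAt]
    simp only [Real.cos_zero, sub_self, zero_mul]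
    have hlim : Tendsto (fun x : ℝ => x ^ (p - 1)) (𝓝[>] 0) (𝓝 0) := by
      have := (Real.continuousAt_rpow_const 0 (p - 1) (Or.inr (by linarith))).tendsto
      rw [Real.zero_rpow (by linarith)] at this
      exact this.mono_left nhdsWithin_le_nhds
    refine squeeze_zero' ?_ ?_ hlim
    · filter_upwards [self_mem_nhdsWithin] with x hx
      exact mul_nonneg (by linarith [Real.cos_le_one x]) (Real.rpow_nonneg (le_of_lt hx) _)
    · filter_upwards [self_mem_nhdsWithin] with x hx
      have hx0 : 0 < x := hx
      calc (1 - Real.cos x) * x ^ (p - 3) ≤ x ^ 2 * x ^ (p - 3) := by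
            gcongr
            have := one_sub_cos_le x
            nlinarith
        _ = x ^ (p - 1) := by
            rw [← Real.rpow_natCast, ← Real.rpow_add hx0]
            push_cast; ring_nf
  · intro x hx
    have hx0 : 0 < x := hx
    have d1 : HasDerivAt (fun x => 1 - Real.cos x) (Real.sin x) x := by
      simpa using (Real.hasDerivAt_cos x).const_sub 1
    have d2 := d1.mul (Real.hasDerivAt_rpow_const (p := p - 3) (Or.inl hx0.ne'))
    refine d2.congr_deriv ?_
    rw [show p - 3 - 1 = p - 4 by ring]
    ring
  · exact i1.sub (i2.const_mul _)
  · have hlim : Tendsto (fun x : ℝ => 2 * x ^ (-(3 - p))) atTop (𝓝 0) := by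
      simpa using (tendsto_rpow_neg_atTop (y := 3 - p) (by linarith)).const_mul 2
    refine squeeze_zero' ?_ ?_ hlim
    · filter_upwards [eventually_gt_atTop 0] with x hx
      exact mul_nonneg (by linarith [Real.cos_le_one x]) (Real.rpow_nonneg (le_of_lt hx) _)
    · filter_upwards [eventually_gt_atTop 0] with x hx
      rw [neg_sub]
      gcongr
      linarith [Real.neg_one_le_cos x]

theorem tendsto_rpow_mul_exp_neg_rpow_atTop {p : ℝ} (hp : 1 < p) (a : ℝ) :
    Tendsto (fun t : ℝ => t ^ a * Real.exp (-t ^ p)) atTop (𝓝 0) := by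
  have h := rpow_mul_exp_neg_mul_rpow_isLittleO_exp_neg a hp (one_pos)
  have h2 : Tendsto (fun x : ℝ => Real.exp (-(1 / 2) * x)) atTop (𝓝 0) :=
    Real.tendsto_exp_atBot.comp (tendsto_id.const_mul_atTop_of_neg (by norm_num))
  have := h.trans_tendsto h2
  simpa using this

theorem hasDerivAt_rpow_mul_exp_neg_rpow {p a t : ℝ} (ht : 0 < t) :
    HasDerivAt (fun t : ℝ => t ^ a * Real.exp (-t ^ p))
      (a * (t ^ (a - 1) * Real.exp (-t ^ p)) - p * (t ^ (a + p - 1) * Real.exp (-t ^ p))) t := by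
  have d1 := Real.hasDerivAt_rpow_const (x := t) (p := a) (Or.inl ht.ne')
  have d2 := (Real.hasDerivAt_rpow_const (x := t) (p := p) (Or.inl ht.ne')).neg.exp
  refine (d1.mul d2).congr_deriv ?_
  rw [show a + p - 1 = a + (p - 1) by ring, Real.rpow_add ht]
  simp only [Pi.neg_apply]
  ring

/-- Threefold integration by parts for the cosine transform of `exp (-t^p)`. -/
theorem cosTransform_by_parts {p : ℝ} (h1 : 1 < p) (h2 : p < 2) {u : ℝ} (hu : 0 < u) :
    ∫ t in Ioi (0 : ℝ), Real.cos (t * u) * Real.exp (-t ^ p) =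
      (u ^ 3)⁻¹ * ∫ t in Ioi (0 : ℝ), Real.sin (t * u) * (t ^ (p - 3) *
        ((p * (p - 1) * (2 - p) + 3 * p ^ 2 * (p - 1) * t ^ p - p ^ 3 * (t ^ p) ^ 2) *
          Real.exp (-t ^ p))) := by
  set e : ℝ → ℝ → ℝ := fun a t => t ^ a * Real.exp (-t ^ p) with he
  have hd : ∀ a t, 0 < t → HasDerivAt (e a) (a * e (a - 1) t - p * e (a + p - 1) t) t :=
    fun a t ht => hasDerivAt_rpow_mul_exp_neg_rpow ht
  have hlim : ∀ a, Tendsto (e a) atTop (𝓝 0) := tendsto_rpow_mul_exp_neg_rpow_atTop h1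
  have hem : ∀ a, Measurable (e a) := fun a => by simp only [he]; fun_prop
  have hei : ∀ a, -1 < a → IntegrableOn (e a) (Ioi 0) := fun a ha =>
    integrableOn_rpow_mul_exp_neg_rpow ha (by linarith)
  have hbi : ∀ (b : ℝ → ℝ) (a : ℝ), Measurable b → (∀ t, |b t| ≤ 1) → -1 < a →
      IntegrableOn (fun t => b t * e a t) (Ioi 0) := fun b a hb hb1 ha => by
    refine (hei a ha).mono' (hb.mul (hem a)).aestronglyMeasurable ?_
    refine (ae_restrict_iff' measurableSet_Ioi).2 (Eventually.of_forall fun t ht => ?_)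
    have : 0 ≤ e a t := mul_nonneg (Real.rpow_nonneg (le_of_lt ht) _) (Real.exp_pos _).le
    rw [norm_mul, Real.norm_eq_abs, Real.norm_eq_abs, abs_of_nonneg this]
    exact mul_le_of_le_one_left this (hb1 t)
  have hsi : IntegrableOn (fun t => Real.sin (t * u) * e (p - 3) t) (Ioi 0) := by
    have : Measurable fun t => Real.sin (t * u) * e (p - 3) t := by
      have := hem (p - 3)
      fun_prop
    refine ((hei (p - 2) (by linarith)).const_mul u).mono' this.aestronglyMeasurable ?_
    refine (ae_restrict_iff' measurableSet_Ioi).2 (Eventually.of_forall fun t ht => ?_)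
    have ht0 : 0 < t := ht
    have h3 : 0 ≤ e (p - 3) t := by simp only [he]; positivity
    rw [norm_mul, Real.norm_eq_abs, Real.norm_eq_abs, abs_of_nonneg h3]
    have h4 : |Real.sin (t * u)| ≤ t * u := by
      have := Real.abs_sin_le_abs (x := t * u)
      rwa [abs_of_pos (mul_pos ht0 hu)] at this
    have h5 : t * e (p - 3) t = e (p - 2) t := by
      simp only [he]
      rw [← mul_assoc]
      nth_rewrite 1 [← Real.rpow_one t]
      rw [← Real.rpow_add ht0]; ring_nf
    calc |Real.sin (t * u)| * e (p - 3) t ≤ t * u * e (p - 3) t := by gcongr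
      _ = u * e (p - 2) t := by rw [← h5]; ring
  have hcos : IntegrableOn (fun t => Real.cos (t * u) * e 0 t) (Ioi 0) :=
    hbi _ _ (by fun_prop) (fun t => Real.abs_cos_le_one _) (by norm_num)
  have hs1 : IntegrableOn (fun t => Real.sin (t * u) * e (2 * p - 3) t) (Ioi 0) :=
    hbi _ _ (by fun_prop) (fun t => Real.abs_sin_le_one _) (by linarith)
  have hs2 : IntegrableOn (fun t => Real.sin (t * u) * e (3 * p - 3) t) (Ioi 0) :=
    hbi _ _ (by fun_prop) (fun t => Real.abs_sin_le_one _) (by linarith)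
  set g : ℝ → ℝ := fun t => Real.sin (t * u) * (p * (p - 1) * (2 - p) * e (p - 3) t +
    3 * p ^ 2 * (p - 1) * e (2 * p - 3) t - p ^ 3 * e (3 * p - 3) t) with hg
  have hgi : IntegrableOn g (Ioi 0) := by
    refine (((hsi.const_mul (p * (p - 1) * (2 - p))).add (hs1.const_mul (3 * p ^ 2 * (p - 1)))).sub
      (hs2.const_mul (p ^ 3))).congr (Eventually.of_forall fun t => ?_)
    simp only [hg, Pi.add_apply, Pi.sub_apply]
    ring
  have hgeq : ∀ t ∈ Ioi (0 : ℝ), Real.sin (t * u) * (t ^ (p - 3) *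
        ((p * (p - 1) * (2 - p) + 3 * p ^ 2 * (p - 1) * t ^ p - p ^ 3 * (t ^ p) ^ 2) *
          Real.exp (-t ^ p))) = g t := by
    intro t ht
    have ht0 : 0 < t := ht
    simp only [hg, he]
    rw [show 2 * p - 3 = (p - 3) + p by ring, show 3 * p - 3 = (p - 3) + p + p by ring,
      Real.rpow_add ht0, Real.rpow_add ht0, Real.rpow_add ht0]
    ring
  rw [setIntegral_congr_fun measurableSet_Ioi hgeq]
  -- All three integrations by parts are done at once: `f` gathers their boundary terms. Three are
  -- needed because only then is the remaining power `t^(p-3)`, after the substitution `x = t u`,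
  -- absolutely integrable at infinity against the sine.
  have hFTC := integral_Ioi_of_hasDerivAt_of_tendsto (a := 0) (m := 0)
    (f := fun t : ℝ => Real.sin (t * u) * e 0 t / u + Real.cos (t * u) * (-p * e (p - 1) t) / u ^ 2 -
      Real.sin (t * u) * (p ^ 2 * e (2 * p - 2) t - p * (p - 1) * e (p - 2) t) / u ^ 3)
    (f' := fun t : ℝ => Real.cos (t * u) * e 0 t - (u ^ 3)⁻¹ * g t) ?_ ?_ ?_ ?_
  · rw [integral_sub hcos (hgi.const_mul _), integral_const_mul] at hFTC
    have h0 : e (p - 1) 0 = 0 := by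
      simp only [he]; rw [Real.zero_rpow (by linarith), zero_mul]
    simp only [zero_mul, Real.sin_zero, h0, mul_zero, zero_div, add_zero, sub_zero] at hFTC
    have h5 : ∀ t, Real.cos (t * u) * e 0 t = Real.cos (t * u) * Real.exp (-t ^ p) := fun t => by
      simp [he]
    simp_rw [h5] at hFTC
    linarith
  · rw [← continuousWithinAt_Ioi_iff_Ici, ContinuousWithinAt]
    have c1 : ∀ a, 0 ≤ a → ContinuousAt (e a) 0 := fun a ha => by
      have hc1 : ContinuousAt (fun t : ℝ => t ^ a) 0 := Real.continuousAt_rpow_const 0 a (Or.inr ha)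
      have hc2 : ContinuousAt (fun t : ℝ => t ^ p) 0 :=
        Real.continuousAt_rpow_const 0 p (Or.inr (by linarith))
      exact hc1.mul (Real.continuous_exp.continuousAt.comp hc2.neg)
    have c1' : ∀ a, 0 ≤ a → Tendsto (e a) (𝓝[>] 0) (𝓝 (e a 0)) := fun a ha =>
      (c1 a ha).tendsto.mono_left nhdsWithin_le_nhds
    have c2 : Tendsto (fun t => Real.sin (t * u)) (𝓝[>] 0) (𝓝 (Real.sin (0 * u))) :=
      (Continuous.tendsto (by fun_prop) _).mono_left nhdsWithin_le_nhds
    have c3 : Tendsto (fun t => Real.cos (t * u)) (𝓝[>] 0) (𝓝 (Real.cos (0 * u))) :=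
      (Continuous.tendsto (by fun_prop) _).mono_left nhdsWithin_le_nhds
    -- Here the power of `t` is negative, but the sine supplies one more power, and `t^(p-1)` tends
    -- to zero as `p > 1`.
    have c4 : Tendsto (fun t => Real.sin (t * u) * e (p - 2) t) (𝓝[>] 0) (𝓝 0) := by
      have h6 : Tendsto (fun t => u * e (p - 1) t) (𝓝[>] 0) (𝓝 0) := by
        have := (c1' (p - 1) (by linarith)).const_mul u
        simp only [he] at this
        rw [Real.zero_rpow (by linarith), zero_mul, mul_zero] at this
        exact this
      refine squeeze_zero_norm' ?_ h6
      filter_upwards [self_mem_nhdsWithin] with t ht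
      have ht0 : 0 < t := ht
      have h3 : 0 ≤ e (p - 2) t := by simp only [he]; positivity
      rw [norm_mul, Real.norm_eq_abs, Real.norm_eq_abs, abs_of_nonneg h3]
      have h4 : |Real.sin (t * u)| ≤ t * u := by
        have := Real.abs_sin_le_abs (x := t * u)
        rwa [abs_of_pos (mul_pos ht0 hu)] at this
      have h5 : t * e (p - 2) t = e (p - 1) t := by
        simp only [he]
        rw [← mul_assoc]
        nth_rewrite 1 [← Real.rpow_one t]
        rw [← Real.rpow_add ht0]; ring_nf
      calc |Real.sin (t * u)| * e (p - 2) t ≤ t * u * e (p - 2) t := by gcongr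
        _ = u * e (p - 1) t := by rw [← h5]; ring
    have := (((c2.mul (c1' 0 le_rfl)).div_const u).add ((c3.mul ((c1' (p - 1)
      (by linarith)).const_mul (-p))).div_const (u ^ 2))).sub
      (((c2.mul ((c1' (2 * p - 2) (by linarith)).const_mul (p ^ 2))).sub
        (c4.const_mul (p * (p - 1)))).div_const (u ^ 3))
    convert this using 1
    · ext t
      ring
    · simp
  · intro t ht
    have ht0 : 0 < t := ht
    have hs : HasDerivAt (fun t => Real.sin (t * u)) (Real.cos (t * u) * u) t := by
      simpa using ((hasDerivAt_id t).mul_const u).sin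
    have hc : HasDerivAt (fun t => Real.cos (t * u)) (-Real.sin (t * u) * u) t := by
      simpa using ((hasDerivAt_id t).mul_const u).cos
    have D := (((hs.mul (hd 0 t ht0)).div_const u).add ((hc.mul ((hd (p - 1) t ht0).const_mul
      (-p))).div_const (u ^ 2))).sub ((hs.mul (((hd (2 * p - 2) t ht0).const_mul (p ^ 2)).sub
        ((hd (p - 2) t ht0).const_mul (p * (p - 1))))).div_const (u ^ 3))
    refine D.congr_deriv ?_
    simp only [hg, Pi.sub_apply]
    rw [show (0 : ℝ) + p - 1 = p - 1 by ring, show p - 1 - 1 = p - 2 by ring,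
      show p - 1 + p - 1 = 2 * p - 2 by ring, show 2 * p - 2 - 1 = 2 * p - 3 by ring,
      show 2 * p - 2 + p - 1 = 3 * p - 3 by ring, show p - 2 - 1 = p - 3 by ring,
      show p - 2 + p - 1 = 2 * p - 3 by ring]
    field_simp
    ring
  · exact hcos.sub (hgi.const_mul _)
  · have b1 : ∀ (b : ℝ → ℝ) a, (∀ t, |b t| ≤ 1) → Tendsto (fun t => b t * e a t) atTop (𝓝 0) :=
      fun b a hb => by
        refine squeeze_zero_norm (a := fun t => |e a t|) (fun t => ?_) (by simpa using (hlim a).abs)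
        rw [norm_mul]
        exact mul_le_of_le_one_left (abs_nonneg _) (hb t)
    have s1 : ∀ a, Tendsto (fun t => Real.sin (t * u) * e a t) atTop (𝓝 0) := fun a =>
      b1 _ a fun t => Real.abs_sin_le_one _
    have s2 : ∀ a, Tendsto (fun t => Real.cos (t * u) * e a t) atTop (𝓝 0) := fun a =>
      b1 _ a fun t => Real.abs_cos_le_one _
    have := (((s1 0).div_const u).add (((s2 (p - 1)).const_mul (-p)).div_const (u ^ 2))).sub
      ((((s1 (2 * p - 2)).const_mul (p ^ 2)).sub
        ((s1 (p - 2)).const_mul (p * (p - 1)))).div_const (u ^ 3))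
    convert this using 1
    · ext t
      ring
    · simp

/-- The exact decay of the cosine transform of `exp (-t^p)`, `1 < p < 2`. -/
theorem tendsto_rpow_mul_cosTransform {p : ℝ} (h1 : 1 < p) (h2 : p < 2) :
    Tendsto (fun u : ℝ => u ^ (1 + p) * ∫ t in Ioi (0 : ℝ), Real.cos (t * u) * Real.exp (-t ^ p))
      atTop (𝓝 (p * (p - 1) * (2 - p) * ∫ x in Ioi (0 : ℝ), Real.sin x * x ^ (p - 3))) := by
  set A := p * (p - 1) * (2 - p) with hA
  set B := 3 * p ^ 2 * (p - 1) with hB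
  have hA0 : 0 ≤ A := mul_nonneg (mul_nonneg (by linarith) (by linarith)) (by linarith)
  have hB0 : 0 ≤ B := mul_nonneg (by positivity) (by linarith)
  set Ψ : ℝ → ℝ := fun z => (A + B * z - p ^ 3 * z ^ 2) * Real.exp (-z) with hΨ
  have hΨb : ∀ z, 0 ≤ z → |Ψ z| ≤ A + B + p ^ 3 * 2 := by
    intro z hz
    have e1 : Real.exp (-z) ≤ 1 := Real.exp_le_one_iff.2 (by linarith)
    have e2 : z * Real.exp (-z) ≤ 1 := by
      rw [Real.exp_neg, ← div_eq_mul_inv, div_le_one (Real.exp_pos z)]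
      linarith [Real.add_one_le_exp z]
    have e3 : z ^ 2 * Real.exp (-z) ≤ 2 := by
      rw [Real.exp_neg, ← div_eq_mul_inv, div_le_iff₀ (Real.exp_pos z)]
      have := Real.quadratic_le_exp_of_nonneg hz
      nlinarith
    have e4 := Real.exp_pos (-z)
    have hp3 : 0 ≤ p ^ 3 := by positivity
    have hz1 : 0 ≤ z * Real.exp (-z) := by positivity
    have hz2 : 0 ≤ z ^ 2 * Real.exp (-z) := by positivity
    have : Ψ z = A * Real.exp (-z) + B * (z * Real.exp (-z)) - p ^ 3 * (z ^ 2 * Real.exp (-z)) := by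
      simp only [hΨ]; ring
    rw [this, abs_le]
    constructor <;> nlinarith [mul_le_mul_of_nonneg_left e1 hA0, mul_le_mul_of_nonneg_left e2 hB0,
      mul_le_mul_of_nonneg_left e3 hp3, mul_nonneg hA0 e4.le, mul_nonneg hB0 hz1,
      mul_nonneg hp3 hz2]
  -- Substituting `t = x / u` moves all dependence on `u` into the bounded factor `Ψ`, which tends
  -- to `Ψ 0 = A`; dominated convergence then applies.
  have heq : ∀ᶠ u : ℝ in atTop, ∫ x in Ioi (0 : ℝ), Real.sin x * x ^ (p - 3) * Ψ ((x / u) ^ p) =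
      u ^ (1 + p) * ∫ t in Ioi (0 : ℝ), Real.cos (t * u) * Real.exp (-t ^ p) := by
    filter_upwards [eventually_gt_atTop 0] with u hu
    rw [cosTransform_by_parts h1 h2 hu]
    have h3 := integral_comp_mul_left_Ioi' (fun t => Real.sin (t * u) * (t ^ (p - 3) *
        ((A + B * t ^ p - p ^ 3 * (t ^ p) ^ 2) * Real.exp (-t ^ p)))) 0 (inv_pos.2 hu)
    rw [mul_zero] at h3
    rw [← h3, smul_eq_mul, ← mul_assoc, ← mul_assoc, ← integral_const_mul]
    refine setIntegral_congr_fun measurableSet_Ioi fun x hx => ?_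
    have hx0 : 0 < x := hx
    simp only [hΨ]
    rw [show u⁻¹ * x * u = x by field_simp, show u⁻¹ * x = x / u by field_simp,
      Real.div_rpow hx0.le hu.le (p - 3)]
    have h4 : u ^ (1 + p) * (u ^ 3)⁻¹ * u⁻¹ * (u ^ (p - 3))⁻¹ = 1 := by
      rw [← Real.rpow_natCast u 3, ← Real.rpow_neg hu.le, ← Real.rpow_neg_one,
        ← Real.rpow_neg hu.le, ← Real.rpow_add hu, ← Real.rpow_add hu, ← Real.rpow_add hu]
      rw [show 1 + p + -((3 : ℕ) : ℝ) + -1 + -(p - 3) = 0 by push_cast; ring, Real.rpow_zero]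
    rw [div_eq_mul_inv (x ^ (p - 3))]
    linear_combination (-Real.sin x * x ^ (p - 3) * ((A + B * (x / u) ^ p -
      p ^ 3 * ((x / u) ^ p) ^ 2) * Real.exp (-(x / u) ^ p))) * h4
  refine Tendsto.congr' heq ?_
  have hlim : A * ∫ x in Ioi (0 : ℝ), Real.sin x * x ^ (p - 3) =
      ∫ x in Ioi (0 : ℝ), Real.sin x * x ^ (p - 3) * Ψ 0 := by
    rw [integral_mul_const, mul_comm]
    simp [hΨ]
  rw [hlim]
  have hi := integrableOn_sin_mul_rpow h1 h2
  refine tendsto_integral_filter_of_dominated_convergence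
    (fun x => |Real.sin x * x ^ (p - 3)| * (A + B + p ^ 3 * 2)) ?_ ?_ ?_ ?_
  · refine Eventually.of_forall fun u => ?_
    have : Measurable fun x : ℝ => Real.sin x * x ^ (p - 3) * Ψ ((x / u) ^ p) := by
      simp only [hΨ]; fun_prop
    exact this.aestronglyMeasurable
  · filter_upwards [eventually_gt_atTop 0] with u hu
    refine (ae_restrict_iff' measurableSet_Ioi).2 (Eventually.of_forall fun x hx => ?_)
    have hx0 : 0 < x := hx
    rw [norm_mul, Real.norm_eq_abs, Real.norm_eq_abs]
    gcongr
    exact hΨb _ (by positivity)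
  · exact hi.abs.mul_const _
  · refine Eventually.of_forall fun x => Tendsto.const_mul _ ?_
    have c1 : Continuous Ψ := by simp only [hΨ]; fun_prop
    have c2 : Tendsto (fun u : ℝ => (x / u) ^ p) atTop (𝓝 ((0 : ℝ) ^ p)) :=
      ((Real.continuousAt_rpow_const 0 p (Or.inr (by linarith))).tendsto).comp
        (tendsto_const_nhds.div_atTop tendsto_id)
    rw [Real.zero_rpow (by linarith)] at c2
    exact (c1.tendsto 0).comp c2

/-! ### The stable density: positivity, decay and characteristic function. -/

theorem integrableOn_exp_neg_rpow {p : ℝ} (hp : 0 < p) :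
    IntegrableOn (fun t : ℝ => Real.exp (-t ^ p)) (Ioi 0) := by
  have := integrableOn_rpow_mul_exp_neg_rpow (s := 0) (by norm_num) hp
  simpa using this

theorem stableDensity_neg (p x : ℝ) : stableDensity p (-x) = stableDensity p x := by
  simp [stableDensity, mul_neg, Real.cos_neg]

theorem stableDensity_abs (p x : ℝ) : stableDensity p |x| = stableDensity p x := by
  rcases abs_cases x with ⟨h, _⟩ | ⟨h, _⟩ <;> rw [h]
  exact stableDensity_neg p x

theorem abs_cos_mul_exp_le (x t c : ℝ) : ‖Real.cos x * Real.exp (-t ^ c)‖ ≤ Real.exp (-t ^ c) := by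
  rw [norm_mul, Real.norm_eq_abs, Real.norm_eq_abs, Real.abs_exp]
  exact mul_le_of_le_one_left (Real.exp_pos _).le (Real.abs_cos_le_one _)

theorem continuous_stableDensity {p : ℝ} (hp : 0 < p) : Continuous (stableDensity p) := by
  refine continuous_const.mul ?_
  refine continuous_of_dominated (bound := fun t => Real.exp (-t ^ p)) (fun x => ?_)
    (fun x => Eventually.of_forall fun t => abs_cos_mul_exp_le _ _ _) (integrableOn_exp_neg_rpow hp)
    (Eventually.of_forall fun t => by fun_prop)
  have : Measurable fun t : ℝ => Real.cos (t * x) * Real.exp (-t ^ p) := by fun_prop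
  exact this.aestronglyMeasurable

theorem stableDensity_one (x : ℝ) : stableDensity 1 x = (1 / Real.pi) * (1 / (1 + x ^ 2)) := by
  simp only [stableDensity, Real.rpow_one]
  rw [integral_cos_mul_exp_neg]

theorem stableDensity_two (x : ℝ) :
    stableDensity 2 x = (1 / Real.pi) * (Real.sqrt Real.pi / 2 * Real.exp (-x ^ 2 / 4)) := by
  simp only [stableDensity]
  have := integral_cos_mul_exp_neg_mul_sq one_pos x
  simp only [div_one, mul_one, neg_mul, one_mul] at this
  simp only [Real.rpow_two, this]

theorem stableDensity_nonneg {p : ℝ} (h1 : 1 ≤ p) (h2 : p ≤ 2) (x : ℝ) : 0 ≤ stableDensity p x := by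
  rcases h2.eq_or_lt with rfl | h2
  · rw [stableDensity_two]; positivity
  · exact mul_nonneg (by positivity) (cosTransform_exp_neg_rpow_nonneg (by linarith) h2 x)

theorem stableDensity_two_le {u : ℝ} (hu : 0 < u) : stableDensity 2 u ≤ 32 * u ^ (-4 : ℝ) := by
  rw [stableDensity_two]
  have h1 : Real.exp (-u ^ 2 / 4) ≤ 32 * u ^ (-4 : ℝ) := by
    rw [show -u ^ 2 / 4 = -(u ^ 2 / 4) by ring, Real.exp_neg, Real.rpow_neg hu.le,
      show u ^ (4 : ℝ) = u ^ 4 by exact_mod_cast Real.rpow_natCast u 4, ← div_eq_mul_inv,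
      inv_eq_one_div, div_le_div_iff₀ (Real.exp_pos _) (by positivity)]
    have := Real.quadratic_le_exp_of_nonneg (x := u ^ 2 / 4) (by positivity)
    nlinarith [sq_nonneg u]
  have h2 : (1 / Real.pi) * (Real.sqrt Real.pi / 2) ≤ 1 := by
    have h3 : Real.sqrt Real.pi ≤ Real.pi := by
      rw [Real.sqrt_le_left (by positivity)]
      nlinarith [Real.pi_gt_three]
    rw [div_mul_div_comm, one_mul, div_le_one (by positivity)]
    linarith [Real.pi_pos]
  rw [← mul_assoc]
  calc _ ≤ 1 * Real.exp (-u ^ 2 / 4) := by gcongr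
    _ ≤ _ := by linarith

/-- Power decay of the stable density, with positive constant for `p < 2`. -/
theorem exists_tendsto_stableDensity {p : ℝ} (h1 : 1 ≤ p) (h2 : p ≤ 2) :
    ∃ c : ℝ, 0 ≤ c ∧ (p < 2 → 0 < c) ∧
      Tendsto (fun u : ℝ => u ^ (1 + p) * stableDensity p u) atTop (𝓝 c) := by
  rcases h2.eq_or_lt with rfl | h2
  · refine ⟨0, le_rfl, fun h => absurd h (lt_irrefl _), ?_⟩
    have hlim : Tendsto (fun u : ℝ => 32 * u ^ (-1 : ℝ)) atTop (𝓝 0) := by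
      simpa using (tendsto_rpow_neg_atTop (y := 1) one_pos).const_mul 32
    refine squeeze_zero' ?_ ?_ hlim
    · filter_upwards [eventually_gt_atTop 0] with u hu
      exact mul_nonneg (by positivity) (stableDensity_nonneg h1 le_rfl u)
    · filter_upwards [eventually_gt_atTop 0] with u hu
      calc u ^ (1 + 2 : ℝ) * stableDensity 2 u ≤ u ^ (1 + 2 : ℝ) * (32 * u ^ (-4 : ℝ)) := by
            gcongr; exact stableDensity_two_le hu
        _ = 32 * (u ^ (1 + 2 : ℝ) * u ^ (-4 : ℝ)) := by ring
        _ = 32 * u ^ (-1 : ℝ) := by rw [← Real.rpow_add hu]; norm_num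
  rcases h1.eq_or_lt with rfl | h1
  · refine ⟨1 / Real.pi, by positivity, fun _ => by positivity, ?_⟩
    have h3 : Tendsto (fun u : ℝ => 1 / Real.pi * (1 - (1 + u ^ 2)⁻¹)) atTop
        (𝓝 (1 / Real.pi * (1 - 0))) := by
      refine (Tendsto.const_sub 1 (Tendsto.inv_tendsto_atTop ?_)).const_mul _
      exact tendsto_atTop_add_const_left _ _ (tendsto_pow_atTop two_ne_zero)
    rw [sub_zero, mul_one] at h3
    refine h3.congr' ?_
    filter_upwards [eventually_gt_atTop 0] with u hu
    rw [stableDensity_one, show (1 + 1 : ℝ) = 2 by norm_num, Real.rpow_two]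
    field_simp
    ring
  · refine ⟨(1 / Real.pi) * (p * (p - 1) * (2 - p) *
      ∫ x in Ioi (0 : ℝ), Real.sin x * x ^ (p - 3)), ?_, fun _ => ?_, ?_⟩
    rotate_left
    · have := integral_sin_mul_rpow_pos h1 h2
      have h3 : 0 < p - 1 := by linarith
      have h4 : 0 < 2 - p := by linarith
      positivity
    · refine ((tendsto_rpow_mul_cosTransform h1 h2).const_mul (1 / Real.pi)).congr fun u => ?_
      simp only [stableDensity]
      ring
    · have := integral_sin_mul_rpow_pos h1 h2
      have h3 : 0 < p - 1 := by linarith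
      have h4 : 0 < 2 - p := by linarith
      positivity

/-- Beyond some `U` the limit of `u^(1+p) h(u)` gives the tail bound; below `U` the supremum of `h`
does. One constant depending on `p` only serves both purposes. -/
theorem exists_stableDensity_bound {p : ℝ} (h1 : 1 ≤ p) (h2 : p ≤ 2) :
    ∃ K : ℝ, 0 < K ∧ (∀ u, stableDensity p u ≤ K) ∧
      ∀ u, 0 < u → stableDensity p u ≤ K * u ^ (-1 - p) := by
  have hp : 0 < p := by linarith
  obtain ⟨c, hc0, -, hc⟩ := exists_tendsto_stableDensity h1 h2
  set B := (1 / Real.pi) * ∫ t in Ioi (0 : ℝ), Real.exp (-t ^ p) with hB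
  have hBu : ∀ u, stableDensity p u ≤ B := fun u => by
    refine mul_le_mul_of_nonneg_left ?_ (by positivity)
    have hi : IntegrableOn (fun t : ℝ => Real.cos (t * u) * Real.exp (-t ^ p)) (Ioi 0) := by
      refine (integrableOn_exp_neg_rpow hp).mono' ?_
        (Eventually.of_forall fun t => abs_cos_mul_exp_le _ _ _)
      have : Measurable fun t : ℝ => Real.cos (t * u) * Real.exp (-t ^ p) := by fun_prop
      exact this.aestronglyMeasurable
    exact integral_mono hi (integrableOn_exp_neg_rpow hp) fun t =>
      (le_abs_self _).trans (abs_cos_mul_exp_le _ _ _)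
  have hB0 : 0 ≤ B := (stableDensity_nonneg h1 h2 0).trans (hBu 0)
  have hev := hc.eventually (gt_mem_nhds (show c < c + 1 by linarith))
  obtain ⟨U, hU⟩ := (hev.and (eventually_ge_atTop 1)).exists_forall_of_atTop
  have hU1 : 1 ≤ U := (hU U le_rfl).2
  have hU0 : 0 < U := by linarith
  have hUp : 0 < U ^ (1 + p) := by positivity
  refine ⟨B + (c + 1) + B * U ^ (1 + p), by positivity, fun u => ?_, fun u hu => ?_⟩
  · have := hBu u
    have : 0 ≤ B * U ^ (1 + p) := by positivity
    linarith [hBu u]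
  · have hneg : u ^ (-1 - p) = (u ^ (1 + p))⁻¹ := by
      rw [← Real.rpow_neg hu.le]; ring_nf
    have hup : 0 < u ^ (1 + p) := by positivity
    rw [hneg, ← div_eq_mul_inv, le_div_iff₀ hup]
    rcases le_total U u with h | h
    · have := (hU u h).1
      have : 0 ≤ B * U ^ (1 + p) := by positivity
      linarith
    · have h3 : u ^ (1 + p) ≤ U ^ (1 + p) := Real.rpow_le_rpow hu.le h (by linarith)
      have := mul_le_mul (hBu u) h3 hup.le hB0
      linarith

theorem integrable_of_even {k : ℝ → ℝ} (heven : ∀ t, k (-t) = k t) (hk : IntegrableOn k (Ioi 0)) :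
    Integrable k := by
  rw [← integrableOn_univ, ← Iic_union_Ioi (a := (0 : ℝ))]
  refine IntegrableOn.union ?_ hk
  rw [integrableOn_Iic_iff_integrableOn_Iio]
  have h := (Measure.measurePreserving_neg (volume : Measure ℝ)).integrableOn_comp_preimage
    (Homeomorph.neg ℝ).measurableEmbedding (f := k) (s := Ioi 0)
  have h2 : (k ∘ Neg.neg) = k := funext heven
  rw [h2] at h
  have h3 : Neg.neg ⁻¹' Ioi (0 : ℝ) = Iio 0 := by ext x; simp
  rw [h3] at h
  exact h.2 hk

theorem integrable_stableDensity {p : ℝ} (h1 : 1 ≤ p) (h2 : p ≤ 2) :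
    Integrable (stableDensity p) := by
  obtain ⟨K, hK, hb, hu⟩ := exists_stableDensity_bound h1 h2
  have hi : IntegrableOn (stableDensity p) (Ioi 0) := by
    refine integrableOn_Ioi_of_abs_le_rpow (continuous_stableDensity (by linarith)).measurable
      (a := 0) (b := -1 - p) (K := K) (by norm_num) (by linarith) (fun x hx _ => ?_)
      (fun x hx => ?_)
    · rw [abs_of_nonneg (stableDensity_nonneg h1 h2 x), Real.rpow_zero, mul_one]
      exact hb x
    · rw [abs_of_nonneg (stableDensity_nonneg h1 h2 x)]
      exact hu x (by linarith)
  exact integrable_of_even (stableDensity_neg p) hi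

/-- Fourier integrals of even functions are real. -/
theorem integral_cexp_mul_even {k : ℝ → ℝ} (hk : Integrable k) (heven : ∀ t, k (-t) = k t) (a : ℝ) :
    ∫ t, Complex.exp (((a * t : ℝ) : ℂ) * Complex.I) * (k t : ℂ) =
      ((∫ t, Real.cos (a * t) * k t : ℝ) : ℂ) := by
  have hF : Integrable fun t : ℝ => Complex.exp (((a * t : ℝ) : ℂ) * Complex.I) * (k t : ℂ) := by
    refine hk.norm.mono' ?_ (Eventually.of_forall fun t => ?_)
    · exact (by fun_prop : Continuous fun t : ℝ =>
        Complex.exp (((a * t : ℝ) : ℂ) * Complex.I)).aestronglyMeasurable.mul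
          (Complex.continuous_ofReal.comp_aestronglyMeasurable hk.aestronglyMeasurable)
    · rw [norm_mul, Complex.norm_exp_ofReal_mul_I, one_mul, Complex.norm_real]
  have h1 := integral_neg_eq_self
    (fun t : ℝ => Complex.exp (((a * t : ℝ) : ℂ) * Complex.I) * (k t : ℂ)) volume
  have h2 : (∫ t, Complex.exp (((a * t : ℝ) : ℂ) * Complex.I) * (k t : ℂ)) +
      ∫ t, Complex.exp (((a * -t : ℝ) : ℂ) * Complex.I) * (k (-t) : ℂ) =
      2 * ((∫ t, Real.cos (a * t) * k t : ℝ) : ℂ) := by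
    rw [← integral_add hF hF.comp_neg, ← integral_complex_ofReal, ← integral_const_mul]
    congr 1
    ext t
    rw [heven, Complex.ofReal_mul (Real.cos (a * t)), Complex.ofReal_cos, Complex.cos]
    push_cast
    ring_nf
  rw [h1] at h2
  have h3 : ∀ z w : ℂ, z + z = 2 * w → z = w := fun z w h => by linear_combination h / 2
  exact h3 _ _ h2

theorem continuous_exp_neg_abs_rpow {p : ℝ} (hp : 0 < p) :
    Continuous fun t : ℝ => Real.exp (-|t| ^ p) := by
  have : Continuous fun t : ℝ => |t| ^ p :=
    continuous_abs.rpow_const fun _ => Or.inr hp.le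
  fun_prop

theorem integrable_exp_neg_abs_rpow {p : ℝ} (hp : 0 < p) :
    Integrable fun t : ℝ => Real.exp (-|t| ^ p) := by
  refine integrable_of_even (fun x => by simp) ?_
  refine (integrableOn_exp_neg_rpow hp).congr_fun (fun t ht => ?_) measurableSet_Ioi
  simp only [abs_of_pos (show (0 : ℝ) < t from ht)]

theorem integral_cos_mul_exp_neg_abs_rpow (p a : ℝ) :
    ∫ t, Real.cos (a * t) * Real.exp (-|t| ^ p) = 2 * Real.pi * stableDensity p a := by
  have h : ∀ t : ℝ, Real.cos (a * t) * Real.exp (-|t| ^ p) =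
      Real.cos (|t| * a) * Real.exp (-|t| ^ p) := fun t => by
    congr 1
    rcases abs_cases t with ⟨h, _⟩ | ⟨h, _⟩ <;> rw [h]
    · rw [mul_comm]
    · rw [neg_mul, Real.cos_neg, mul_comm]
  simp_rw [h]
  rw [integral_comp_abs (f := fun t => Real.cos (t * a) * Real.exp (-t ^ p)), stableDensity]
  generalize ∫ t in Ioi (0 : ℝ), Real.cos (t * a) * Real.exp (-t ^ p) = I
  field_simp

open FourierTransform in
/-- The cosine transform of the stable density. -/
theorem integral_cos_mul_stableDensity {p : ℝ} (h1 : 1 ≤ p) (h2 : p ≤ 2) (a : ℝ) :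
    ∫ x, Real.cos (a * x) * stableDensity p x = Real.exp (-|a| ^ p) := by
  have hp : 0 < p := by linarith
  set f : ℝ → ℂ := fun t => (Real.exp (-|t| ^ p) : ℝ) with hf
  have hfc : Continuous f := Complex.continuous_ofReal.comp (continuous_exp_neg_abs_rpow hp)
  have hfi : Integrable f := (integrable_exp_neg_abs_rpow hp).ofReal
  have hF : 𝓕 f = fun ξ => ((2 * Real.pi * stableDensity p (2 * Real.pi * ξ) : ℝ) : ℂ) := by
    ext ξ
    rw [Real.fourier_real_eq_integral_exp_smul]
    have := integral_cexp_mul_even (integrable_exp_neg_abs_rpow hp) (fun t => by simp)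
      (-2 * Real.pi * ξ)
    rw [integral_cos_mul_exp_neg_abs_rpow] at this
    rw [show -2 * Real.pi * ξ = -(2 * Real.pi * ξ) by ring, stableDensity_neg] at this
    rw [← this]
    congr 1
    ext t
    rw [smul_eq_mul]
    congr 3
    push_cast; ring
  have hpi : (2 * Real.pi) ≠ 0 := by positivity
  have hi2 : Integrable fun ξ => 2 * Real.pi * stableDensity p (2 * Real.pi * ξ) :=
    ((integrable_stableDensity h1 h2).comp_mul_left' hpi).const_mul _
  have hFi : Integrable (𝓕 f) := by rw [hF]; exact hi2.ofReal
  -- Fourier inversion for `exp (-|t|^p)`: its transform is a rescaled stable density, integrable by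
  -- the tail bound.
  have hinv := congrFun (hfc.fourierInv_fourier_eq hfi hFi) a
  rw [Real.fourierInv_eq', hF] at hinv
  have h3 := integral_cexp_mul_even hi2 (fun t => by rw [mul_neg, stableDensity_neg])
    (2 * Real.pi * a)
  have h4 : ∀ v : ℝ, Complex.exp (((2 * Real.pi * inner ℝ v a : ℝ) : ℂ) * Complex.I) •
      ((2 * Real.pi * stableDensity p (2 * Real.pi * v) : ℝ) : ℂ) =
      Complex.exp (((2 * Real.pi * a * v : ℝ) : ℂ) * Complex.I) *
      ((2 * Real.pi * stableDensity p (2 * Real.pi * v) : ℝ) : ℂ) := fun v => by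
    rw [smul_eq_mul]
    congr 3
    simp
    ring
  simp_rw [h4] at hinv
  rw [h3] at hinv
  have h5 := Complex.ofReal_injective hinv
  rw [← h5]
  have h6 := Measure.integral_comp_mul_left (fun x => Real.cos (a * x) * stableDensity p x)
    (2 * Real.pi)
  have h7 : ∀ v : ℝ, Real.cos (2 * Real.pi * a * v) *
      (2 * Real.pi * stableDensity p (2 * Real.pi * v)) =
      2 * Real.pi * (Real.cos (a * (2 * Real.pi * v)) * stableDensity p (2 * Real.pi * v)) :=
    fun v => by rw [show a * (2 * Real.pi * v) = 2 * Real.pi * a * v by ring]; ring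
  simp_rw [h7]
  rw [integral_const_mul, h6, abs_of_pos (by positivity), smul_eq_mul]
  field_simp

theorem integral_stableLaw {p : ℝ} (h1 : 1 ≤ p) (h2 : p ≤ 2) {E : Type*} [NormedAddCommGroup E]
    [NormedSpace ℝ E] (f : ℝ → E) :
    ∫ x, f x ∂stableLaw p = ∫ x, stableDensity p x • f x := by
  have hm : Measurable fun x => ENNReal.ofReal (stableDensity p x) :=
    (continuous_stableDensity (by linarith)).measurable.ennreal_ofReal
  rw [stableLaw, integral_withDensity_eq_integral_toReal_smul hm
    (Eventually.of_forall fun x => ENNReal.ofReal_lt_top)]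
  simp_rw [ENNReal.toReal_ofReal (stableDensity_nonneg h1 h2 _)]

theorem isProbabilityMeasure_stableLaw {p : ℝ} (h1 : 1 ≤ p) (h2 : p ≤ 2) :
    IsProbabilityMeasure (stableLaw p) := by
  constructor
  rw [stableLaw, withDensity_apply _ MeasurableSet.univ, Measure.restrict_univ,
    ← ofReal_integral_eq_lintegral_ofReal (integrable_stableDensity h1 h2)
      (Eventually.of_forall fun x => stableDensity_nonneg h1 h2 x)]
  have := integral_cos_mul_stableDensity h1 h2 0
  simp only [zero_mul, Real.cos_zero, one_mul, abs_zero] at this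
  rw [this, Real.zero_rpow (by linarith)]
  simp

theorem integral_cos_stableLaw {p : ℝ} (h1 : 1 ≤ p) (h2 : p ≤ 2) (a : ℝ) :
    ∫ x, Real.cos (a * x) ∂stableLaw p = Real.exp (-|a| ^ p) := by
  rw [integral_stableLaw h1 h2, ← integral_cos_mul_stableDensity h1 h2 a]
  simp_rw [smul_eq_mul, mul_comm]

theorem charFun_stableLaw {p : ℝ} (h1 : 1 ≤ p) (h2 : p ≤ 2) (a : ℝ) :
    charFun (stableLaw p) a = (Real.exp (-|a| ^ p) : ℝ) := by
  rw [charFun_apply_real, integral_stableLaw h1 h2, ← integral_cos_mul_stableDensity h1 h2 a,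
    ← integral_cexp_mul_even (integrable_stableDensity h1 h2) (stableDensity_neg p) a]
  congr 1
  ext x
  rw [Complex.real_smul, mul_comm]
  push_cast
  rfl

theorem integrable_stableLaw_iff {p : ℝ} (h1 : 1 ≤ p) (h2 : p ≤ 2) {f : ℝ → ℝ} :
    Integrable f (stableLaw p) ↔ Integrable fun x => stableDensity p x * f x := by
  have hm : Measurable fun x => ENNReal.ofReal (stableDensity p x) :=
    (continuous_stableDensity (by linarith)).measurable.ennreal_ofReal
  rw [stableLaw, integrable_withDensity_iff hm
    (Eventually.of_forall fun x => ENNReal.ofReal_lt_top)]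
  simp_rw [ENNReal.toReal_ofReal (stableDensity_nonneg h1 h2 _), mul_comm]

/-! ### Monotonicity of the sine moments in the scale. -/

/-- `E |sin (a Z)|^q` for a standard symmetric `p`-stable `Z`. -/
def sinMoment (p q a : ℝ) : ℝ := ∫ x, |Real.sin (a * x)| ^ q ∂stableLaw p

theorem abs_sin_rpow_le_one {q : ℝ} (hq : 0 ≤ q) (y : ℝ) : |Real.sin y| ^ q ≤ 1 :=
  Real.rpow_le_one (abs_nonneg _) (Real.abs_sin_le_one _) hq

theorem integrable_of_abs_le {Ω : Type*} [MeasurableSpace Ω] {μ : Measure Ω} [IsFiniteMeasure μ]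
    {f : Ω → ℝ} (hf : Measurable f) {B : ℝ} (hB : ∀ x, |f x| ≤ B) : Integrable f μ :=
  Integrable.of_bound hf.aestronglyMeasurable B (Eventually.of_forall hB)

section Monotone

variable {p : ℝ}

/-- The expectations `E f(aZ) cos(baZ)` decrease in the scale `a ≥ 0`. -/
def DecreasingSpectrum (p : ℝ) (f : ℝ → ℝ) : Prop :=
  ∀ b : ℝ, 0 ≤ b → ∀ a a' : ℝ, 0 ≤ a → a ≤ a' →
    ∫ x, f (a' * x) * Real.cos (b * (a' * x)) ∂stableLaw p ≤
      ∫ x, f (a * x) * Real.cos (b * (a * x)) ∂stableLaw p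

theorem decreasingSpectrum_one (h1 : 1 ≤ p) (h2 : p ≤ 2) : DecreasingSpectrum p fun _ => 1 := by
  intro b hb a a' ha haa'
  simp only [one_mul, ← mul_assoc]
  rw [integral_cos_stableLaw h1 h2, integral_cos_stableLaw h1 h2]
  have ha' := ha.trans haa'
  rw [abs_of_nonneg (mul_nonneg hb ha), abs_of_nonneg (mul_nonneg hb ha')]
  gcongr

/-- By the product-to-sum formula, `(1 + c cos² y) cos (b y)` is a combination of cosines of
frequencies `b`, `b + 2` and `|b - 2|` with nonnegative coefficients, so the inequality for `f` is
applied at three frequencies. -/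
theorem DecreasingSpectrum.mul_one_add_cos_sq (h1 : 1 ≤ p) (h2 : p ≤ 2) {f : ℝ → ℝ}
    (hf : DecreasingSpectrum p f) (hm : Measurable f) {B : ℝ} (hB : ∀ x, |f x| ≤ B) {c : ℝ}
    (hc : 0 ≤ c) : DecreasingSpectrum p fun y => f y * (1 + c * Real.cos y ^ 2) := by
  have := isProbabilityMeasure_stableLaw h1 h2
  have hi : ∀ b a : ℝ, Integrable (fun x => f (a * x) * Real.cos (b * (a * x))) (stableLaw p) :=
    fun b a => by
      refine integrable_of_abs_le (B := B) (by fun_prop) fun x => ?_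
      rw [abs_mul]
      exact (mul_le_of_le_one_right (abs_nonneg _) (Real.abs_cos_le_one _)).trans (hB _)
  have key : ∀ b a : ℝ, ∫ x, f (a * x) * (1 + c * Real.cos (a * x) ^ 2) *
      Real.cos (b * (a * x)) ∂stableLaw p =
      (1 + c / 2) * (∫ x, f (a * x) * Real.cos (b * (a * x)) ∂stableLaw p) +
      c / 4 * (∫ x, f (a * x) * Real.cos ((b + 2) * (a * x)) ∂stableLaw p) +
      c / 4 * (∫ x, f (a * x) * Real.cos (|b - 2| * (a * x)) ∂stableLaw p) := by
    intro b a
    have i12 : Integrable (fun x => (1 + c / 2) * (f (a * x) * Real.cos (b * (a * x))) +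
        c / 4 * (f (a * x) * Real.cos ((b + 2) * (a * x)))) (stableLaw p) :=
      ((hi _ _).const_mul _).add ((hi _ _).const_mul _)
    rw [← integral_const_mul, ← integral_const_mul, ← integral_const_mul,
      ← integral_add ((hi _ _).const_mul _) ((hi _ _).const_mul _),
      ← integral_add i12 ((hi _ _).const_mul _)]
    congr 1
    ext x
    have e1 : Real.cos (|b - 2| * (a * x)) = Real.cos (b * (a * x) - 2 * (a * x)) := by
      rcases abs_cases (b - 2) with ⟨h, _⟩ | ⟨h, _⟩ <;> rw [h]
      · ring_nf
      · rw [neg_mul, Real.cos_neg]; ring_nf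
    rw [e1, show (b + 2) * (a * x) = b * (a * x) + 2 * (a * x) by ring, Real.cos_add, Real.cos_sub,
      Real.cos_two_mul]
    ring
  intro b hb a a' ha haa'
  rw [key, key]
  have i1 := hf b hb a a' ha haa'
  have i2 := hf (b + 2) (by linarith) a a' ha haa'
  have i3 := hf |b - 2| (abs_nonneg _) a a' ha haa'
  gcongr

theorem decreasingSpectrum_pow (h1 : 1 ≤ p) (h2 : p ≤ 2) {c : ℝ} (hc : 0 ≤ c) (n : ℕ) :
    DecreasingSpectrum p fun y => (1 + c * Real.cos y ^ 2) ^ n := by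
  induction n with
  | zero => simpa using decreasingSpectrum_one h1 h2
  | succ n ih =>
    simp_rw [pow_succ]
    refine ih.mul_one_add_cos_sq h1 h2 (by fun_prop) (B := (1 + c) ^ n) (fun x => ?_) hc
    have h3 : Real.cos x ^ 2 ≤ 1 := Real.cos_sq_le_one x
    have h4 := sq_nonneg (Real.cos x)
    rw [abs_of_nonneg (by positivity)]
    gcongr
    nlinarith

/-- Since `exp (-v sin²) = e^(-v) exp (v cos²)` and `exp (v cos²)` is the limit of `(1 + v cos² /
n)^n`, the function is a limit of nonnegative combinations of cosines, and `E cos (b a Z) = exp (-(b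
a)^p)` decreases in `a`. -/
theorem integral_exp_neg_mul_sin_sq_anti (h1 : 1 ≤ p) (h2 : p ≤ 2) {v : ℝ} (hv : 0 ≤ v)
    {a a' : ℝ} (ha : 0 ≤ a) (haa' : a ≤ a') :
    ∫ x, Real.exp (-(v * Real.sin (a' * x) ^ 2)) ∂stableLaw p ≤
      ∫ x, Real.exp (-(v * Real.sin (a * x) ^ 2)) ∂stableLaw p := by
  have := isProbabilityMeasure_stableLaw h1 h2
  have hlim : ∀ a : ℝ, Tendsto (fun n : ℕ =>
      ∫ x, (1 + v / n * Real.cos (a * x) ^ 2) ^ n ∂stableLaw p) atTop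
      (𝓝 (∫ x, Real.exp (v * Real.cos (a * x) ^ 2) ∂stableLaw p)) := by
    intro a
    refine tendsto_integral_of_dominated_convergence (fun _ => Real.exp v) (fun n => ?_)
      (integrable_const _) (fun n => Eventually.of_forall fun x => ?_)
      (Eventually.of_forall fun x => ?_)
    · have : Measurable fun x : ℝ => (1 + v / n * Real.cos (a * x) ^ 2) ^ n := by fun_prop
      exact this.aestronglyMeasurable
    · have h0 : 0 ≤ v / n * Real.cos (a * x) ^ 2 := by positivity
      rw [Real.norm_eq_abs, abs_of_nonneg (by positivity)]
      calc (1 + v / n * Real.cos (a * x) ^ 2) ^ n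
          ≤ Real.exp (v / n * Real.cos (a * x) ^ 2) ^ n := by
            gcongr
            linarith [Real.add_one_le_exp (v / n * Real.cos (a * x) ^ 2)]
        _ = Real.exp (n * (v / n * Real.cos (a * x) ^ 2)) := (Real.exp_nat_mul _ _).symm
        _ ≤ Real.exp v := by
            rw [Real.exp_le_exp]
            rcases Nat.eq_zero_or_pos n with rfl | hn
            · simpa using hv
            · have hn' : (n : ℝ) ≠ 0 := by positivity
              rw [show (n : ℝ) * (v / n * Real.cos (a * x) ^ 2) = v * Real.cos (a * x) ^ 2 by
                field_simp]
              exact mul_le_of_le_one_right hv (Real.cos_sq_le_one _)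
    · have := Real.tendsto_one_add_div_pow_exp (v * Real.cos (a * x) ^ 2)
      refine this.congr fun n => ?_
      rw [mul_div_right_comm]
  have hle : ∫ x, Real.exp (v * Real.cos (a' * x) ^ 2) ∂stableLaw p ≤
      ∫ x, Real.exp (v * Real.cos (a * x) ^ 2) ∂stableLaw p := by
    refine le_of_tendsto_of_tendsto' (hlim a') (hlim a) fun n => ?_
    have := decreasingSpectrum_pow h1 h2 (c := v / n) (by positivity) n 0 le_rfl a a' ha haa'
    simpa using this
  have hfac : ∀ a : ℝ, ∫ x, Real.exp (-(v * Real.sin (a * x) ^ 2)) ∂stableLaw p =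
      Real.exp (-v) * ∫ x, Real.exp (v * Real.cos (a * x) ^ 2) ∂stableLaw p := fun a => by
    rw [← integral_const_mul]
    congr 1
    ext x
    rw [← Real.exp_add, Real.sin_sq]
    ring_nf
  rw [hfac, hfac]
  gcongr

theorem integral_sin_sq_stableLaw (h1 : 1 ≤ p) (h2 : p ≤ 2) (a : ℝ) :
    ∫ x, Real.sin (a * x) ^ 2 ∂stableLaw p = (1 - Real.exp (-|2 * a| ^ p)) / 2 := by
  have := isProbabilityMeasure_stableLaw h1 h2
  rw [← integral_cos_stableLaw h1 h2]
  have h : ∀ x : ℝ, Real.sin (a * x) ^ 2 = 1 / 2 - 1 / 2 * Real.cos (2 * a * x) := fun x => by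
    rw [show 2 * a * x = 2 * (a * x) by ring, Real.cos_two_mul, Real.cos_sq']
    ring
  simp_rw [h]
  rw [integral_sub (integrable_const _), integral_const_mul]
  · simp
    ring
  · exact (integrable_of_abs_le (B := 1) (by fun_prop) fun x => Real.abs_cos_le_one _).const_mul _

theorem abs_rpow_eq_sq_rpow (y q : ℝ) : |y| ^ q = (y ^ 2) ^ (q / 2) := by
  rw [← sq_abs, ← Real.rpow_natCast, ← Real.rpow_mul (abs_nonneg y)]
  congr 1
  push_cast; ring

/-- `E |sin (aZ)|^q` increases with the scale `a`. -/
theorem sinMoment_mono (h1 : 1 ≤ p) (h2 : p ≤ 2) {q : ℝ} (hq0 : 0 < q) (hq : q ≤ 2) {a a' : ℝ}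
    (ha : 0 ≤ a) (haa' : a ≤ a') : sinMoment p q a ≤ sinMoment p q a' := by
  have := isProbabilityMeasure_stableLaw h1 h2
  -- For `q = 2` the Lévy integral with exponent `q / 2 = 1` diverges at zero, but `E sin²` is
  -- explicit.
  rcases hq.eq_or_lt with rfl | hq
  · simp only [sinMoment, Real.rpow_two, sq_abs]
    rw [integral_sin_sq_stableLaw h1 h2, integral_sin_sq_stableLaw h1 h2]
    have ha' := ha.trans haa'
    rw [abs_of_nonneg (by positivity), abs_of_nonneg (by positivity)]
    gcongr
  have hα0 : 0 < q / 2 := by positivity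
  have hα1 : q / 2 < 1 := by linarith
  have hc := levyConst_pos hα0 hα1
  have hint : ∀ a : ℝ, Integrable (Function.uncurry fun (x v : ℝ) =>
      (1 - Real.exp (-(v * Real.sin (a * x) ^ 2))) * v ^ (-1 - q / 2))
      ((stableLaw p).prod (volume.restrict (Ioi 0))) := by
    intro a
    have hg := Integrable.mul_prod (μ := stableLaw p) (integrable_const (1 : ℝ))
      (integrableOn_levy hα0 hα1 zero_le_one)
    refine hg.mono' ?_ ?_
    · have : Measurable (Function.uncurry fun (x v : ℝ) =>
        (1 - Real.exp (-(v * Real.sin (a * x) ^ 2))) * v ^ (-1 - q / 2)) := by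
        unfold Function.uncurry; fun_prop
      exact this.aestronglyMeasurable
    · have hae : ∀ᵐ z ∂((stableLaw p).prod (volume.restrict (Ioi (0 : ℝ)))), z.2 ∈ Ioi (0 : ℝ) :=
        Measure.quasiMeasurePreserving_snd.ae (ae_restrict_mem measurableSet_Ioi)
      filter_upwards [hae] with z hz
      obtain ⟨x, v⟩ := z
      have hv : 0 < v := hz
      simp only [Function.uncurry, one_mul, mul_one]
      have h3 : Real.sin (a * x) ^ 2 ≤ 1 := Real.sin_sq_le_one _
      have h4 : Real.exp (-(v * Real.sin (a * x) ^ 2)) ≤ 1 := Real.exp_le_one_iff.2 (by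
        have : 0 ≤ v * Real.sin (a * x) ^ 2 := by positivity
        linarith)
      rw [Real.norm_eq_abs, abs_mul, abs_of_nonneg (by linarith), abs_of_nonneg (by positivity)]
      gcongr
      nlinarith
  -- The Lévy formula for the power `q / 2` of `sin²` writes the sine moment as a positive average
  -- over `v` of `1 - E exp (-v sin²)`, each of which increases with `a`.
  have hG : ∀ a : ℝ, levyConst (q / 2) * sinMoment p q a =
      ∫ v in Ioi (0 : ℝ), (1 - ∫ x, Real.exp (-(v * Real.sin (a * x) ^ 2)) ∂stableLaw p) *
        v ^ (-1 - q / 2) := by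
    intro a
    have e1 : ∀ x : ℝ, levyConst (q / 2) * |Real.sin (a * x)| ^ q = ∫ v in Ioi (0 : ℝ),
        (1 - Real.exp (-(v * Real.sin (a * x) ^ 2))) * v ^ (-1 - q / 2) := fun x => by
      rw [abs_rpow_eq_sq_rpow, integral_levy hα0 (sq_nonneg _)]
    rw [sinMoment, ← integral_const_mul]
    simp_rw [e1]
    rw [integral_integral_swap (hint a)]
    refine setIntegral_congr_fun measurableSet_Ioi fun v hv => ?_
    have hv0 : 0 < v := hv
    rw [integral_mul_const, integral_sub (integrable_const _)]
    · simp
    · refine integrable_of_abs_le (B := 1) (by fun_prop) fun x => ?_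
      rw [Real.abs_exp]
      exact Real.exp_le_one_iff.2 (by
        have : 0 ≤ v * Real.sin (a * x) ^ 2 := by positivity
        linarith)
  have hi : ∀ a : ℝ, IntegrableOn (fun v : ℝ =>
      (1 - ∫ x, Real.exp (-(v * Real.sin (a * x) ^ 2)) ∂stableLaw p) * v ^ (-1 - q / 2))
      (Ioi 0) := by
    intro a
    refine (hint a).integral_prod_right.congr ?_
    refine (ae_restrict_iff' measurableSet_Ioi).2 (Eventually.of_forall fun v hv => ?_)
    have hv0 : 0 < v := hv
    simp only [Function.uncurry]
    rw [integral_mul_const, integral_sub (integrable_const _)]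
    · simp
    · refine integrable_of_abs_le (B := 1) (by fun_prop) fun x => ?_
      rw [Real.abs_exp]
      exact Real.exp_le_one_iff.2 (by
        have : 0 ≤ v * Real.sin (a * x) ^ 2 := by positivity
        linarith)
  refine le_of_mul_le_mul_left ?_ hc
  rw [hG, hG]
  refine setIntegral_mono_on (hi a) (hi a') measurableSet_Ioi fun v hv => ?_
  have hv0 : 0 < v := hv
  have := integral_exp_neg_mul_sin_sq_anti h1 h2 hv0.le ha haa'
  gcongr

end Monotone

/-! ### Size of the sine moments in terms of truncated moments. -/

theorem integrable_abs_sin_rpow {p q : ℝ} (h1 : 1 ≤ p) (h2 : p ≤ 2) (hq : 0 ≤ q) (a : ℝ) :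
    Integrable (fun x => |Real.sin (a * x)| ^ q) (stableLaw p) := by
  have := isProbabilityMeasure_stableLaw h1 h2
  refine integrable_of_abs_le (B := 1) (by fun_prop) fun x => ?_
  rw [abs_of_nonneg (by positivity)]
  exact abs_sin_rpow_le_one hq _

/-- Bound `|sin|^q` by `|sin|`, and then use `(E |sin|)² ≤ E sin² ≤ 1/2` in the form of a
tangent-line inequality. A bound strictly below `1`, uniform in `a`, leaves room in the threshold
for normalization and deviation. -/
theorem sinMoment_le_inv_sqrt_two {p q : ℝ} (h1 : 1 ≤ p) (h2 : p ≤ 2) (hq : 1 ≤ q) (a : ℝ) :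
    sinMoment p q a ≤ 1 / Real.sqrt 2 := by
  have := isProbabilityMeasure_stableLaw h1 h2
  have hs : Real.sqrt 2 * Real.sqrt 2 = 2 := Real.mul_self_sqrt (by norm_num)
  have hs0 : 0 < Real.sqrt 2 := by positivity
  have hpt : ∀ x : ℝ, |Real.sin (a * x)| ^ q ≤
      Real.sqrt 2 / 2 * Real.sin (a * x) ^ 2 + 1 / Real.sqrt 2 / 2 := fun x => by
    have h3 : |Real.sin (a * x)| ^ q ≤ |Real.sin (a * x)| ^ (1 : ℝ) :=
      Real.rpow_le_rpow_of_exponent_ge' (abs_nonneg _) (Real.abs_sin_le_one _) zero_le_one hq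
    rw [Real.rpow_one] at h3
    refine h3.trans ?_
    rw [← sq_abs (Real.sin (a * x))]
    have : 1 / Real.sqrt 2 = Real.sqrt 2 / 2 := by field_simp; linarith
    rw [this]
    nlinarith [sq_nonneg (Real.sqrt 2 * |Real.sin (a * x)| - 1)]
  have hsq : Integrable (fun x => Real.sin (a * x) ^ 2) (stableLaw p) :=
    integrable_of_abs_le (B := 1) (by fun_prop) fun x => by
      rw [abs_of_nonneg (by positivity)]; exact Real.sin_sq_le_one _
  have hadd : Integrable (fun x => Real.sqrt 2 / 2 * Real.sin (a * x) ^ 2 + 1 / Real.sqrt 2 / 2)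
      (stableLaw p) := (hsq.const_mul _).add (integrable_const _)
  have h4 := integral_mono (integrable_abs_sin_rpow h1 h2 (by linarith) a) hadd hpt
  rw [integral_add (hsq.const_mul (Real.sqrt 2 / 2)) (integrable_const _), integral_const_mul,
    integral_sin_sq_stableLaw h1 h2] at h4
  simp only [integral_const, probReal_univ, one_smul] at h4
  refine h4.trans ?_
  have h5 := Real.exp_pos (-|2 * a| ^ p)
  have : 1 / Real.sqrt 2 = Real.sqrt 2 / 2 := by field_simp; linarith
  rw [this]
  nlinarith

theorem le_sinMoment_of_one_le {p q : ℝ} (h1 : 1 ≤ p) (h2 : p ≤ 2) (hq0 : 0 ≤ q) (hq : q ≤ 2)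
    {a : ℝ} (ha : 1 ≤ a) : 1 / 4 ≤ sinMoment p q a := by
  have := isProbabilityMeasure_stableLaw h1 h2
  have hsq : Integrable (fun x => Real.sin (a * x) ^ 2) (stableLaw p) :=
    integrable_of_abs_le (B := 1) (by fun_prop) fun x => by
      rw [abs_of_nonneg (by positivity)]; exact Real.sin_sq_le_one _
  have h3 : ∫ x, Real.sin (a * x) ^ 2 ∂stableLaw p ≤ sinMoment p q a :=
    integral_mono hsq (integrable_abs_sin_rpow h1 h2 hq0 a) fun x => by
      have := Real.rpow_le_rpow_of_exponent_ge' (abs_nonneg (Real.sin (a * x)))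
        (Real.abs_sin_le_one _) hq0 hq
      simpa using this
  rw [integral_sin_sq_stableLaw h1 h2] at h3
  refine le_trans ?_ h3
  have h4 : 1 ≤ |2 * a| ^ p := by
    refine Real.one_le_rpow ?_ (by linarith)
    rw [abs_of_nonneg (by linarith)]; linarith
  have h5 : Real.exp (-|2 * a| ^ p) ≤ 1 / 2 := by
    rw [Real.exp_neg, inv_eq_one_div]
    have : 2 ≤ Real.exp (|2 * a| ^ p) := by linarith [Real.add_one_le_exp (|2 * a| ^ p)]
    exact one_div_le_one_div_of_le (by norm_num) this
  linarith

/-- Integrals of even functions against the stable law. -/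
theorem integral_stableLaw_abs {p : ℝ} (h1 : 1 ≤ p) (h2 : p ≤ 2) (f : ℝ → ℝ) :
    ∫ x, f |x| ∂stableLaw p = 2 * ∫ u in Ioi (0 : ℝ), f u * stableDensity p u := by
  rw [integral_stableLaw h1 h2, ← integral_comp_abs (f := fun u => f u * stableDensity p u)]
  simp_rw [stableDensity_abs, smul_eq_mul, mul_comm]

theorem abs_sin_mul_abs (a x : ℝ) : |Real.sin (a * |x|)| = |Real.sin (a * x)| := by
  rcases abs_cases x with ⟨h, _⟩ | ⟨h, _⟩ <;> rw [h]
  rw [mul_neg, Real.sin_neg, abs_neg]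

theorem sinMoment_eq {p : ℝ} (h1 : 1 ≤ p) (h2 : p ≤ 2) (q a : ℝ) :
    sinMoment p q a = 2 * ∫ u in Ioi (0 : ℝ), |Real.sin (a * u)| ^ q * stableDensity p u := by
  rw [← integral_stableLaw_abs h1 h2 fun u => |Real.sin (a * u)| ^ q, sinMoment]
  simp_rw [abs_sin_mul_abs]

theorem integrableOn_abs_sin_rpow_mul {p q : ℝ} (h1 : 1 ≤ p) (h2 : p ≤ 2) (hq : 0 ≤ q) (a : ℝ) :
    IntegrableOn (fun u => |Real.sin (a * u)| ^ q * stableDensity p u) (Ioi 0) := by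
  have := (integrable_stableLaw_iff h1 h2).1 (integrable_abs_sin_rpow h1 h2 hq a)
  simp_rw [mul_comm (stableDensity p _)] at this
  exact this.integrableOn

/-- `2 ∫_0^b u^q h(u) du`. -/
def partialMoment (p q b : ℝ) : ℝ := 2 * ∫ u in Ioc (0 : ℝ) b, u ^ q * stableDensity p u

theorem truncatedMoment_eq (p ε a : ℝ) :
    truncatedMoment p ε a = partialMoment p p (Real.sqrt ε / a) := rfl

section

variable {p q : ℝ}

theorem continuous_rpow_mul_stableDensity (h1 : 1 ≤ p) (hq : 0 ≤ q) :
    Continuous fun u : ℝ => u ^ q * stableDensity p u :=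
  (Real.continuous_rpow_const hq).mul (continuous_stableDensity (by linarith))

theorem integrableOn_Ioc_rpow_mul_stableDensity (h1 : 1 ≤ p) (hq : 0 ≤ q) (a b : ℝ) :
    IntegrableOn (fun u : ℝ => u ^ q * stableDensity p u) (Ioc a b) :=
  (continuous_rpow_mul_stableDensity h1 hq).integrableOn_Ioc

theorem rpow_mul_stableDensity_nonneg (h1 : 1 ≤ p) (h2 : p ≤ 2) {u : ℝ} (hu : 0 < u) :
    0 ≤ u ^ q * stableDensity p u :=
  mul_nonneg (by positivity) (stableDensity_nonneg h1 h2 u)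

/-- The decay exponent `c` is kept separate from `p`: it is `p` in general, while the Gaussian
density also admits `c = 3`, which makes the moment `q = p = 2` finite. -/
theorem rpow_mul_stableDensity_le {K c u : ℝ} (hK : ∀ u, 0 < u → stableDensity p u ≤ K * u ^ (-1 - c))
    (hu : 0 < u) : u ^ q * stableDensity p u ≤ K * u ^ (q - 1 - c) := by
  calc u ^ q * stableDensity p u ≤ u ^ q * (K * u ^ (-1 - c)) := by gcongr; exact hK u hu
    _ = K * (u ^ q * u ^ (-1 - c)) := by ring
    _ = K * u ^ (q - 1 - c) := by rw [← Real.rpow_add hu]; ring_nf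

theorem integrableOn_Ioi_rpow_mul_stableDensity (h1 : 1 ≤ p) (h2 : p ≤ 2) (hq : 0 ≤ q) {K c : ℝ}
    (hK : ∀ u, 0 < u → stableDensity p u ≤ K * u ^ (-1 - c)) (hqp : q < c) :
    IntegrableOn (fun u : ℝ => u ^ q * stableDensity p u) (Ioi 0) := by
  rw [← Ioc_union_Ioi_eq_Ioi (zero_le_one (α := ℝ))]
  refine (integrableOn_Ioc_rpow_mul_stableDensity h1 hq 0 1).union ?_
  refine ((integrableOn_Ioi_rpow_of_lt (a := q - 1 - c) (by linarith) one_pos).const_mul K).mono'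
    (continuous_rpow_mul_stableDensity h1 hq).aestronglyMeasurable ?_
  refine (ae_restrict_iff' measurableSet_Ioi).2 (Eventually.of_forall fun u hu => ?_)
  have hu0 : 0 < u := one_pos.trans hu
  rw [Real.norm_eq_abs, abs_of_nonneg (rpow_mul_stableDensity_nonneg h1 h2 hu0)]
  exact rpow_mul_stableDensity_le hK hu0

theorem integral_Ioi_rpow_mul_stableDensity_le (h1 : 1 ≤ p) (h2 : p ≤ 2) (hq : 0 ≤ q) {K c : ℝ}
    (hK : ∀ u, 0 < u → stableDensity p u ≤ K * u ^ (-1 - c)) (hqp : q < c) {b : ℝ} (hb : 0 < b) :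
    ∫ u in Ioi b, u ^ q * stableDensity p u ≤ K * (b ^ (q - c) / (c - q)) := by
  have hi := (integrableOn_Ioi_rpow_mul_stableDensity h1 h2 hq hK hqp).mono_set
    (Ioi_subset_Ioi hb.le)
  have hj := (integrableOn_Ioi_rpow_of_lt (a := q - 1 - c) (by linarith) hb).const_mul K
  refine (setIntegral_mono_on hi hj measurableSet_Ioi fun u hu =>
    rpow_mul_stableDensity_le hK (hb.trans hu)).trans_eq ?_
  rw [integral_const_mul, integral_Ioi_rpow_of_lt (by linarith) hb]
  rw [show q - 1 - c + 1 = -(c - q) by ring, neg_div_neg_eq, neg_sub]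

theorem partialMoment_add_tail (h1 : 1 ≤ p) (h2 : p ≤ 2) (hq : 0 ≤ q) {K c : ℝ}
    (hK : ∀ u, 0 < u → stableDensity p u ≤ K * u ^ (-1 - c)) (hqp : q < c) {b : ℝ} (hb : 0 ≤ b) :
    stableMoment p q = partialMoment p q b + 2 * ∫ u in Ioi b, u ^ q * stableDensity p u := by
  have hi := integrableOn_Ioi_rpow_mul_stableDensity h1 h2 hq hK hqp
  rw [stableMoment, partialMoment, ← Ioc_union_Ioi_eq_Ioi hb,
    setIntegral_union (Ioc_disjoint_Ioi le_rfl) measurableSet_Ioi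
      (hi.mono_set Ioc_subset_Ioi_self) (hi.mono_set (Ioi_subset_Ioi hb))]
  ring

theorem stableMoment_sub_le_partialMoment (h1 : 1 ≤ p) (h2 : p ≤ 2) (hq : 0 ≤ q) {K c : ℝ}
    (hK : ∀ u, 0 < u → stableDensity p u ≤ K * u ^ (-1 - c)) (hqp : q < c) {b : ℝ} (hb : 0 < b) :
    stableMoment p q - 2 * K * (b ^ (q - c) / (c - q)) ≤ partialMoment p q b := by
  have := integral_Ioi_rpow_mul_stableDensity_le h1 h2 hq hK hqp hb
  rw [partialMoment_add_tail h1 h2 hq hK hqp hb.le]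
  linarith

theorem partialMoment_mono (h1 : 1 ≤ p) (h2 : p ≤ 2) (hq : 0 ≤ q) {b b' : ℝ} (hbb' : b ≤ b') :
    partialMoment p q b ≤ partialMoment p q b' := by
  refine mul_le_mul_of_nonneg_left ?_ (by norm_num)
  refine setIntegral_mono_set (integrableOn_Ioc_rpow_mul_stableDensity h1 hq 0 b') ?_
    (Ioc_subset_Ioc_right hbb').eventuallyLE
  exact (ae_restrict_iff' measurableSet_Ioc).2 (Eventually.of_forall fun u hu =>
    rpow_mul_stableDensity_nonneg h1 h2 hu.1)

theorem partialMoment_le_stableMoment (h1 : 1 ≤ p) (h2 : p ≤ 2) (hq : 0 ≤ q) {K c : ℝ}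
    (hK : ∀ u, 0 < u → stableDensity p u ≤ K * u ^ (-1 - c)) (hqp : q < c) {b : ℝ} (hb : 0 ≤ b) :
    partialMoment p q b ≤ stableMoment p q := by
  rw [partialMoment_add_tail h1 h2 hq hK hqp hb]
  have : 0 ≤ ∫ u in Ioi b, u ^ q * stableDensity p u :=
    setIntegral_nonneg measurableSet_Ioi fun u hu =>
      rpow_mul_stableDensity_nonneg h1 h2 (lt_of_le_of_lt hb hu)
  linarith

theorem two_mul_integral_stableDensity_le_one (h1 : 1 ≤ p) (h2 : p ≤ 2) {s : Set ℝ}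
    (hs : s ⊆ Ioi 0) : 2 * ∫ u in s, stableDensity p u ≤ 1 := by
  have := isProbabilityMeasure_stableLaw h1 h2
  have h3 := integral_stableLaw_abs h1 h2 fun _ => 1
  simp only [integral_const, probReal_univ, one_smul, one_mul] at h3
  rw [h3]
  gcongr
  · exact Eventually.of_forall fun u => stableDensity_nonneg h1 h2 u
  · exact (integrable_stableDensity h1 h2).integrableOn

theorem partialMoment_le_rpow (h1 : 1 ≤ p) (h2 : p ≤ 2) (hq : 0 ≤ q) {b : ℝ} (hb : 0 ≤ b) :
    partialMoment p q b ≤ b ^ q := by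
  have h3 : ∫ u in Ioc 0 b, u ^ q * stableDensity p u ≤ ∫ u in Ioc 0 b, b ^ q * stableDensity p u :=
    setIntegral_mono_on (integrableOn_Ioc_rpow_mul_stableDensity h1 hq 0 b)
      ((integrable_stableDensity h1 h2).integrableOn.const_mul _) measurableSet_Ioc fun u hu => by
        have := stableDensity_nonneg h1 h2 u
        have := hu.2
        have := hu.1.le
        gcongr
  rw [integral_const_mul] at h3
  have h4 := two_mul_integral_stableDensity_le_one h1 h2 (s := Ioc 0 b) Ioc_subset_Ioi_self
  have h5 : 0 ≤ b ^ q := by positivity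
  rw [partialMoment]
  nlinarith

/-- On `(0, 1]` powers decrease in the exponent. Taking `q' = 2` gives a lower bound for all moments
that depends on `p` only; this makes the final constant independent of `q`. -/
theorem partialMoment_one_anti (h1 : 1 ≤ p) (h2 : p ≤ 2) {q' : ℝ} (hq : 0 ≤ q) (hqq' : q ≤ q') :
    partialMoment p q' 1 ≤ partialMoment p q 1 := by
  refine mul_le_mul_of_nonneg_left ?_ (by norm_num)
  refine setIntegral_mono_on (integrableOn_Ioc_rpow_mul_stableDensity h1 (hq.trans hqq') 0 1)
    (integrableOn_Ioc_rpow_mul_stableDensity h1 hq 0 1) measurableSet_Ioc fun u hu => ?_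
  exact mul_le_mul_of_nonneg_right (Real.rpow_le_rpow_of_exponent_ge hu.1 hu.2 hqq')
    (stableDensity_nonneg h1 h2 u)

theorem stableDensity_zero_pos (h1 : 1 ≤ p) : 0 < stableDensity p 0 := by
  have hi := integrableOn_exp_neg_rpow (show 0 < p by linarith)
  have h3 : 0 < ∫ t in Ioi (0 : ℝ), Real.exp (-t ^ p) := by
    rw [setIntegral_pos_iff_support_of_nonneg_ae
      (Eventually.of_forall fun t => (Real.exp_pos _).le) hi]
    have : (Function.support fun t : ℝ => Real.exp (-t ^ p)) = univ := by
      ext t; simp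
    rw [this, univ_inter]
    simp
  simp only [stableDensity, mul_zero, Real.cos_zero, one_mul]
  have := Real.pi_pos
  positivity

theorem partialMoment_pos (h1 : 1 ≤ p) (h2 : p ≤ 2) (hq : 0 ≤ q) {b : ℝ} (hb : 0 < b) :
    0 < partialMoment p q b := by
  refine mul_pos two_pos ?_
  rw [setIntegral_pos_iff_support_of_nonneg_ae _ (integrableOn_Ioc_rpow_mul_stableDensity h1 hq 0 b)]
  · have hc := (continuous_stableDensity (show 0 < p by linarith)).continuousAt (x := 0)
    have hev := hc.eventually (lt_mem_nhds (stableDensity_zero_pos h1))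
    obtain ⟨δ, hδ, hball⟩ := Metric.eventually_nhds_iff.1 hev
    have : Ioo (0 : ℝ) (min δ b) ⊆
        (Function.support fun u : ℝ => u ^ q * stableDensity p u) ∩ Ioc 0 b := by
      intro u hu
      have hu2 := lt_min_iff.1 hu.2
      refine ⟨?_, hu.1, hu2.2.le⟩
      have h3 : 0 < stableDensity p u := hball (by
        rw [Real.dist_eq, sub_zero, abs_of_pos hu.1]; exact hu2.1)
      exact (mul_pos (Real.rpow_pos_of_pos hu.1 q) h3).ne'
    exact lt_of_lt_of_le (by simp [hδ, hb]) (measure_mono this)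
  · exact (ae_restrict_iff' measurableSet_Ioc).2 (Eventually.of_forall fun u hu =>
      rpow_mul_stableDensity_nonneg h1 h2 hu.1)

theorem abs_sin_rpow_le (hq : 0 ≤ q) {a u : ℝ} (ha : 0 ≤ a) (hu : 0 ≤ u) :
    |Real.sin (a * u)| ^ q ≤ a ^ q * u ^ q := by
  rw [← Real.mul_rpow ha hu]
  refine Real.rpow_le_rpow (abs_nonneg _) ?_ hq
  have := Real.abs_sin_le_abs (x := a * u)
  rwa [abs_of_nonneg (mul_nonneg ha hu)] at this

/-- Split at `u = 1 / a`: below, `|sin (a u)| ≤ a u`; above, the sine is at most one and the tail of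
the density has mass of order `a^p`. -/
theorem sinMoment_le_partialMoment_add (h1 : 1 ≤ p) (h2 : p ≤ 2) (hq : 0 ≤ q) {K : ℝ}
    (hK : ∀ u, 0 < u → stableDensity p u ≤ K * u ^ (-1 - p)) {a : ℝ} (ha : 0 < a) :
    sinMoment p q a ≤ a ^ q * partialMoment p q (1 / a) + 2 * K * a ^ p / p := by
  have hi := integrableOn_abs_sin_rpow_mul h1 h2 hq a
  have hb : 0 < 1 / a := by positivity
  rw [sinMoment_eq h1 h2, ← Ioc_union_Ioi_eq_Ioi hb.le,
    setIntegral_union (Ioc_disjoint_Ioi le_rfl) measurableSet_Ioi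
      (hi.mono_set Ioc_subset_Ioi_self) (hi.mono_set (Ioi_subset_Ioi hb.le))]
  have e1 : ∫ u in Ioc 0 (1 / a), |Real.sin (a * u)| ^ q * stableDensity p u ≤
      a ^ q * ∫ u in Ioc 0 (1 / a), u ^ q * stableDensity p u := by
    rw [← integral_const_mul]
    refine setIntegral_mono_on (hi.mono_set Ioc_subset_Ioi_self)
      ((integrableOn_Ioc_rpow_mul_stableDensity h1 hq _ _).const_mul _) measurableSet_Ioc
      fun u hu => ?_
    rw [← mul_assoc]
    exact mul_le_mul_of_nonneg_right (abs_sin_rpow_le hq ha.le hu.1.le) (stableDensity_nonneg h1 h2 u)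
  have e2 : ∫ u in Ioi (1 / a), |Real.sin (a * u)| ^ q * stableDensity p u ≤ K * (a ^ p / p) := by
    have h3 := integral_Ioi_rpow_mul_stableDensity_le h1 h2 (le_refl 0) hK (by linarith) hb
    simp only [Real.rpow_zero, one_mul, zero_sub, sub_zero] at h3
    rw [one_div, Real.inv_rpow ha.le, Real.rpow_neg ha.le, inv_inv, ← one_div] at h3
    refine le_trans ?_ h3
    refine setIntegral_mono_on (hi.mono_set (Ioi_subset_Ioi hb.le))
      (integrable_stableDensity h1 h2).integrableOn measurableSet_Ioi fun u _ => ?_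
    exact mul_le_of_le_one_left (stableDensity_nonneg h1 h2 u) (abs_sin_rpow_le_one hq _)
  rw [partialMoment]
  have : 2 * K * a ^ p / p = 2 * (K * (a ^ p / p)) := by ring
  rw [this]
  linarith

theorem sinMoment_le_stableMoment (h1 : 1 ≤ p) (h2 : p ≤ 2) (hq : 0 ≤ q) {K c : ℝ}
    (hK : ∀ u, 0 < u → stableDensity p u ≤ K * u ^ (-1 - c)) (hqp : q < c) {a : ℝ} (ha : 0 ≤ a) :
    sinMoment p q a ≤ a ^ q * stableMoment p q := by
  have hi := integrableOn_abs_sin_rpow_mul h1 h2 hq a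
  have h3 : ∫ u in Ioi 0, |Real.sin (a * u)| ^ q * stableDensity p u ≤
      a ^ q * ∫ u in Ioi 0, u ^ q * stableDensity p u := by
    rw [← integral_const_mul]
    refine setIntegral_mono_on hi
      ((integrableOn_Ioi_rpow_mul_stableDensity h1 h2 hq hK hqp).const_mul _) measurableSet_Ioi
      fun u hu => ?_
    rw [← mul_assoc]
    exact mul_le_mul_of_nonneg_right (abs_sin_rpow_le hq ha (le_of_lt hu))
      (stableDensity_nonneg h1 h2 u)
  rw [sinMoment_eq h1 h2, stableMoment]
  linarith

/-- The variance bound. Below `1 / a` the integrand is at most `K u^(2q-1-p)`, integrable at zero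
exactly because `p < 2q`; its integral produces the denominator `2q - p` of the dimension bound. -/
theorem sinMoment_two_mul_le (h1 : 1 ≤ p) (h2 : p ≤ 2) (hq : q ≤ p) (hpq : p < 2 * q) {K : ℝ}
    (hK0 : 0 ≤ K) (hK : ∀ u, 0 < u → stableDensity p u ≤ K * u ^ (-1 - p)) {a : ℝ} (ha : 0 < a) :
    sinMoment p (2 * q) a ≤ 6 * K * (a ^ p / (2 * q - p)) := by
  have hq0 : 0 ≤ 2 * q := by linarith
  refine (sinMoment_le_partialMoment_add h1 h2 hq0 hK ha).trans ?_
  have hb : 0 < 1 / a := by positivity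
  have e1 : ∫ u in Ioc 0 (1 / a), u ^ (2 * q) * stableDensity p u ≤
      K * ((1 / a) ^ (2 * q - p) / (2 * q - p)) := by
    have hii : IntegrableOn (fun u : ℝ => u ^ (2 * q - 1 - p)) (Ioc 0 (1 / a)) := by
      rw [← intervalIntegrable_iff_integrableOn_Ioc_of_le hb.le]
      exact intervalIntegral.intervalIntegrable_rpow' (by linarith)
    refine (setIntegral_mono_on (integrableOn_Ioc_rpow_mul_stableDensity h1 hq0 _ _)
      (hii.const_mul K) measurableSet_Ioc fun u hu =>
        rpow_mul_stableDensity_le hK hu.1).trans_eq ?_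
    rw [integral_const_mul, ← intervalIntegral.integral_of_le hb.le,
      integral_rpow (Or.inl (by linarith)), show 2 * q - 1 - p + 1 = 2 * q - p by ring,
      Real.zero_rpow (by linarith), sub_zero]
  have e2 : a ^ (2 * q) * (1 / a) ^ (2 * q - p) = a ^ p := by
    rw [one_div, Real.inv_rpow ha.le, ← Real.rpow_neg ha.le, ← Real.rpow_add ha]
    ring_nf
  have hd : 0 < 2 * q - p := by linarith
  have e3 : a ^ (2 * q) * partialMoment p (2 * q) (1 / a) ≤ 2 * K * (a ^ p / (2 * q - p)) := by
    rw [← e2, partialMoment]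
    have : 0 ≤ a ^ (2 * q) := by positivity
    calc _ = 2 * (a ^ (2 * q) * ∫ u in Ioc 0 (1 / a), u ^ (2 * q) * stableDensity p u) := by ring
      _ ≤ 2 * (a ^ (2 * q) * (K * ((1 / a) ^ (2 * q - p) / (2 * q - p)))) := by gcongr
      _ = _ := by ring
  have hap : 0 ≤ a ^ p := by positivity
  have e4 : 2 * K * a ^ p / p ≤ 4 * K * (a ^ p / (2 * q - p)) := by
    rw [mul_div_assoc', div_le_div_iff₀ (by linarith) hd]
    have : 0 ≤ K * a ^ p := by positivity
    nlinarith
  linarith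

/-- From `sin y ≥ y (1 - y²/6)` and Bernoulli's inequality, `(1 - y²/6)^q ≥ 1 - q y²/6`, where `q ≤
2`. -/
theorem abs_sin_rpow_ge (hq1 : 1 ≤ q) (hq2 : q ≤ 2) {y θ : ℝ} (hy : 0 ≤ y) (hyθ : y ^ 2 ≤ θ)
    (hθ : θ ≤ 1) : (1 - θ / 3) * y ^ q ≤ |Real.sin y| ^ q := by
  have h3 := Real.sin_ge_sub_cube hy
  have h4 : y * (1 + -(y ^ 2 / 6)) ≤ |Real.sin y| := by
    refine le_trans ?_ (le_abs_self _)
    linarith [h3, show y * (1 + -(y ^ 2 / 6)) = y - y ^ 3 / 6 by ring]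
  have h5 : 0 ≤ 1 + -(y ^ 2 / 6) := by linarith
  have h6 := one_add_mul_self_le_rpow_one_add (s := -(y ^ 2 / 6)) (by linarith) hq1
  calc (1 - θ / 3) * y ^ q ≤ (1 + -(y ^ 2 / 6)) ^ q * y ^ q := by
        gcongr
        refine le_trans ?_ h6
        nlinarith [sq_nonneg y]
    _ = (y * (1 + -(y ^ 2 / 6))) ^ q := by rw [Real.mul_rpow hy h5, mul_comm]
    _ ≤ _ := Real.rpow_le_rpow (mul_nonneg hy h5) h4 (by linarith)

/-- Only the range `a u ≤ √θ`, where the sine is nearly linear, is kept. With `θ = ε` this is where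
the truncation point of `Q_a` comes from. -/
theorem partialMoment_le_sinMoment (h1 : 1 ≤ p) (h2 : p ≤ 2) (hq1 : 1 ≤ q) (hq2 : q ≤ 2) {θ : ℝ}
    (hθ0 : 0 ≤ θ) (hθ : θ ≤ 1) {a : ℝ} (ha : 0 < a) :
    (1 - θ / 3) * (a ^ q * partialMoment p q (Real.sqrt θ / a)) ≤ sinMoment p q a := by
  have hq0 : 0 ≤ q := by linarith
  have hi := integrableOn_abs_sin_rpow_mul h1 h2 hq0 a
  have e1 : (1 - θ / 3) * a ^ q * ∫ u in Ioc 0 (Real.sqrt θ / a), u ^ q * stableDensity p u ≤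
      ∫ u in Ioc 0 (Real.sqrt θ / a), |Real.sin (a * u)| ^ q * stableDensity p u := by
    rw [← integral_const_mul]
    refine setIntegral_mono_on ((integrableOn_Ioc_rpow_mul_stableDensity h1 hq0 _ _).const_mul _)
      (hi.mono_set Ioc_subset_Ioi_self) measurableSet_Ioc fun u hu => ?_
    have hu0 := hu.1.le
    rw [show (1 - θ / 3) * a ^ q * (u ^ q * stableDensity p u) =
      (1 - θ / 3) * (a * u) ^ q * stableDensity p u by rw [Real.mul_rpow ha.le hu0]; ring]
    refine mul_le_mul_of_nonneg_right ?_ (stableDensity_nonneg h1 h2 u)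
    refine abs_sin_rpow_ge hq1 hq2 (by positivity) ?_ hθ
    have h3 : a * u ≤ Real.sqrt θ := by
      have := hu.2
      rw [le_div_iff₀ ha] at this
      linarith
    calc (a * u) ^ 2 ≤ Real.sqrt θ ^ 2 := by gcongr
      _ = θ := Real.sq_sqrt hθ0
  have e2 : ∫ u in Ioc 0 (Real.sqrt θ / a), |Real.sin (a * u)| ^ q * stableDensity p u ≤
      ∫ u in Ioi 0, |Real.sin (a * u)| ^ q * stableDensity p u := by
    refine setIntegral_mono_set hi ?_ Ioc_subset_Ioi_self.eventuallyLE
    exact Eventually.of_forall fun u => mul_nonneg (by positivity) (stableDensity_nonneg h1 h2 u)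
  rw [sinMoment_eq h1 h2, partialMoment]
  linarith

/-- A lower bound for `E |sin (aZ)|^q` of the correct order, uniform in `q`. -/
theorem min_rpow_le_sinMoment (h1 : 1 ≤ p) (h2 : p ≤ 2) (hq1 : 1 ≤ q) (hq2 : q ≤ 2) {a : ℝ}
    (ha : 0 < a) : partialMoment p 2 1 / 4 * (min 1 a) ^ q ≤ sinMoment p q a := by
  have hm1 : partialMoment p 2 1 ≤ 1 := by
    simpa using partialMoment_le_rpow h1 h2 (q := 2) (by norm_num) zero_le_one
  have hm0 := partialMoment_pos h1 h2 (q := 2) (by norm_num) one_pos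
  rcases le_total 1 a with h | h
  · rw [min_eq_left h, Real.one_rpow]
    have := le_sinMoment_of_one_le h1 h2 (by linarith) hq2 h
    linarith
  · rw [min_eq_right h]
    have h3 := partialMoment_le_sinMoment h1 h2 hq1 hq2 zero_le_one le_rfl ha
    have h4 : partialMoment p 2 1 ≤ partialMoment p q (Real.sqrt 1 / a) := by
      refine (partialMoment_one_anti h1 h2 (by linarith) hq2).trans
        (partialMoment_mono h1 h2 (by linarith) ?_)
      rw [Real.sqrt_one]
      exact (one_le_div ha).2 h
    have haq : 0 ≤ a ^ q := by positivity
    refine le_trans ?_ h3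
    nlinarith [mul_le_mul_of_nonneg_left h4 haq, mul_nonneg haq hm0.le]

end

/-! ### Bernstein's inequality. -/

section Bernstein

variable {X : Type*} [MeasurableSpace X] {ν : Measure X} [IsProbabilityMeasure ν] {F : X → ℝ}

theorem exp_le_one_add_add_sq {x : ℝ} (hx : |x| ≤ 1) : Real.exp x ≤ 1 + x + x ^ 2 := by
  have := (abs_le.1 (Real.abs_exp_sub_one_sub_id_le hx)).2
  linarith

theorem mgf_le_of_bounded (hF : Measurable F) (hF0 : ∀ x, 0 ≤ F x) (hF1 : ∀ x, F x ≤ 1) {V : ℝ}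
    (hV : ∫ x, F x ^ 2 ∂ν ≤ V) {l : ℝ} (hl : |l| ≤ 1) :
    mgf F ν l ≤ Real.exp (l * ∫ x, F x ∂ν + l ^ 2 * V) := by
  have hFi : Integrable F ν := integrable_of_abs_le (B := 1) hF fun x => by
    rw [abs_of_nonneg (hF0 x)]; exact hF1 x
  have hF2 : Integrable (fun x => F x ^ 2) ν := integrable_of_abs_le (B := 1) (by fun_prop) fun x => by
    rw [abs_of_nonneg (sq_nonneg _)]; exact pow_le_one₀ (hF0 x) (hF1 x)
  have hlF : ∀ x, |l * F x| ≤ 1 := fun x => by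
    rw [abs_mul, abs_of_nonneg (hF0 x)]
    exact mul_le_one₀ hl (hF0 x) (hF1 x)
  have hE : Integrable (fun x => Real.exp (l * F x)) ν :=
    integrable_of_abs_le (B := Real.exp 1) (by fun_prop) fun x => by
      rw [Real.abs_exp, Real.exp_le_exp]
      exact (le_abs_self _).trans (hlF x)
  have hsum : Integrable (fun x => 1 + l * F x) ν := (integrable_const _).add (hFi.const_mul l)
  have hsum2 : Integrable (fun x => 1 + l * F x + l ^ 2 * F x ^ 2) ν := hsum.add (hF2.const_mul _)
  have h1 : mgf F ν l ≤ ∫ x, (1 + l * F x + l ^ 2 * F x ^ 2) ∂ν :=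
    integral_mono hE hsum2 fun x => by
      have := exp_le_one_add_add_sq (hlF x)
      simp only
      linarith [mul_pow l (F x) 2]
  rw [integral_add hsum (hF2.const_mul _), integral_add (integrable_const _) (hFi.const_mul _),
    integral_const_mul, integral_const_mul] at h1
  simp only [integral_const, probReal_univ, one_smul] at h1
  refine h1.trans ?_
  have h2 : l ^ 2 * ∫ x, F x ^ 2 ∂ν ≤ l ^ 2 * V := by gcongr
  linarith [Real.add_one_le_exp (l * ∫ x, F x ∂ν + l ^ 2 * V)]

theorem mgf_sum_pi_le (hF : Measurable F) (hF0 : ∀ x, 0 ≤ F x) (hF1 : ∀ x, F x ≤ 1) {V : ℝ}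
    (hV : ∫ x, F x ^ 2 ∂ν ≤ V) {l : ℝ} (hl : |l| ≤ 1) (k : ℕ) :
    mgf (fun x : Fin k → X => ∑ j, F (x j)) (Measure.pi fun _ => ν) l ≤
      Real.exp (k * (l * ∫ x, F x ∂ν + l ^ 2 * V)) := by
  have hind := iIndepFun_pi (μ := fun _ : Fin k => ν) (X := fun _ => F) fun _ => hF.aemeasurable
  have h1 := hind.mgf_sum (t := l) (fun j => hF.comp (measurable_pi_apply j)) Finset.univ
  have h2 : (∑ j, fun x : Fin k → X => F (x j)) = fun x : Fin k → X => ∑ j, F (x j) := by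
    ext x; simp
  have h3 : ∀ j : Fin k, mgf (fun x : Fin k → X => F (x j)) (Measure.pi fun _ => ν) l =
      mgf F ν l := fun j => by
    exact integral_comp_eval (μ := fun _ : Fin k => ν) (i := j)
      (f := fun y => Real.exp (l * F y)) (by fun_prop : Measurable fun y =>
        Real.exp (l * F y)).aestronglyMeasurable
  rw [h2] at h1
  rw [h1]
  simp_rw [h3]
  rw [Finset.prod_const, Finset.card_univ, Fintype.card_fin, Real.exp_nat_mul]
  gcongr
  · exact mgf_nonneg
  · exact mgf_le_of_bounded hF hF0 hF1 hV hl

/-- Bernstein's inequality for independent copies of a variable with values in `[0, 1]`. -/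
theorem bernstein_pi (hF : Measurable F) (hF0 : ∀ x, 0 ≤ F x) (hF1 : ∀ x, F x ≤ 1) {V d ρ : ℝ}
    (hV0 : 0 ≤ V) (hV : ∫ x, F x ^ 2 ∂ν ≤ V) (hd : 0 ≤ d) (hρ1 : 2 * ρ ≤ d)
    (hρ2 : 4 * ρ * V ≤ d ^ 2) (k : ℕ) :
    (Measure.pi fun _ : Fin k => ν).real {x | k * (∫ y, F y ∂ν + d) ≤ ∑ j, F (x j)} ≤
      Real.exp (-(k * ρ)) ∧
    (Measure.pi fun _ : Fin k => ν).real {x | ∑ j, F (x j) ≤ k * (∫ y, F y ∂ν - d)} ≤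
      Real.exp (-(k * ρ)) := by
  -- The maximizer of `l d - l² V` is `d / (2V)`, with value `d² / (4V)`. If it exceeds `1`, then `l
  -- = 1` still gives `d - V ≥ d / 2`. The two hypotheses on `ρ` correspond to these two regimes.
  obtain ⟨l, hl0, hl1, hl⟩ : ∃ l : ℝ, 0 ≤ l ∧ l ≤ 1 ∧ ρ ≤ l * d - l ^ 2 * V := by
    rcases le_total (2 * V) d with h | h
    · exact ⟨1, zero_le_one, le_rfl, by linarith⟩
    · rcases hV0.eq_or_lt with rfl | hVp
      · exact ⟨1, zero_le_one, le_rfl, by linarith⟩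
      · refine ⟨d / (2 * V), by positivity, by rw [div_le_one (by positivity)]; exact h, ?_⟩
        have : d / (2 * V) * d - (d / (2 * V)) ^ 2 * V = d ^ 2 / (4 * V) := by
          field_simp; ring
        rw [this, le_div_iff₀ (by positivity)]
        linarith
  have habs : |l| ≤ 1 := by rwa [abs_of_nonneg hl0]
  have hint : ∀ l : ℝ, Integrable (fun x : Fin k → X => Real.exp (l * ∑ j, F (x j)))
      (Measure.pi fun _ => ν) := fun l => by
    refine integrable_of_abs_le (B := Real.exp (|l| * k)) (by fun_prop) fun x => ?_
    rw [Real.abs_exp, Real.exp_le_exp]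
    refine (le_abs_self _).trans ?_
    rw [abs_mul]
    gcongr
    rw [abs_of_nonneg (Finset.sum_nonneg fun j _ => hF0 _)]
    calc ∑ j, F (x j) ≤ ∑ _j : Fin k, (1 : ℝ) := Finset.sum_le_sum fun j _ => hF1 _
      _ = k := by simp
  have hk : (0 : ℝ) ≤ k := Nat.cast_nonneg k
  constructor
  · refine (measure_ge_le_exp_mul_mgf _ hl0 (hint l)).trans ?_
    refine (mul_le_mul_of_nonneg_left (mgf_sum_pi_le hF hF0 hF1 hV habs k)
      (Real.exp_pos _).le).trans ?_
    rw [← Real.exp_add, Real.exp_le_exp]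
    have := mul_le_mul_of_nonneg_left hl hk
    linarith
  · refine (measure_le_le_exp_mul_mgf _ (neg_nonpos.2 hl0) (hint (-l))).trans ?_
    refine (mul_le_mul_of_nonneg_left (mgf_sum_pi_le hF hF0 hF1 hV (by rwa [abs_neg]) k)
      (Real.exp_pos _).le).trans ?_
    rw [← Real.exp_add, Real.exp_le_exp]
    have := mul_le_mul_of_nonneg_left hl hk
    linarith

end Bernstein

/-! ### Independent blocks, stability, and the law of one output coordinate. -/

theorem measurePreserving_blocks (k l : ℕ) (μ : Fin l → Measure ℝ)
    [∀ i, IsProbabilityMeasure (μ i)] :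
    MeasurePreserving (fun (ω : Fin (k * l) → ℝ) (j : Fin k) (i : Fin l) =>
      ω (finProdFinEquiv (j, i)))
      (Measure.pi fun r => μ (finProdFinEquiv.symm r).2) (Measure.pi fun _ => Measure.pi μ) := by
  refine ⟨by fun_prop, ?_⟩
  -- The flat list of random numbers is regrouped into `k` independent blocks of the same law by
  -- reindexing and then currying, with finite products viewed as infinite ones over finite index
  -- types.
  have h1 := Measure.infinitePi_map_piCongrLeft (X := fun _ : Fin (k * l) => ℝ)
    (μ := fun r => μ (finProdFinEquiv.symm r).2) (finProdFinEquiv (m := k) (n := l))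
  have h2 := Measure.infinitePi_map_curry (fun (_ : Fin k) (i : Fin l) => μ i)
  simp only [Equiv.symm_apply_apply, Measure.infinitePi_eq_pi] at h1 h2
  rw [← h2, ← h1, Measure.map_map (by fun_prop) (MeasurableEquiv.measurable _)]
  congr 1
  ext x j i
  simp only [Function.comp, MeasurableEquiv.coe_piCongrLeft]
  exact Equiv.piCongrLeft_apply_apply (fun _ : Fin (k * l) => ℝ) finProdFinEquiv x (j, i)

section Stable

variable {p : ℝ}

theorem isProbabilityMeasure_angle : IsProbabilityMeasure (SeedKind.angle.law p) := by
  refine ProbabilityTheory.cond_isProbabilityMeasure_of_finite ?_ ?_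
  · simp [Real.pi_pos]
  · simpa using ENNReal.mul_ne_top ENNReal.ofNat_ne_top ENNReal.ofReal_ne_top

/-- `p`-stability. -/
theorem map_linear_stableLaw (h1 : 1 ≤ p) (h2 : p ≤ 2) {m : ℕ} (y : Fin m → ℝ) :
    (Measure.pi fun _ : Fin m => stableLaw p).map (fun g => ∑ i, y i * g i) =
      (stableLaw p).map fun x => (∑ i, |y i| ^ p) ^ (1 / p) * x := by
  have := isProbabilityMeasure_stableLaw h1 h2
  have hp : p ≠ 0 := by linarith
  have hm1 : Measurable fun g : Fin m → ℝ => ∑ i, y i * g i := by fun_prop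
  have hm2 : Measurable fun x : ℝ => (∑ i, |y i| ^ p) ^ (1 / p) * x := by fun_prop
  have := Measure.isProbabilityMeasure_map (μ := Measure.pi fun _ : Fin m => stableLaw p)
    hm1.aemeasurable
  have := Measure.isProbabilityMeasure_map (μ := stableLaw p) hm2.aemeasurable
  refine Measure.ext_of_charFun ?_
  have hind : iIndepFun (fun (i : Fin m) (g : Fin m → ℝ) => y i * g i)
      (Measure.pi fun _ : Fin m => stableLaw p) :=
    iIndepFun_pi (μ := fun _ : Fin m => stableLaw p) (X := fun i x => y i * x)
      fun i => by fun_prop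
  have hmi : ∀ i : Fin m, Measurable fun g : Fin m → ℝ => y i * g i := fun i =>
    measurable_const.mul (measurable_pi_apply i)
  rw [hind.charFun_map_fun_sum_eq_prod fun i => (hmi i).aemeasurable]
  ext t
  rw [charFun_map_mul, charFun_stableLaw h1 h2, Finset.prod_apply]
  have h3 : ∀ i : Fin m, charFun ((Measure.pi fun _ : Fin m => stableLaw p).map
      fun g => y i * g i) t = (Real.exp (-|y i * t| ^ p) : ℝ) := fun i => by
    have h4 := charFun_map_mul_comp (μ := Measure.pi fun _ : Fin m => stableLaw p)
      (f := Function.eval i) (measurable_pi_apply i).aemeasurable (y i) t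
    rw [(measurePreserving_eval (fun _ : Fin m => stableLaw p) i).map_eq,
      charFun_stableLaw h1 h2] at h4
    exact h4
  simp_rw [h3]
  rw [← Complex.ofReal_prod, ← Real.exp_sum]
  congr 2
  have h0 : 0 ≤ ∑ i, |y i| ^ p := Finset.sum_nonneg fun i _ => by positivity
  rw [abs_mul, abs_of_nonneg (by positivity : 0 ≤ (∑ i, |y i| ^ p) ^ (1 / p)),
    Real.mul_rpow (by positivity) (abs_nonneg _), ← Real.rpow_mul h0, one_div,
    inv_mul_cancel₀ hp, Real.rpow_one, Finset.sum_mul, Finset.sum_neg_distrib]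
  congr 1
  refine Finset.sum_congr rfl fun i _ => ?_
  rw [abs_mul, Real.mul_rpow (abs_nonneg _) (abs_nonneg _)]

theorem integral_sin_linear (h1 : 1 ≤ p) (h2 : p ≤ 2) {m : ℕ} (y : Fin m → ℝ) (q a : ℝ) :
    ∫ g, |Real.sin (a * ∑ i, y i * g i)| ^ q ∂(Measure.pi fun _ : Fin m => stableLaw p) =
      sinMoment p q (a * (∑ i, |y i| ^ p) ^ (1 / p)) := by
  have hm1 : Measurable fun g : Fin m → ℝ => ∑ i, y i * g i := by fun_prop
  have hm2 : Measurable fun x : ℝ => (∑ i, |y i| ^ p) ^ (1 / p) * x := by fun_prop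
  have hm3 : Measurable fun x : ℝ => |Real.sin (a * x)| ^ q := by fun_prop
  have e1 := integral_map (μ := Measure.pi fun _ : Fin m => stableLaw p) hm1.aemeasurable
    hm3.aestronglyMeasurable
  have e2 := integral_map (μ := stableLaw p) hm2.aemeasurable hm3.aestronglyMeasurable
  rw [← e1, map_linear_stableLaw h1 h2, e2, sinMoment]
  simp_rw [mul_assoc]

/-- The mean of `|cos|^q` over a period. -/
def cosMoment (q : ℝ) : ℝ := (2 * Real.pi)⁻¹ * ∫ x in (0 : ℝ)..(2 * Real.pi), |Real.cos x| ^ q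

theorem integral_angle (f : ℝ → ℝ) :
    ∫ x, f x ∂(SeedKind.angle.law p) = (2 * Real.pi)⁻¹ * ∫ x in (0 : ℝ)..(2 * Real.pi), f x := by
  rw [SeedKind.law, ProbabilityTheory.cond, integral_smul_measure,
    intervalIntegral.integral_of_le (by positivity), integral_Icc_eq_integral_Ioc]
  simp [Real.pi_pos.le]

/-- By periodicity the phase `c` is irrelevant. This is the role of the random angle: it removes the
dependence on `v + w`. -/
theorem integral_angle_cos (q c : ℝ) :
    ∫ x, |Real.cos (x + c)| ^ q ∂(SeedKind.angle.law p) = cosMoment q := by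
  rw [integral_angle, cosMoment]
  congr 1
  rw [intervalIntegral.integral_comp_add_right (fun x => |Real.cos x| ^ q)]
  have hper : Function.Periodic (fun x => |Real.cos x| ^ q) (2 * Real.pi) := fun x => by
    simp only [Real.cos_add_two_pi]
  have := hper.intervalIntegral_add_eq c 0
  rw [zero_add] at this
  rw [zero_add, add_comm (2 * Real.pi) c, this]

theorem cosMoment_mem {q : ℝ} (hq0 : 0 ≤ q) (hq2 : q ≤ 2) : cosMoment q ∈ Icc (1 / 2 : ℝ) 1 := by
  have := isProbabilityMeasure_angle (p := 1)
  have hi : Integrable (fun x => |Real.cos (x + 0)| ^ q) (SeedKind.angle.law 1) := by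
    refine integrable_of_abs_le (B := 1) (by fun_prop) fun x => ?_
    rw [abs_of_nonneg (by positivity)]
    exact Real.rpow_le_one (abs_nonneg _) (Real.abs_cos_le_one _) hq0
  constructor
  · have h2 : ∫ x, Real.cos x ^ 2 ∂(SeedKind.angle.law 1) = 1 / 2 := by
      rw [integral_angle, integral_cos_sq]
      simp
      field_simp
    rw [← h2, ← integral_angle_cos (p := 1) q 0]
    refine integral_mono ?_ hi fun x => ?_
    · refine integrable_of_abs_le (B := 1) (by fun_prop) fun x => ?_
      rw [abs_of_nonneg (by positivity)]
      exact Real.cos_sq_le_one _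
    · have := Real.rpow_le_rpow_of_exponent_ge' (abs_nonneg (Real.cos x))
        (Real.abs_cos_le_one _) hq0 hq2
      simpa using this
  · rw [← integral_angle_cos (p := 1) q 0]
    refine (integral_mono hi (integrable_const 1) fun x =>
      Real.rpow_le_one (abs_nonneg _) (Real.abs_cos_le_one _) hq0).trans_eq ?_
    simp

/-- The kinds of the random numbers that one coordinate uses: an angle and `m` stable numbers. -/
def blockKind (m : ℕ) : Fin (m + 1) → SeedKind := Fin.cons .angle fun _ => .stable

/-- The contribution of one coordinate to the distance of two points with difference `y` and
sum `z`. -/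
def blockDist {m : ℕ} (q a : ℝ) (y z : Fin m → ℝ) (ω : Fin (m + 1) → ℝ) : ℝ :=
  |Real.sin (a * ∑ i, y i * ω i.succ)| ^ q * |Real.cos (ω 0 + a * ∑ i, z i * ω i.succ)| ^ q

theorem measurable_blockDist {m : ℕ} (q a : ℝ) (y z : Fin m → ℝ) : Measurable (blockDist q a y z) := by
  unfold blockDist; fun_prop

theorem isProbabilityMeasure_law (h1 : 1 ≤ p) (h2 : p ≤ 2) (c : SeedKind) :
    IsProbabilityMeasure (c.law p) := by
  cases c
  · exact isProbabilityMeasure_stableLaw h1 h2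
  · exact isProbabilityMeasure_angle

theorem integral_block (h1 : 1 ≤ p) (h2 : p ≤ 2) {m : ℕ} {f : (Fin (m + 1) → ℝ) → ℝ}
    (hf : Measurable f) {B : ℝ} (hB : ∀ x, |f x| ≤ B) :
    ∫ ω, f ω ∂(Measure.pi fun i => (blockKind m i).law p) =
      ∫ g, ∫ φ, f (Fin.cons φ g) ∂(SeedKind.angle.law p) ∂(Measure.pi fun _ => stableLaw p) := by
  have := isProbabilityMeasure_law h1 h2
  have := isProbabilityMeasure_stableLaw h1 h2
  have hmp := measurePreserving_piFinSuccAbove (fun i => (blockKind m i).law p) 0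
  have h3 := hmp.symm.integral_comp' f
  rw [← h3]
  have hm : Measurable fun z : ℝ × (Fin m → ℝ) =>
      f ((MeasurableEquiv.piFinSuccAbove (fun _ : Fin (m + 1) => ℝ) 0).symm z) :=
    hf.comp (MeasurableEquiv.measurable _)
  rw [integral_prod_symm _ (integrable_of_abs_le hm fun z => hB _)]
  have e1 : ∀ (φ : ℝ) (g : Fin m → ℝ),
      (MeasurableEquiv.piFinSuccAbove (fun _ : Fin (m + 1) => ℝ) 0).symm (φ, g) =
        (Fin.cons φ g : Fin (m + 1) → ℝ) := fun φ g => by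
    ext i
    refine Fin.cases ?_ (fun j => ?_) i <;> simp [MeasurableEquiv.piFinSuccAbove]
  simp_rw [e1]
  rfl

theorem blockDist_nonneg {m : ℕ} (q a : ℝ) (y z : Fin m → ℝ) (ω : Fin (m + 1) → ℝ) :
    0 ≤ blockDist q a y z ω := by unfold blockDist; positivity

theorem blockDist_le_one {m : ℕ} {q : ℝ} (hq : 0 ≤ q) (a : ℝ) (y z : Fin m → ℝ)
    (ω : Fin (m + 1) → ℝ) : blockDist q a y z ω ≤ 1 :=
  mul_le_one₀ (abs_sin_rpow_le_one hq _) (by positivity)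
    (Real.rpow_le_one (abs_nonneg _) (Real.abs_cos_le_one _) hq)

/-- The angle is integrated first, with the stable numbers fixed; although both factors involve the
same stable numbers, the cosine factor then becomes a constant, and stability evaluates the rest. -/
theorem integral_blockDist (h1 : 1 ≤ p) (h2 : p ≤ 2) {m : ℕ} {q : ℝ} (hq : 0 ≤ q) (a : ℝ)
    (y z : Fin m → ℝ) :
    ∫ ω, blockDist q a y z ω ∂(Measure.pi fun i => (blockKind m i).law p) =
      cosMoment q * sinMoment p q (a * (∑ i, |y i| ^ p) ^ (1 / p)) := by
  rw [integral_block h1 h2 (measurable_blockDist q a y z) (B := 1) fun x => by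
    rw [abs_of_nonneg (blockDist_nonneg _ _ _ _ _)]; exact blockDist_le_one hq _ _ _ _]
  simp only [blockDist, Fin.cons_zero, Fin.cons_succ]
  simp_rw [integral_const_mul, integral_angle_cos]
  rw [integral_mul_const, integral_sin_linear h1 h2, mul_comm]

theorem integral_blockDist_sq_le (h1 : 1 ≤ p) (h2 : p ≤ 2) {m : ℕ} {q : ℝ} (hq : 0 ≤ q) (a : ℝ)
    (y z : Fin m → ℝ) :
    ∫ ω, blockDist q a y z ω ^ 2 ∂(Measure.pi fun i => (blockKind m i).law p) ≤
      sinMoment p (2 * q) (a * (∑ i, |y i| ^ p) ^ (1 / p)) := by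
  have := isProbabilityMeasure_law h1 h2
  set f : (Fin (m + 1) → ℝ) → ℝ := fun ω => |Real.sin (a * ∑ i, y i * ω i.succ)| ^ (2 * q) with hf
  have hfm : Measurable f := by simp only [hf]; fun_prop
  have hfb : ∀ ω, |f ω| ≤ 1 := fun ω => by
    simp only [hf]
    rw [abs_of_nonneg (by positivity)]; exact abs_sin_rpow_le_one (by linarith) _
  have h3 : ∫ ω, blockDist q a y z ω ^ 2 ∂(Measure.pi fun i => (blockKind m i).law p) ≤
      ∫ ω, f ω ∂(Measure.pi fun i => (blockKind m i).law p) := by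
    refine integral_mono (integrable_of_abs_le (B := 1)
      ((measurable_blockDist q a y z).pow_const 2) fun ω => ?_)
      (integrable_of_abs_le hfm hfb) fun ω => ?_
    · rw [abs_of_nonneg (sq_nonneg _)]
      exact pow_le_one₀ (blockDist_nonneg _ _ _ _ _) (blockDist_le_one hq _ _ _ _)
    · simp only [blockDist, hf]
      rw [mul_pow, ← Real.rpow_natCast (_ ^ q), ← Real.rpow_mul (abs_nonneg _), Nat.cast_two,
        mul_comm q 2]
      refine mul_le_of_le_one_right (by positivity) (pow_le_one₀ (by positivity) ?_)
      exact Real.rpow_le_one (abs_nonneg _) (Real.abs_cos_le_one _) hq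
  refine h3.trans_eq ?_
  rw [integral_block h1 h2 hfm hfb]
  simp only [hf, Fin.cons_succ]
  have := isProbabilityMeasure_angle (p := p)
  simp only [integral_const, probReal_univ, one_smul]
  exact integral_sin_linear h1 h2 y (2 * q) a

end Stable

/-! ### The choice of the threshold `s`. -/

/-- The estimates for the mean `N E |sin (tZ/s)|^q` (in units of `𝒬 / s^q`) on which the embedding
rests. -/
structure ScaleEstimate (p q ε R s N : ℝ) : Prop where
  scale_ge : R ≤ s
  norm_ge : 1 / 2 ≤ N
  -- This is `1 + (7/10)(1/2)`, the supremum of the normalization used for `q < p`; times `1/√2` it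
  -- stays below `24/25`.
  norm_le : N ≤ 27 / 20
  normalizer_ge : partialMoment p 2 1 ≤ thresholdNormalizer p q ε R s
  normalizer_le : thresholdNormalizer p q ε R s ≤ s ^ q
  -- The systematic error is kept to `19/20` of `ε`; the remainder absorbs a relative random
  -- deviation of `ε / 50`.
  upper : ∀ t, 1 ≤ t → N * (s ^ q * sinMoment p q (t / s)) ≤
    (1 + 19 / 20 * ε) * (t ^ q * thresholdNormalizer p q ε R s)
  lower : ∀ t, 1 ≤ t → t ≤ R → (1 - 19 / 20 * ε) * (t ^ q * thresholdNormalizer p q ε R s) ≤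
    N * (s ^ q * sinMoment p q (t / s))
  lower_of_lt : q < p → (1 + 3 / 5 * ε) * (R ^ q * thresholdNormalizer p q ε R s) ≤
    N * (s ^ q * sinMoment p q (R / s))

theorem one_le_rpow_neg {ε x : ℝ} (h0 : 0 < ε) (h1 : ε ≤ 1) (hx : 0 ≤ x) : 1 ≤ ε ^ (-x) :=
  Real.one_le_rpow_of_pos_of_le_one_of_nonpos h0 h1 (by linarith)

theorem inv_le_rpow_neg {ε x : ℝ} (h0 : 0 < ε) (h1 : ε ≤ 1) (hx : 1 ≤ x) : 1 / ε ≤ ε ^ (-x) := by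
  rw [one_div, ← Real.rpow_neg_one]
  exact Real.rpow_le_rpow_of_exponent_ge h0 h1 (by linarith)

theorem sqrt_mul_rpow_neg_half {ε : ℝ} (h0 : 0 < ε) : Real.sqrt ε * ε ^ (-(1 / 2) : ℝ) = 1 := by
  rw [Real.sqrt_eq_rpow, ← Real.rpow_add h0]
  norm_num

theorem one_add_le_mul_sq {ε : ℝ} (h0 : 0 < ε) (h2 : ε < 1 / 2) :
    1 + 3 / 5 * ε ≤ (1 + 7 / 10 * ε) * (1 - ε / 120) ^ 2 := by
  have h7 : 1 - ε / 60 ≤ (1 - ε / 120) ^ 2 := by linarith [sq_nonneg (ε / 120)]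
  refine le_trans ?_ (mul_le_mul_of_nonneg_left h7 (by positivity))
  nlinarith [mul_lt_mul_of_pos_left h2 h0]

theorem one_sub_le_mul {ε : ℝ} (h0 : 0 < ε) :
    1 - 19 / 20 * ε ≤ (1 - 3 / 5 * ε) * (1 - ε / 3) := by
  nlinarith [mul_pos h0 h0]

/-- The full moment `Q` is finite and gives the upper bound at every scale. Below, truncation at `b
= √θ s / R` loses at most a multiple of `b^(q-p) / (p-q)`, and the root `1/(p-q)` in the threshold
makes this a small multiple of `ε Q`. The inflated normalization `1 + 7ε/10` leaves the surplus
`3ε/5` required at scale `R`. -/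
theorem scaleEstimate_of_lt {p q : ℝ} (h2 : p ≤ 2) (hq1 : 1 ≤ q) (hqp : q < p) :
    ∃ A : ℝ, 1 ≤ A ∧ ∀ ε : ℝ, 0 < ε → ε < 1 / 2 → ∀ R : ℝ, 1 < R →
      ∀ s : ℝ, s = A * thresholdScale p q ε R → ScaleEstimate p q ε R s (1 + 7 / 10 * ε) := by
  have h1 : 1 ≤ p := by linarith
  have hq0 : 0 ≤ q := by linarith
  have hd : 0 < p - q := by linarith
  obtain ⟨K, hK0, -, hK⟩ := exists_stableDensity_bound h1 h2
  set Q := stableMoment p q with hQ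
  have hm1 : partialMoment p 2 1 ≤ partialMoment p q 1 :=
    partialMoment_one_anti h1 h2 hq0 (by linarith)
  have hmQ : partialMoment p 2 1 ≤ Q :=
    hm1.trans (partialMoment_le_stableMoment h1 h2 hq0 hK hqp zero_le_one)
  have hQ0 : 0 < Q := (partialMoment_pos h1 h2 (q := 2) (by norm_num) one_pos).trans_le hmQ
  -- The last condition makes the truncation loss at most `ε Q / 120`, and `Q ≤ A` gives `Q ≤ s^q`.
  -- None of the conditions involves `ε` or `R`.
  obtain ⟨A, hA1, hAQ, hA⟩ : ∃ A : ℝ, 1 ≤ A ∧ Q ≤ A ∧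
      2 * K / (p - q) ^ 2 * (A * Real.sqrt (1 / 40)) ^ (-(p - q)) ≤ Q / 120 := by
    have ht : Tendsto (fun A : ℝ => 2 * K / (p - q) ^ 2 *
        (A * Real.sqrt (1 / 40)) ^ (-(p - q))) atTop (𝓝 (2 * K / (p - q) ^ 2 * 0)) :=
      ((tendsto_rpow_neg_atTop hd).comp (tendsto_id.atTop_mul_const (by positivity))).const_mul _
    rw [mul_zero] at ht
    have := ht.eventually (ge_mem_nhds (show 0 < Q / 120 by positivity))
    obtain ⟨A, hA, hA1, hA2⟩ := (this.and ((eventually_ge_atTop 1).and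
      (eventually_ge_atTop Q))).exists
    exact ⟨A, hA1, hA2, hA⟩
  refine ⟨A, hA1, fun ε hε0 hε2 R hR s hs => ?_⟩
  have hε1 : ε ≤ 1 := by linarith
  have hR0 : 0 < R := by linarith
  have hA0 : 0 < A := by linarith
  set D := 1 + (p - q) * ε ^ (-(q / 2 + 1)) with hD
  have hpw : 1 / ε ≤ ε ^ (-(q / 2 + 1)) := inv_le_rpow_neg hε0 hε1 (by linarith)
  have hpw0 : 0 < ε ^ (-(q / 2 + 1)) := by positivity
  clear_value D Q
  have hD1 : 1 ≤ D := by
    have : 0 ≤ (p - q) * ε ^ (-(q / 2 + 1)) := by positivity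
    linarith
  have hDε : (p - q) / ε ≤ D := by
    have := mul_le_mul_of_nonneg_left hpw hd.le
    rw [mul_one_div] at this
    linarith
  have hs' : s = A * (R * ε ^ (-(1 / 2) : ℝ) * D ^ (1 / (p - q))) := by
    rw [hs, thresholdScale, if_pos hqp, hD]
  have hDr : 1 ≤ D ^ (1 / (p - q)) := Real.one_le_rpow hD1 (by positivity)
  have hεr : 1 ≤ ε ^ (-(1 / 2) : ℝ) := one_le_rpow_neg hε0 hε1 (by norm_num)
  have hARs : A * R ≤ s := by
    rw [hs']
    have : A * R * (1 * 1) ≤ A * R * (ε ^ (-(1 / 2) : ℝ) * D ^ (1 / (p - q))) := by gcongr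
    linarith
  have hs0 : 0 < s := lt_of_lt_of_le (by positivity) hARs
  have hAs : A ≤ s := (le_mul_of_one_le_right hA0.le hR.le).trans hARs
  have hRs : R ≤ s := (le_mul_of_one_le_left hR0.le hA1).trans hARs
  have hs1 : 1 ≤ s := hR.le.trans hRs
  have hnorm : thresholdNormalizer p q ε R s = Q := by rw [thresholdNormalizer, if_pos hqp, hQ]
  have hsq : s ≤ s ^ q := by
    have := Real.rpow_le_rpow_of_exponent_le hs1 hq1
    rwa [Real.rpow_one] at this
  -- The linearization loss `θ / 3` becomes `ε / 120`, equal to the truncation loss; together they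
  -- give the factor `(1 - ε/120)^2`.
  obtain ⟨θ, hθ⟩ : ∃ θ, θ = ε / 40 := ⟨_, rfl⟩
  have hb : Real.sqrt θ * s / R = A * Real.sqrt (1 / 40) * D ^ (1 / (p - q)) := by
    rw [hs', hθ, show ε / 40 = 1 / 40 * ε by ring, Real.sqrt_mul (by norm_num)]
    have := sqrt_mul_rpow_neg_half hε0
    field_simp
    linear_combination this
  have hθ0 : 0 < θ := by linarith
  have hb0 : 0 < Real.sqrt θ * s / R := by positivity
  have hbp : (Real.sqrt θ * s / R) ^ (q - p) ≤
      (A * Real.sqrt (1 / 40)) ^ (-(p - q)) * (ε / (p - q)) := by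
    rw [hb, Real.mul_rpow (by positivity) (by positivity), ← Real.rpow_mul (by positivity),
      show 1 / (p - q) * (q - p) = -1 by field_simp; ring, Real.rpow_neg_one,
      show q - p = -(p - q) by ring]
    gcongr
    rw [inv_eq_one_div, show ε / (p - q) = 1 / ((p - q) / ε) by rw [one_div_div]]
    exact one_div_le_one_div_of_le (by positivity) hDε
  have hM : Q * (1 - ε / 120) ≤ partialMoment p q (Real.sqrt θ * s / R) := by
    refine le_trans ?_ (stableMoment_sub_le_partialMoment h1 h2 hq0 hK hqp hb0)
    have : 2 * K * ((Real.sqrt θ * s / R) ^ (q - p) / (p - q)) ≤ Q / 120 * ε := by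
      calc 2 * K * ((Real.sqrt θ * s / R) ^ (q - p) / (p - q)) ≤
          2 * K * ((A * Real.sqrt (1 / 40)) ^ (-(p - q)) * (ε / (p - q)) / (p - q)) := by gcongr
        _ = 2 * K / (p - q) ^ 2 * (A * Real.sqrt (1 / 40)) ^ (-(p - q)) * ε := by
            field_simp
        _ ≤ Q / 120 * ε := by gcongr
    linarith
  have hlow : ∀ t, 1 ≤ t → t ≤ R → (1 + 3 / 5 * ε) * (t ^ q * Q) ≤
      (1 + 7 / 10 * ε) * (s ^ q * sinMoment p q (t / s)) := by
    intro t ht1 htR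
    have ht0 : 0 < t := by linarith
    have h3 := partialMoment_le_sinMoment h1 h2 hq1 (by linarith) (θ := θ) (by linarith)
      (by linarith) (a := t / s) (by positivity)
    have h4 : partialMoment p q (Real.sqrt θ * s / R) ≤
        partialMoment p q (Real.sqrt θ / (t / s)) := by
      refine partialMoment_mono h1 h2 hq0 ?_
      rw [div_div_eq_mul_div]
      gcongr
    have h5 : (1 - ε / 120) ^ 2 * (t ^ q * Q) ≤ s ^ q * sinMoment p q (t / s) := by
      have hsq0 : 0 < s ^ q := by positivity
      calc (1 - ε / 120) ^ 2 * (t ^ q * Q) = (1 - θ / 3) * (t ^ q * (Q * (1 - ε / 120))) := by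
            rw [hθ]; ring
        _ ≤ (1 - θ / 3) * (t ^ q * partialMoment p q (Real.sqrt θ / (t / s))) := by
            have : 0 ≤ 1 - θ / 3 := by linarith
            have := hM.trans h4
            gcongr
        _ = s ^ q * ((1 - θ / 3) * ((t / s) ^ q *
              partialMoment p q (Real.sqrt θ / (t / s)))) := by
            rw [Real.div_rpow ht0.le hs0.le]; field_simp
        _ ≤ s ^ q * sinMoment p q (t / s) := by gcongr
    have h6 : 0 ≤ t ^ q * Q := by positivity
    refine le_trans ?_ (mul_le_mul_of_nonneg_left h5 (by positivity))
    rw [← mul_assoc (1 + 7 / 10 * ε)]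
    refine mul_le_mul_of_nonneg_right ?_ h6
    exact one_add_le_mul_sq hε0 hε2
  refine ⟨hRs, by linarith, by linarith, by rwa [hnorm], ?_, ?_, ?_, ?_⟩
  · rw [hnorm]; exact hAQ.trans (hAs.trans hsq)
  · intro t ht
    have ht0 : 0 < t := by linarith
    rw [hnorm]
    have h3 := sinMoment_le_stableMoment h1 h2 hq0 hK hqp (a := t / s) (by positivity)
    have hsq0 : 0 < s ^ q := by positivity
    rw [← hQ] at h3
    have h4 : s ^ q * sinMoment p q (t / s) ≤ t ^ q * Q := by
      calc s ^ q * sinMoment p q (t / s) ≤ s ^ q * ((t / s) ^ q * Q) := by gcongr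
        _ = t ^ q * Q := by rw [Real.div_rpow ht0.le hs0.le]; field_simp
    have h6 : 0 ≤ t ^ q * Q := by positivity
    calc _ ≤ (1 + 7 / 10 * ε) * (t ^ q * Q) := by gcongr
      _ ≤ _ := mul_le_mul_of_nonneg_right (by linarith) h6
  · intro t ht htR
    rw [hnorm]
    refine le_trans ?_ (hlow t ht htR)
    have h6 : 0 ≤ t ^ q * Q := by have : 0 < t := by linarith
                                  positivity
    gcongr
    linarith
  · intro _
    rw [hnorm]
    exact hlow R hR.le le_rfl

/-- In the case `q = p` everything reduces to one comparison of truncated moments. -/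
theorem scaleEstimate_of_eq {p : ℝ} (h1 : 1 ≤ p) (h2 : p ≤ 2) {A ε R s B : ℝ} (hA : 1 ≤ A)
    (hε0 : 0 < ε) (hε2 : ε < 1 / 2) (hR : 1 < R) (hs : s = A * thresholdScale p p ε R)
    (hG : ∀ t, 1 ≤ t → sinMoment p p (t / s) ≤ (t / s) ^ p * B)
    (hB : (1 - 3 / 5 * ε) * B ≤ (1 + 19 / 20 * ε) * partialMoment p p (Real.sqrt ε * s / R)) :
    ScaleEstimate p p ε R s (1 - 3 / 5 * ε) := by
  have hε1 : ε ≤ 1 := by linarith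
  have hR0 : 0 < R := by linarith
  have hA0 : 0 < A := by linarith
  have hp0 : 0 ≤ p := by linarith
  have hεr : 1 ≤ ε ^ (-(1 / 2) : ℝ) := one_le_rpow_neg hε0 hε1 (by norm_num)
  have hexp : 1 ≤ Real.exp (ε ^ (-(p / 2 + 1))) := Real.one_le_exp (by positivity)
  have hs' : A * (R * ε ^ (-(1 / 2) : ℝ)) ≤ s := by
    rw [hs, thresholdScale, if_neg (lt_irrefl p)]
    gcongr
    refine le_trans ?_ (le_max_right _ _)
    exact le_mul_of_one_le_right (by positivity) hexp
  have hs0 : 0 < s := lt_of_lt_of_le (by positivity) hs'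
  have hRs : R ≤ s := by
    refine le_trans ?_ hs'
    have : 1 * (R * 1) ≤ A * (R * ε ^ (-(1 / 2) : ℝ)) := by gcongr
    linarith
  set b := Real.sqrt ε * s / R with hb
  -- The truncation point is at least `1`, so the normalizer is bounded below by `partialMoment p 2
  -- 1`, independently of `ε`, `R` and `s`.
  have hb1 : 1 ≤ b := by
    rw [hb, le_div_iff₀ hR0, one_mul]
    calc R = Real.sqrt ε * (1 * (R * ε ^ (-(1 / 2) : ℝ))) := by
          linear_combination (-R) * sqrt_mul_rpow_neg_half hε0
      _ ≤ Real.sqrt ε * (A * (R * ε ^ (-(1 / 2) : ℝ))) := by gcongr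
      _ ≤ Real.sqrt ε * s := by gcongr
  have hbs : b ≤ s := by
    rw [hb, div_le_iff₀ hR0]
    have : Real.sqrt ε ≤ 1 := Real.sqrt_le_one.2 hε1
    nlinarith
  have hnorm : thresholdNormalizer p p ε R s = partialMoment p p b := by
    rw [thresholdNormalizer, if_neg (lt_irrefl p), truncatedMoment_eq, div_div_eq_mul_div, hb]
  have hM0 : 0 < partialMoment p p b := partialMoment_pos h1 h2 hp0 (by linarith)
  refine ⟨hRs, by linarith, by linarith, ?_, ?_, ?_, ?_, fun h => absurd h (lt_irrefl p)⟩
  · rw [hnorm]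
    exact (partialMoment_one_anti h1 h2 hp0 h2).trans (partialMoment_mono h1 h2 hp0 hb1)
  · rw [hnorm]
    refine (partialMoment_le_rpow h1 h2 hp0 (by linarith)).trans ?_
    gcongr
  · intro t ht
    have ht0 : 0 < t := by linarith
    rw [hnorm]
    have hsq0 : 0 < s ^ p := by positivity
    have htq0 : 0 < t ^ p := by positivity
    have hN : 0 ≤ 1 - 3 / 5 * ε := by linarith
    calc (1 - 3 / 5 * ε) * (s ^ p * sinMoment p p (t / s)) ≤
        (1 - 3 / 5 * ε) * (s ^ p * ((t / s) ^ p * B)) := by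
          have := hG t ht
          gcongr
      _ = t ^ p * ((1 - 3 / 5 * ε) * B) := by
          rw [Real.div_rpow ht0.le hs0.le]; field_simp
      _ ≤ t ^ p * ((1 + 19 / 20 * ε) * partialMoment p p b) := by gcongr
      _ = _ := by ring
  · intro t ht htR
    have ht0 : 0 < t := by linarith
    rw [hnorm]
    have h3 := partialMoment_le_sinMoment h1 h2 h1 h2 (θ := ε) hε0.le
      hε1 (a := t / s) (by positivity)
    have h4 : partialMoment p p b ≤ partialMoment p p (Real.sqrt ε / (t / s)) := by
      refine partialMoment_mono h1 h2 hp0 ?_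
      rw [div_div_eq_mul_div, hb]
      gcongr
    have hsq0 : 0 < s ^ p := by positivity
    have htq0 : 0 < t ^ p := by positivity
    have h5 : (1 - ε / 3) * (t ^ p * partialMoment p p b) ≤ s ^ p * sinMoment p p (t / s) := by
      calc (1 - ε / 3) * (t ^ p * partialMoment p p b) ≤
          (1 - ε / 3) * (t ^ p * partialMoment p p (Real.sqrt ε / (t / s))) := by
            have : 0 ≤ 1 - ε / 3 := by linarith
            gcongr
        _ = s ^ p * ((1 - ε / 3) * ((t / s) ^ p *
              partialMoment p p (Real.sqrt ε / (t / s)))) := by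
            rw [Real.div_rpow ht0.le hs0.le]; field_simp
        _ ≤ s ^ p * sinMoment p p (t / s) := by gcongr
    have h6 : 0 ≤ t ^ p * partialMoment p p b := by positivity
    refine le_trans ?_ (mul_le_mul_of_nonneg_left h5 (by linarith))
    rw [← mul_assoc (1 - 3 / 5 * ε)]
    refine mul_le_mul_of_nonneg_right ?_ h6
    exact one_sub_le_mul hε0

/-- The Gaussian has a finite second moment, so the comparison is between `Q` and its truncation.
The tail beyond `b` is at most `64 / b`, and `b ≥ A / ε` with `A ≥ 64 / Q` makes it at most `ε Q`.
-/
theorem scaleEstimate_two :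
    ∃ A : ℝ, 1 ≤ A ∧ ∀ ε : ℝ, 0 < ε → ε < 1 / 2 → ∀ R : ℝ, 1 < R →
      ∀ s : ℝ, s = A * thresholdScale 2 2 ε R → ScaleEstimate 2 2 ε R s (1 - 3 / 5 * ε) := by
  have h12 : (1 : ℝ) ≤ 2 := by norm_num
  have hK : ∀ u : ℝ, 0 < u → stableDensity 2 u ≤ 32 * u ^ (-1 - 3 : ℝ) := fun u hu => by
    have := stableDensity_two_le hu
    rwa [show (-1 - 3 : ℝ) = -4 by norm_num]
  set Q := stableMoment 2 2 with hQ
  have hQ0 : 0 < Q := (partialMoment_pos h12 le_rfl (q := 2) (by norm_num) one_pos).trans_le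
    (partialMoment_le_stableMoment h12 le_rfl (by norm_num) hK (by norm_num) zero_le_one)
  refine ⟨max 1 (64 / Q), le_max_left _ _, fun ε hε0 hε2 R hR s hs => ?_⟩
  set A := max 1 (64 / Q) with hA
  have hA1 : 1 ≤ A := le_max_left _ _
  have hAQ : 64 ≤ A * Q := by
    have : 64 / Q ≤ A := le_max_right _ _
    rwa [div_le_iff₀ hQ0] at this
  have hR0 : 0 < R := by linarith
  refine scaleEstimate_of_eq (B := Q) h12 le_rfl hA1 hε0 hε2 hR hs (fun t ht => ?_) ?_
  · have hs0 : 0 ≤ s := by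
      rw [hs, thresholdScale, if_neg (lt_irrefl _)]
      refine mul_nonneg (by linarith) (le_max_of_le_left ?_)
      positivity
    exact sinMoment_le_stableMoment h12 le_rfl (by norm_num) hK (by norm_num) (by positivity)
  · set b := Real.sqrt ε * s / R with hb
    have hbA : A / ε ≤ b := by
      have hs' : A * (R * ε ^ (-(1 / 2) : ℝ) * Real.exp (ε ^ (-(2 / 2 + 1) : ℝ))) ≤ s := by
        rw [hs, thresholdScale, if_neg (lt_irrefl _)]
        gcongr
        exact le_max_right _ _
      have he : 1 / ε ≤ Real.exp (ε ^ (-(2 / 2 + 1) : ℝ)) := by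
        have h3 := inv_le_rpow_neg hε0 (by linarith) (show (1 : ℝ) ≤ 2 / 2 + 1 by norm_num)
        linarith [Real.add_one_le_exp (ε ^ (-(2 / 2 + 1) : ℝ))]
      rw [hb, le_div_iff₀ hR0]
      calc A / ε * R = Real.sqrt ε * (A * (R * ε ^ (-(1 / 2) : ℝ) * (1 / ε))) := by
            linear_combination (-A / ε * R) * sqrt_mul_rpow_neg_half hε0
        _ ≤ Real.sqrt ε * (A * (R * ε ^ (-(1 / 2) : ℝ) * Real.exp (ε ^ (-(2 / 2 + 1) : ℝ)))) := by
            gcongr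
        _ ≤ Real.sqrt ε * s := by gcongr
    have hb0 : 0 < b := lt_of_lt_of_le (by positivity) hbA
    have h3 := stableMoment_sub_le_partialMoment h12 le_rfl (q := 2) (by norm_num) hK
      (by norm_num) hb0
    have h4 : 2 * 32 * (b ^ (2 - 3 : ℝ) / (3 - 2)) ≤ ε * Q := by
      rw [show (2 - 3 : ℝ) = -1 by norm_num, Real.rpow_neg_one]
      have h5 : b⁻¹ ≤ ε / A := by
        rw [inv_eq_one_div, show ε / A = 1 / (A / ε) by rw [one_div_div]]
        exact one_div_le_one_div_of_le (by positivity) hbA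
      have h6 : 64 * (ε / A) ≤ ε * Q := by
        rw [mul_div_assoc', div_le_iff₀ (by linarith)]
        nlinarith
      linarith
    have h7 : Q * (1 - ε) ≤ partialMoment 2 2 b := by linarith
    refine le_trans ?_ (mul_le_mul_of_nonneg_left h7 (by positivity))
    nlinarith [mul_pos hε0 hQ0, mul_pos (mul_pos hε0 hε0) hQ0]

theorem partialMoment_sub_eq {p q : ℝ} (h1 : 1 ≤ p) (hq : 0 ≤ q) {a b : ℝ} (ha : 0 < a)
    (hab : a ≤ b) :
    partialMoment p q b - partialMoment p q a =
      2 * ∫ u in Ioc a b, u ^ q * stableDensity p u := by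
  rw [partialMoment, partialMoment, ← Ioc_union_Ioc_eq_Ioc ha.le hab,
    setIntegral_union (Ioc_disjoint_Ioc_of_le le_rfl) measurableSet_Ioc
      (integrableOn_Ioc_rpow_mul_stableDensity h1 hq _ _)
      (integrableOn_Ioc_rpow_mul_stableDensity h1 hq _ _)]
  ring

theorem setIntegral_mul_inv {a b : ℝ} (ha : 0 < a) (hab : a ≤ b) (c : ℝ) :
    ∫ u in Ioc a b, c * u⁻¹ = c * Real.log (b / a) := by
  rw [integral_const_mul, ← intervalIntegral.integral_of_le hab,
    integral_inv_of_pos ha (ha.trans_le hab)]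

theorem integrableOn_mul_inv {a b : ℝ} (ha : 0 < a) (c : ℝ) :
    IntegrableOn (fun u => c * u⁻¹) (Ioc a b) := by
  refine IntegrableOn.mono_set (t := Icc a b) (ContinuousOn.integrableOn_Icc ?_) Ioc_subset_Icc_self
  exact continuousOn_const.mul (continuousOn_inv₀.mono fun x hx => (ha.trans_le hx.1).ne')

theorem rpow_mul_stableDensity_eq {p u : ℝ} (hu : 0 < u) :
    u ^ p * stableDensity p u = u ^ (1 + p) * stableDensity p u * u⁻¹ := by
  rw [Real.rpow_add hu, Real.rpow_one]
  field_simp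

/-- For `q = p` the integrand is `u^(1+p) h(u)` divided by `u`, of order `c / u`: truncated moments
grow logarithmically. -/
theorem partialMoment_sub_le_log {p : ℝ} (h1 : 1 ≤ p) {a b c : ℝ} (ha : 0 < a) (hab : a ≤ b)
    (hc : ∀ u, a ≤ u → u ^ (1 + p) * stableDensity p u ≤ c) :
    partialMoment p p b - partialMoment p p a ≤ 2 * c * Real.log (b / a) := by
  rw [partialMoment_sub_eq h1 (by linarith) ha hab, mul_assoc, ← setIntegral_mul_inv ha hab]
  refine mul_le_mul_of_nonneg_left ?_ (by norm_num)
  refine setIntegral_mono_on (integrableOn_Ioc_rpow_mul_stableDensity h1 (by linarith) _ _)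
    (integrableOn_mul_inv ha c) measurableSet_Ioc fun u hu => ?_
  have hu0 : 0 < u := ha.trans hu.1
  rw [rpow_mul_stableDensity_eq hu0]
  exact mul_le_mul_of_nonneg_right (hc u hu.1.le) (by positivity)

theorem log_le_partialMoment_sub {p : ℝ} (h1 : 1 ≤ p) {a b c : ℝ} (ha : 0 < a) (hab : a ≤ b)
    (hc : ∀ u, a ≤ u → c ≤ u ^ (1 + p) * stableDensity p u) :
    2 * c * Real.log (b / a) ≤ partialMoment p p b - partialMoment p p a := by
  rw [partialMoment_sub_eq h1 (by linarith) ha hab, mul_assoc, ← setIntegral_mul_inv ha hab]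
  refine mul_le_mul_of_nonneg_left ?_ (by norm_num)
  refine setIntegral_mono_on (integrableOn_mul_inv ha c)
    (integrableOn_Ioc_rpow_mul_stableDensity h1 (by linarith) _ _) measurableSet_Ioc fun u hu => ?_
  have hu0 : 0 < u := ha.trans hu.1
  rw [rpow_mul_stableDensity_eq hu0]
  exact mul_le_mul_of_nonneg_right (hc u hu.1.le) (by positivity)

/-- For small `ε` the power `ε^(-1/2)` beats the logarithm; the remaining `ε` are bounded away from
zero, and the term `ε T` covers them. -/
theorem exists_log_inv_add_le {δ : ℝ} (hδ : 0 < δ) (C : ℝ) :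
    ∃ T : ℝ, 0 ≤ T ∧ ∀ ε : ℝ, 0 < ε → ε < 1 →
      -Real.log ε + C ≤ δ * ε ^ (-(1 / 2) : ℝ) + ε * T := by
  have h1 : Tendsto (fun x : ℝ => δ * x ^ (1 / 2 : ℝ) - Real.log x) atTop atTop := by
    have h2 := (isLittleO_log_rpow_atTop (r := 1 / 2) (by norm_num)).bound (half_pos hδ)
    have h3 : Tendsto (fun x : ℝ => δ / 2 * x ^ (1 / 2 : ℝ)) atTop atTop :=
      (tendsto_rpow_atTop (by norm_num)).const_mul_atTop (half_pos hδ)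
    refine tendsto_atTop_mono' _ ?_ h3
    filter_upwards [h2, eventually_ge_atTop 0] with x hx hx0
    have h4 : Real.log x ≤ δ / 2 * x ^ (1 / 2 : ℝ) := by
      refine (le_abs_self _).trans (hx.trans_eq ?_)
      rw [Real.norm_of_nonneg (by positivity)]
    linarith
  obtain ⟨X, hX⟩ := eventually_atTop.1 (h1.eventually_ge_atTop C)
  set Y := max X 1 with hY
  have hY1 : 1 ≤ Y := le_max_right _ _
  refine ⟨Y * (Y + |C|), by positivity, fun ε h0 hε1 => ?_⟩
  by_cases h : Y ≤ ε⁻¹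
  · have := hX ε⁻¹ ((le_max_left _ _).trans h)
    rw [Real.log_inv, Real.inv_rpow h0.le, ← Real.rpow_neg h0.le] at this
    have h5 : 0 ≤ ε * (Y * (Y + |C|)) := by positivity
    linarith
  · push Not at h
    have h6 : -Real.log ε ≤ Y := by
      rw [← Real.log_inv]
      have := Real.log_le_sub_one_of_pos (inv_pos.2 h0)
      linarith
    have h7 : 1 ≤ ε * Y := by
      rw [inv_lt_iff_one_lt_mul₀ h0] at h
      linarith
    have h8 : Y + |C| ≤ ε * (Y * (Y + |C|)) := by
      rw [← mul_assoc]
      exact le_mul_of_one_le_left (by positivity) h7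
    have h9 : 0 ≤ δ * ε ^ (-(1 / 2) : ℝ) := by positivity
    linarith [le_abs_self C]

/-- The comparison of logarithms behind the choice of the threshold for `q = p`. -/
theorem log_threshold_bound {ε l r κ u a e T b : ℝ} (h0 : 0 < ε) (h2 : ε < 1 / 2) (hl : 0 ≤ l)
    (hr : 0 ≤ r) (hT : l + κ ≤ 3 / 50 * e + ε * T) (he : 0 ≤ e) (ha : T ≤ a - u) (hT0 : 0 ≤ T)
    (hb1 : ε * a + (1 - ε) * r - ε * l / 2 ≤ ε * b) (hb2 : ε * a + e ≤ ε * b) :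
    (1 - 3 / 5 * ε) * (51 / 50 * (r + l / 2)) + κ ≤ 31 / 20 * (ε * (49 / 50 * (b - u))) := by
  -- The two lower bounds for `ε b` are averaged with weights `24/25` and `1/25`: the first pays for
  -- `r`, the second for `l + κ`. The constant `3/50` is just below `(31/20)(49/50)(1/25)`.
  have hb : ε * a + 24 / 25 * ((1 - ε) * r - ε * l / 2) + e / 25 ≤ ε * b := by linarith
  have h3 : 0 ≤ (1 / 2 - ε) * r := by apply mul_nonneg <;> linarith
  have h4 : 0 ≤ (1 / 2 - ε) * l := by apply mul_nonneg <;> linarith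
  have h5 : ε * T ≤ ε * (a - u) := mul_le_mul_of_nonneg_left ha h0.le
  have h6 : 0 ≤ ε * T := by positivity
  nlinarith

/-- Between `b = √ε s / R` and `s` the truncated moment grows by about `2c log (R/√ε)`, while at `b`
it is about `2c log b`. The growth must be of order `ε` relative to the latter: `R^(1/ε)` in the
threshold provides for `log R`, the exponential for `log (1/ε)` and the tail constant. -/
theorem scaleEstimate_of_eq_lt_two {p : ℝ} (h1 : 1 ≤ p) (h2 : p < 2) :
    ∃ A : ℝ, 1 ≤ A ∧ ∀ ε : ℝ, 0 < ε → ε < 1 / 2 → ∀ R : ℝ, 1 < R →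
      ∀ s : ℝ, s = A * thresholdScale p p ε R → ScaleEstimate p p ε R s (1 - 3 / 5 * ε) := by
  have hp0 : 0 ≤ p := by linarith
  obtain ⟨c, -, hc0, hc⟩ := exists_tendsto_stableDensity h1 h2.le
  have hc0 : 0 < c := hc0 h2
  obtain ⟨K, hK0, -, hK⟩ := exists_stableDensity_bound h1 h2.le
  obtain ⟨U, hU1, hU⟩ : ∃ U : ℝ, 1 ≤ U ∧ ∀ u, U ≤ u →
      49 / 50 * c ≤ u ^ (1 + p) * stableDensity p u ∧
      u ^ (1 + p) * stableDensity p u ≤ 51 / 50 * c := by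
    have h3 := hc.eventually (Icc_mem_nhds (show 49 / 50 * c < c by linarith)
      (show c < 51 / 50 * c by linarith))
    obtain ⟨U, hU⟩ := eventually_atTop.1 h3
    exact ⟨max U 1, le_max_right _ _, fun u hu => hU u ((le_max_left _ _).trans hu)⟩
  obtain ⟨T, hT0, hT⟩ := exists_log_inv_add_le (show (0 : ℝ) < 3 / 50 by norm_num) (K / c)
  have hU0 : 0 < U := by linarith
  have hA1 : 1 ≤ U * Real.exp T := one_le_mul_of_one_le_of_one_le hU1 (Real.one_le_exp hT0)
  -- `U` is where the density comes within two percent of its asymptotics; the factor `exp T` adds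
  -- `T` to `log b - log U`, which pays for the term `ε T`.
  refine ⟨U * Real.exp T, hA1, fun ε hε0 hε2 R hR s hs => ?_⟩
  have hUA : U ≤ U * Real.exp T := le_mul_of_one_le_right hU0.le (Real.one_le_exp hT0)
  have hAT : T ≤ Real.log (U * Real.exp T) - Real.log U := by
    rw [Real.log_mul hU0.ne' (Real.exp_pos _).ne', Real.log_exp]; linarith
  generalize U * Real.exp T = A at hs hA1 hUA hAT
  have hR0 : 0 < R := by linarith
  have hA0 : 0 < A := by linarith
  have hs1 : A * R ^ (1 / ε) ≤ s := by
    rw [hs, thresholdScale, if_neg (lt_irrefl p)]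
    gcongr
    exact le_max_left _ _
  have hs2 : A * (R * ε ^ (-(1 / 2) : ℝ) * Real.exp (ε ^ (-(p / 2 + 1)))) ≤ s := by
    rw [hs, thresholdScale, if_neg (lt_irrefl p)]
    gcongr
    exact le_max_right _ _
  have hs0 : 0 < s := lt_of_lt_of_le (by positivity) hs1
  have hR1 : 1 ≤ R ^ (1 / ε) := Real.one_le_rpow hR.le (by positivity)
  have hsε : 0 < Real.sqrt ε := Real.sqrt_pos.2 hε0
  -- For `t ≥ 1` the split point `s / t` is at most `s`, so this `B` serves all scales; `2 K` bounds
  -- the tail beyond the split, since `p ≥ 1`.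
  refine scaleEstimate_of_eq (B := partialMoment p p s + 2 * K) h1 h2.le hA1 hε0 hε2 hR hs
    (fun t ht => ?_) ?_
  · have ht0 : 0 < t := by linarith
    have hpow : 0 ≤ (t / s) ^ p := by positivity
    refine (sinMoment_le_partialMoment_add h1 h2.le hp0 hK (a := t / s) (by positivity)).trans ?_
    rw [mul_add]
    have h3 : partialMoment p p (1 / (t / s)) ≤ partialMoment p p s := by
      refine partialMoment_mono h1 h2.le hp0 ?_
      rw [one_div_div]
      exact div_le_self hs0.le ht
    have h4 : 2 * K * (t / s) ^ p / p ≤ (t / s) ^ p * (2 * K) := by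
      rw [mul_comm (2 * K)]
      exact div_le_self (by positivity) h1
    have h5 := mul_le_mul_of_nonneg_left h3 hpow
    linarith
  · set b := Real.sqrt ε * s / R with hb
    have hbA : A * Real.exp (ε ^ (-(p / 2 + 1))) ≤ b := by
      rw [hb, le_div_iff₀ hR0]
      calc A * Real.exp (ε ^ (-(p / 2 + 1))) * R =
            Real.sqrt ε * (A * (R * ε ^ (-(1 / 2) : ℝ) * Real.exp (ε ^ (-(p / 2 + 1))))) := by
            linear_combination (-A * R * Real.exp (ε ^ (-(p / 2 + 1)))) * sqrt_mul_rpow_neg_half hε0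
        _ ≤ Real.sqrt ε * s := by gcongr
    have hUb : U ≤ b := hUA.trans (le_trans
      (le_mul_of_one_le_right hA0.le (Real.one_le_exp (by positivity))) hbA)
    have hb0 : 0 < b := by linarith
    have hsb : s / b = R / Real.sqrt ε := by
      rw [hb]; field_simp
    have hlogsqrt : Real.log (Real.sqrt ε) = Real.log ε / 2 := Real.log_sqrt hε0.le
    have hlsb : Real.log (s / b) = Real.log R + -Real.log ε / 2 := by
      rw [hsb, Real.log_div hR0.ne' hsε.ne', hlogsqrt]; ring
    have hlb1 : ε * Real.log A + (1 - ε) * Real.log R - ε * -Real.log ε / 2 ≤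
        ε * Real.log b := by
      have h3 : Real.log (A * R ^ (1 / ε)) ≤ Real.log s :=
        Real.log_le_log (by positivity) hs1
      rw [Real.log_mul hA0.ne' (by positivity), Real.log_rpow hR0] at h3
      have h4 : Real.log b = Real.log ε / 2 + Real.log s - Real.log R := by
        rw [hb, Real.log_div (by positivity) hR0.ne', Real.log_mul hsε.ne' hs0.ne', hlogsqrt]
      have h5 := mul_le_mul_of_nonneg_left h3 hε0.le
      have h6 : ε * (1 / ε * Real.log R) = Real.log R := by field_simp
      rw [h4]
      linarith
    have hlb2 : ε * Real.log A + ε ^ (-(1 / 2) : ℝ) ≤ ε * Real.log b := by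
      have h3 : Real.log (A * Real.exp (ε ^ (-(p / 2 + 1)))) ≤ Real.log b :=
        Real.log_le_log (by positivity) hbA
      rw [Real.log_mul hA0.ne' (Real.exp_pos _).ne', Real.log_exp] at h3
      have h4 : ε * ε ^ (-(p / 2 + 1)) = ε ^ (-(p / 2)) := by
        nth_rewrite 1 [← Real.rpow_one ε]
        rw [← Real.rpow_add hε0]
        congr 1; ring
      have h5 : ε ^ (-(1 / 2) : ℝ) ≤ ε ^ (-(p / 2)) :=
        Real.rpow_le_rpow_of_exponent_ge hε0 (by linarith) (by linarith)
      have h6 := mul_le_mul_of_nonneg_left h3 hε0.le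
      linarith
    have hkey := log_threshold_bound hε0 hε2 (l := -Real.log ε) (r := Real.log R) (κ := K / c)
      (u := Real.log U) (a := Real.log A) (by linarith [Real.log_nonpos hε0.le (by linarith)])
      (Real.log_nonneg hR.le) (hT ε hε0 (by linarith)) (by positivity) hAT hT0 hlb1 hlb2
    have hbs : b ≤ s := by
      rw [hb, div_le_iff₀ hR0]
      have : Real.sqrt ε ≤ 1 := Real.sqrt_le_one.2 (by linarith)
      nlinarith
    have h3 := partialMoment_sub_le_log h1 hb0 hbs fun u hu => (hU u (hUb.trans hu)).2
    have h4 := log_le_partialMoment_sub h1 hU0 hUb fun u hu => (hU u hu).1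
    have h5 : 0 < partialMoment p p U := partialMoment_pos h1 h2.le hp0 hU0
    rw [hlsb] at h3
    rw [Real.log_div hb0.ne' hU0.ne'] at h4
    have h6 := mul_le_mul_of_nonneg_left hkey (show 0 ≤ 2 * c by linarith)
    have h7 : 2 * c * (K / c) = 2 * K := by field_simp
    have h8 : (1 - 3 / 5 * ε) * (partialMoment p p s - partialMoment p p b) ≤ (1 - 3 / 5 * ε) *
        (2 * (51 / 50 * c) * (Real.log R + -Real.log ε / 2)) :=
      mul_le_mul_of_nonneg_left h3 (by linarith)
    have h9 : ε * (2 * (49 / 50 * c) * (Real.log b - Real.log U)) ≤ ε * partialMoment p p b :=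
      mul_le_mul_of_nonneg_left (by linarith) hε0.le
    have h10 : (1 - 3 / 5 * ε) * (2 * K) ≤ 2 * K :=
      mul_le_of_le_one_left (by linarith) (by linarith)
    linarith

theorem exists_scaleEstimate {p q : ℝ} (h2 : p ≤ 2) (hq1 : 1 ≤ q) (hqp : q ≤ p) :
    ∃ A : ℝ, 1 ≤ A ∧ ∀ ε : ℝ, 0 < ε → ε < 1 / 2 → ∀ R : ℝ, 1 < R →
      ∀ s : ℝ, s = A * thresholdScale p q ε R → ∃ N, ScaleEstimate p q ε R s N := by
  have key : ∃ N : ℝ → ℝ, ∃ A : ℝ, 1 ≤ A ∧ ∀ ε : ℝ, 0 < ε → ε < 1 / 2 → ∀ R : ℝ, 1 < R →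
      ∀ s : ℝ, s = A * thresholdScale p q ε R → ScaleEstimate p q ε R s (N ε) := by
    rcases hqp.lt_or_eq with h | rfl
    · exact ⟨_, scaleEstimate_of_lt h2 hq1 h⟩
    · rcases h2.lt_or_eq with h | rfl
      · exact ⟨_, scaleEstimate_of_eq_lt_two hq1 h⟩
      · exact ⟨_, scaleEstimate_two⟩
  obtain ⟨N, A, hA, h⟩ := key
  exact ⟨A, hA, fun ε h0 h3 R hR s hs => ⟨_, h ε h0 h3 R hR s hs⟩⟩

/-! ### Semantics of straight-line programs. -/

section StraightLine

variable {m r : ℕ}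

/-- Running a straight-line code from a given memory. -/
def Instr.run (x : Fin m → ℝ) (ω : Fin r → ℝ) (code : List (Instr m r)) (mem : List ℝ) : List ℝ :=
  code.foldl (fun mem c => mem ++ [c.eval x ω mem]) mem

/-- The addresses read by an instruction are all smaller than `n`. -/
def Instr.ReadsBelow (n : ℕ) : Instr m r → Prop
  | .add a b => a < n ∧ b < n
  | .mul a b => a < n ∧ b < n
  | .sin a => a < n
  | _ => True

theorem Instr.run_cons (x : Fin m → ℝ) (ω : Fin r → ℝ) (c : Instr m r) (code : List (Instr m r))
    (mem : List ℝ) : Instr.run x ω (c :: code) mem = Instr.run x ω code (mem ++ [c.eval x ω mem]) :=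
  rfl

theorem Instr.run_append (x : Fin m → ℝ) (ω : Fin r → ℝ) (c d : List (Instr m r))
    (mem : List ℝ) : Instr.run x ω (c ++ d) mem = Instr.run x ω d (Instr.run x ω c mem) :=
  List.foldl_append

theorem Instr.exists_run_eq_append (x : Fin m → ℝ) (ω : Fin r → ℝ) (code : List (Instr m r))
    (mem : List ℝ) : ∃ l, Instr.run x ω code mem = mem ++ l ∧ l.length = code.length := by
  induction code generalizing mem with
  | nil => exact ⟨[], by simp [Instr.run]⟩
  | cons c code ih =>
    obtain ⟨l, hl, hl'⟩ := ih (mem ++ [c.eval x ω mem])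
    exact ⟨c.eval x ω mem :: l, by rw [Instr.run_cons, hl]; simp, by simp [hl']⟩

theorem Instr.eval_congr (x : Fin m → ℝ) (ω : Fin r → ℝ) {mem mem' : List ℝ} {n : ℕ}
    (h : ∀ i < n, mem.getD i 0 = mem'.getD i 0) {c : Instr m r} (hc : c.ReadsBelow n) :
    c.eval x ω mem = c.eval x ω mem' := by
  cases c with
  | const c => rfl
  | input i => rfl
  | seed j => rfl
  | add a b => simp only [Instr.eval, h a hc.1, h b hc.2]
  | mul a b => simp only [Instr.eval, h a hc.1, h b hc.2]
  | sin a => simp only [Instr.eval, h a hc]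

/-- Memory is only ever appended to, so an instruction that reads earlier cells sees there what the
final memory contains. The run is thus described by equations in the final memory alone. -/
theorem Instr.run_getD (x : Fin m → ℝ) (ω : Fin r → ℝ) (code : List (Instr m r)) {n : ℕ}
    (hn : n < code.length) (hc : (code[n]).ReadsBelow n) :
    (Instr.run x ω code []).getD n 0 = (code[n]).eval x ω (Instr.run x ω code []) := by
  have hsplit : code = code.take n ++ code[n] :: code.drop (n + 1) := by simp
  obtain ⟨l, hl, hl'⟩ := Instr.exists_run_eq_append x ω (code.take n) []
  rw [List.nil_append] at hl
  have hln : l.length = n := by rw [hl', List.length_take]; omega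
  obtain ⟨l', h', -⟩ := Instr.exists_run_eq_append x ω (code.drop (n + 1))
    (l ++ [(code[n]).eval x ω l])
  have hrun : Instr.run x ω code [] = l ++ ((code[n]).eval x ω l :: l') := by
    conv_lhs => rw [hsplit]
    rw [Instr.run_append, hl, Instr.run_cons, h', List.append_assoc, List.singleton_append]
  have heq : ∀ i < n, l.getD i 0 = (Instr.run x ω code []).getD i 0 := fun i hi => by
    rw [hrun, List.getD_append _ _ _ _ (hi.trans_eq hln.symm)]
  rw [← Instr.eval_congr x ω heq hc, hrun, List.getD_append_right _ _ _ _ hln.le, hln]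
  simp

end StraightLine

/-! ### The program computing the embedding. -/

section Sketch

variable {m k : ℕ}

/-- Row `i` of the part of the code that computes output coordinate `j`: row `0` sets up the zero
accumulator, row `i + 1` adds the product of the input coordinate `i` and its random coefficient, and
the last two rows rescale, shift by the random angle, and apply the sine. -/
def sketchRow (m k : ℕ) (α β : ℝ) (j : Fin k) (i : Fin (m + 3)) : Fin 4 → Instr m (k * (m + 1)) :=
  -- `b` is the address of the first cell of the row. Each row has four cells, padded with zeros, so
  -- that `b - 1` is the last cell of the preceding row, which holds the running value.
  let b := 4 * (i.val + (m + 3) * j.val)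
  if h0 : i.val = 0 then ![.const 0, .const 0, .const 0, .const 0]
  else if h : i.val ≤ m then
    ![.input ⟨i.val - 1, by omega⟩, .seed (finProdFinEquiv (j, ⟨i.val, by omega⟩)),
      .mul b (b + 1), .add (b - 1) (b + 2)]
  else if i.val = m + 1 then
    ![.const α, .mul (b - 1) b, .seed (finProdFinEquiv (j, 0)), .add (b + 1) (b + 2)]
  else ![.sin (b - 1), .const β, .mul b (b + 1), .const 0]

/-- The code of the embedding. -/
def sketchCode (m k : ℕ) (α β : ℝ) : List (Instr m (k * (m + 1))) :=
  List.ofFn fun x : Fin (k * (m + 3) * 4) =>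
    sketchRow m k α β (finProdFinEquiv.symm (finProdFinEquiv.symm x).1).1
      (finProdFinEquiv.symm (finProdFinEquiv.symm x).1).2 (finProdFinEquiv.symm x).2

theorem sketchRow_readsBelow (α β : ℝ) (j : Fin k) (i : Fin (m + 3)) (c : Fin 4) :
    (sketchRow m k α β j i c).ReadsBelow (4 * (i.val + (m + 3) * j.val) + c.val) := by
  unfold sketchRow
  -- Positivity of `b` excludes truncation in `b - 1`; row `0`, where `b` may be zero, reads
  -- nothing.
  have h : i.val ≠ 0 → 0 < 4 * (i.val + (m + 3) * j.val) := by omega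
  generalize 4 * (i.val + (m + 3) * j.val) = b at h
  split_ifs with h0 h1 h2
  all_goals fin_cases c <;> simp [Instr.ReadsBelow]
  all_goals have := h h0
  all_goals omega

theorem run_sketchCode_getD (α β : ℝ) (x : Fin m → ℝ) (ω : Fin (k * (m + 1)) → ℝ) (j : Fin k)
    (i : Fin (m + 3)) (c : Fin 4) :
    (Instr.run x ω (sketchCode m k α β) []).getD (4 * (i.val + (m + 3) * j.val) + c.val) 0 =
      (sketchRow m k α β j i c).eval x ω (Instr.run x ω (sketchCode m k α β) []) := by
  set a : Fin (k * (m + 3) * 4) := finProdFinEquiv (finProdFinEquiv (j, i), c) with ha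
  have hav : a.val = 4 * (i.val + (m + 3) * j.val) + c.val := by
    simp only [ha, finProdFinEquiv_apply_val]; ring
  have hlt : a.val < (sketchCode m k α β).length := by
    rw [sketchCode, List.length_ofFn]; exact a.2
  have hget : (sketchCode m k α β)[a.val] = sketchRow m k α β j i c := by
    simp only [sketchCode, List.getElem_ofFn, Fin.eta, ha, Equiv.symm_apply_apply]
  have := Instr.run_getD x ω (sketchCode m k α β) hlt (by
    rw [hget, hav]; exact sketchRow_readsBelow α β j i c)
  rw [hget] at this
  rw [← hav, this]

theorem run_sketchCode_acc (α β : ℝ) (x : Fin m → ℝ) (ω : Fin (k * (m + 1)) → ℝ) (j : Fin k)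
    (n : ℕ) (hn : n ≤ m) :
    (Instr.run x ω (sketchCode m k α β) []).getD (4 * (n + (m + 3) * j.val) + 3) 0 =
      ∑ i ∈ Finset.range n, if h : i < m then
        x ⟨i, h⟩ * ω (finProdFinEquiv (j, ⟨i + 1, by omega⟩)) else 0 := by
  induction n with
  | zero =>
    have := run_sketchCode_getD α β x ω j ⟨0, by omega⟩ 3
    simpa [sketchRow, Instr.eval] using this
  | succ n ih =>
    have h0 := run_sketchCode_getD α β x ω j ⟨n + 1, by omega⟩ 0
    have h1 := run_sketchCode_getD α β x ω j ⟨n + 1, by omega⟩ 1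
    have h2 := run_sketchCode_getD α β x ω j ⟨n + 1, by omega⟩ 2
    have h3 := run_sketchCode_getD α β x ω j ⟨n + 1, by omega⟩ 3
    have hb : 4 * (n + 1 + (m + 3) * j.val) - 1 = 4 * (n + (m + 3) * j.val) + 3 := by omega
    have ih := ih (by omega)
    simp only [sketchRow, Nat.add_eq_zero_iff, one_ne_zero, and_false, hn, dite_true, dite_false,
      Instr.eval, Matrix.cons_val, Fin.val_zero, Fin.val_one, Fin.val_two, add_zero, hb,
      add_tsub_cancel_right] at h0 h1 h2 h3
    rw [Finset.sum_range_succ, ← ih, dif_pos (show n < m by omega)]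
    rw [h0, h1] at h2
    rw [h2] at h3
    exact h3

theorem run_sketchCode_out (α β : ℝ) (x : Fin m → ℝ) (ω : Fin (k * (m + 1)) → ℝ) (j : Fin k) :
    (Instr.run x ω (sketchCode m k α β) []).getD (4 * (m + 2 + (m + 3) * j.val) + 2) 0 =
      Real.sin ((∑ i : Fin m, x i * ω (finProdFinEquiv (j, i.succ))) * α +
        ω (finProdFinEquiv (j, 0))) * β := by
  have hacc := run_sketchCode_acc α β x ω j m le_rfl
  rw [Finset.sum_range] at hacc
  simp only [Fin.is_lt, dite_true, Fin.eta] at hacc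
  have h0 := run_sketchCode_getD α β x ω j ⟨m + 1, by omega⟩ 0
  have h1 := run_sketchCode_getD α β x ω j ⟨m + 1, by omega⟩ 1
  have h2 := run_sketchCode_getD α β x ω j ⟨m + 1, by omega⟩ 2
  have h3 := run_sketchCode_getD α β x ω j ⟨m + 1, by omega⟩ 3
  have g0 := run_sketchCode_getD α β x ω j ⟨m + 2, by omega⟩ 0
  have g1 := run_sketchCode_getD α β x ω j ⟨m + 2, by omega⟩ 1
  have g2 := run_sketchCode_getD α β x ω j ⟨m + 2, by omega⟩ 2
  have hb : 4 * (m + 1 + (m + 3) * j.val) - 1 = 4 * (m + (m + 3) * j.val) + 3 := by omega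
  have hb' : 4 * (m + 2 + (m + 3) * j.val) - 1 = 4 * (m + 1 + (m + 3) * j.val) + 3 := by omega
  have hm1 : ¬ m + 1 ≤ m := by omega
  have hm2 : ¬ m + 2 ≤ m := by omega
  have hm3 : ¬ m + 2 = m + 1 := by omega
  simp only [sketchRow, Nat.add_eq_zero_iff, one_ne_zero, and_false, dite_false, OfNat.ofNat_ne_zero,
    hm1, hm2, hm3, if_true, if_false, Instr.eval, Matrix.cons_val, Fin.val_zero, Fin.val_one,
    Fin.val_two, add_zero, hb, hb', hacc] at h0 h1 h2 h3 g0 g1 g2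
  rw [h0] at h1
  rw [h1, h2] at h3
  rw [g1, g0, show (((3 : Fin 4) : ℕ)) = 3 from rfl] at *
  rw [g2, h3]
  rfl

/-- The embedding `v ↦ (β sin (α ∑ i, g j i * v i + φ j))_j`, with stable `g j i` and uniform
angles `φ j`, as a program. -/
def sketchProgram (m k : ℕ) (α β : ℝ) : RandProgram m k where
  r := k * (m + 1)
  kind := fun x => blockKind m (finProdFinEquiv.symm x).2
  -- A bound of the form `C m k` allows no steps at all when `m = 0`; since `ℓ_p^0` is a single
  -- point, nothing need be computed there.
  code := if m = 0 then [] else sketchCode m k α β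
  out := fun j => 4 * (m + 2 + (m + 3) * j.val) + 2

theorem sketchProgram_steps_le (m k : ℕ) (α β : ℝ) :
    (sketchProgram m k α β).steps ≤ 16 * (m * k) := by
  rcases Nat.eq_zero_or_pos m with rfl | hm
  · simp [RandProgram.steps, sketchProgram]
  · simp only [RandProgram.steps, sketchProgram, hm.ne', if_false, sketchCode, List.length_ofFn]
    -- For `m ≥ 1` one has `m + 3 ≤ 4 m`, hence `4 k (m + 3) ≤ 16 m k`.
    nlinarith [Nat.zero_le k]

theorem sketchProgram_toMap (hm : m ≠ 0) (α β p q : ℝ) (ω : Fin (k * (m + 1)) → ℝ)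
    (x : EllP p m) (j : Fin k) :
    (sketchProgram m k α β).toMap p q ω x j =
      Real.sin ((∑ i : Fin m, x i * ω (finProdFinEquiv (j, i.succ))) * α +
        ω (finProdFinEquiv (j, 0))) * β := by
  rw [← run_sketchCode_out]
  simp only [RandProgram.toMap, RandProgram.memory, sketchProgram, hm, if_false, Instr.run]

end Sketch

/-! ### From deviation bounds to the guarantees of the embedding. -/

/-- The deviation bounds that the embedding satisfies for a pair of points: `t` is the distance of
the points, `W` the `q`-th power of the distance of their images, and `X` its mean. -/
def PairGood (ε t X W : ℝ) : Prop :=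
  (1 ≤ t → W ≤ (1 + ε / 50) * X ∧ (1 - ε / 50) * X ≤ W) ∧ (t < 1 → W ≤ X + ε / 50)

theorem isRangeEmbedding_of_subsingleton {p q ε R s C : ℝ} {m k : ℕ} (hq : 1 ≤ q) (hε : 0 < ε)
    (hR : 1 < R) (hT : 0 ≤ s ^ q / thresholdNormalizer p q ε R s) {S : Finset (EllP p m)}
    (hS : ∀ v ∈ S, ∀ w ∈ S, v = w) (f : EllP p m → EllP q k) (h1 : 1 ≤ p) :
    IsRangeEmbedding p q ε R s C S f := by
  have : Fact (1 ≤ ENNReal.ofReal p) := ⟨by rwa [ENNReal.one_le_ofReal]⟩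
  have : Fact (1 ≤ ENNReal.ofReal q) := ⟨by rwa [ENNReal.one_le_ofReal]⟩
  have hv : ∀ v ∈ S, ∀ w ∈ S, ‖v - w‖ = 0 := fun v hv w hw => by
    rw [hS v hv w hw, sub_self, norm_zero]
  have hf : ∀ v ∈ S, ∀ w ∈ S, ‖f v - f w‖ ^ q = 0 := fun v hv w hw => by
    rw [hS v hv w hw, sub_self, norm_zero, Real.zero_rpow (by linarith)]
  refine ⟨fun v h w h' => ?_, fun v h w h' h3 => ?_, fun _ v h w h' h3 => ?_,
    fun _ v h w h' h3 => ?_, fun v h w h' h3 => ?_, fun v h w h' h3 => ?_⟩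
  · rwa [hf v h w h']
  · rw [hv v h w h'] at h3; linarith
  · rw [hv v h w h'] at h3; linarith
  · rw [hv v h w h'] at h3; linarith
  · rw [hv v h w h'] at h3; linarith
  · rw [hf v h w h']; linarith

theorem one_div_sqrt_two_le : 1 / Real.sqrt 2 ≤ 7072 / 10000 := by
  rw [div_le_iff₀ (by positivity)]
  have : (1.4142 : ℝ) ≤ Real.sqrt 2 := Real.le_sqrt_of_sq_le (by norm_num)
  linarith

section Mean

variable {p q ε R s N : ℝ}

/-- The mean of the `q`-th power of the distance of the images of two points at distance `t`. -/
def meanDist (p q ε R s N t : ℝ) : ℝ :=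
  N * (s ^ q * sinMoment p q (t / s)) / thresholdNormalizer p q ε R s

theorem ScaleEstimate.normalizer_pos (h : ScaleEstimate p q ε R s N) (h1 : 1 ≤ p) (h2 : p ≤ 2) :
    0 < thresholdNormalizer p q ε R s :=
  (partialMoment_pos h1 h2 (by norm_num) one_pos).trans_le h.normalizer_ge

theorem ScaleEstimate.meanDist_mono (h : ScaleEstimate p q ε R s N) (h1 : 1 ≤ p) (h2 : p ≤ 2)
    (hq1 : 1 ≤ q) (hq2 : q ≤ 2) (hR : 1 < R) {t t' : ℝ} (ht : 0 ≤ t) (htt' : t ≤ t') :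
    meanDist p q ε R s N t ≤ meanDist p q ε R s N t' := by
  have hs : 0 < s := by linarith [h.scale_ge]
  have hQ := h.normalizer_pos h1 h2
  have hN : 0 < N := by linarith [h.norm_ge]
  have : sinMoment p q (t / s) ≤ sinMoment p q (t' / s) :=
    sinMoment_mono h1 h2 (by linarith) hq2 (by positivity) (by gcongr)
  unfold meanDist
  gcongr

theorem ScaleEstimate.meanDist_le_threshold (h : ScaleEstimate p q ε R s N) (h1 : 1 ≤ p)
    (h2 : p ≤ 2) (hq1 : 1 ≤ q) (hR : 1 < R) (t : ℝ) :
    meanDist p q ε R s N t ≤ 24 / 25 * (s ^ q / thresholdNormalizer p q ε R s) := by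
  have hs : 0 < s := by linarith [h.scale_ge]
  have hQ := h.normalizer_pos h1 h2
  have hN : 0 < N := by linarith [h.norm_ge]
  have h3 : sinMoment p q (t / s) ≤ 7072 / 10000 :=
    (sinMoment_le_inv_sqrt_two h1 h2 hq1 _).trans one_div_sqrt_two_le
  have hsq : 0 < s ^ q := by positivity
  rw [meanDist, ← mul_div_assoc]
  refine div_le_div_of_nonneg_right ?_ hQ.le
  calc N * (s ^ q * sinMoment p q (t / s)) ≤ 27 / 20 * (s ^ q * (7072 / 10000)) := by
        refine mul_le_mul h.norm_le (by gcongr) ?_ (by norm_num)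
        exact mul_nonneg hsq.le (integral_nonneg fun _ => by positivity)
    _ ≤ _ := by linarith

theorem ScaleEstimate.meanDist_le (h : ScaleEstimate p q ε R s N) (h1 : 1 ≤ p)
    (h2 : p ≤ 2) {t : ℝ} (ht : 1 ≤ t) :
    meanDist p q ε R s N t ≤ (1 + 19 / 20 * ε) * t ^ q := by
  rw [meanDist, div_le_iff₀ (h.normalizer_pos h1 h2), mul_assoc]
  exact h.upper t ht

theorem ScaleEstimate.le_meanDist (h : ScaleEstimate p q ε R s N) (h1 : 1 ≤ p)
    (h2 : p ≤ 2) {t : ℝ} (ht : 1 ≤ t) (htR : t ≤ R) :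
    (1 - 19 / 20 * ε) * t ^ q ≤ meanDist p q ε R s N t := by
  rw [meanDist, le_div_iff₀ (h.normalizer_pos h1 h2), mul_assoc]
  exact h.lower t ht htR

theorem ScaleEstimate.le_meanDist_of_lt (h : ScaleEstimate p q ε R s N) (h1 : 1 ≤ p)
    (h2 : p ≤ 2) (hqp : q < p) : (1 + 3 / 5 * ε) * R ^ q ≤ meanDist p q ε R s N R := by
  rw [meanDist, le_div_iff₀ (h.normalizer_pos h1 h2), mul_assoc]
  exact h.lower_of_lt hqp

/-- The deterministic half of the argument: errors of mean and deviation multiply to at most `1 ±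
ε`, and lower bounds beyond `R`, like upper bounds below `1`, follow from monotonicity of the mean.
-/
theorem ScaleEstimate.isRangeEmbedding (h : ScaleEstimate p q ε R s N) (h1 : 1 ≤ p)
    (h2 : p ≤ 2) (hq1 : 1 ≤ q) (hqp : q ≤ p) (hε0 : 0 < ε) (hε2 : ε < 1 / 2) (hR : 1 < R) {C : ℝ}
    (hC : 2 ≤ C) {m k : ℕ} {S : Finset (EllP p m)} {f : EllP p m → EllP q k}
    (hgood : ∀ v ∈ S, ∀ w ∈ S, PairGood ε ‖v - w‖ (meanDist p q ε R s N ‖v - w‖)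
      (‖f v - f w‖ ^ q)) : IsRangeEmbedding p q ε R s C S f := by
  have : Fact (1 ≤ ENNReal.ofReal p) := ⟨by rwa [ENNReal.one_le_ofReal]⟩
  have hQ := h.normalizer_pos h1 h2
  have hs : 0 < s := by linarith [h.scale_ge]
  have hup : ∀ t, 1 ≤ t → (1 + ε / 50) * meanDist p q ε R s N t ≤ (1 + ε) * t ^ q := by
    intro t ht
    have h3 := mul_le_mul_of_nonneg_left (h.meanDist_le h1 h2 ht)
      (show 0 ≤ 1 + ε / 50 by positivity)
    have h4 : (1 + ε / 50) * (1 + 19 / 20 * ε) ≤ 1 + ε := by nlinarith only [hε0, hε2]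
    have h5 : 0 ≤ t ^ q := by positivity
    have h6 := mul_le_mul_of_nonneg_right h4 h5
    linarith
  have hlow : ∀ t, 1 ≤ t → t ≤ R → (1 - ε) * t ^ q ≤ (1 - ε / 50) * meanDist p q ε R s N t := by
    intro t ht htR
    have h3 := mul_le_mul_of_nonneg_left (h.le_meanDist h1 h2 ht htR)
      (show 0 ≤ 1 - ε / 50 by linarith)
    have h4 : 1 - ε ≤ (1 - ε / 50) * (1 - 19 / 20 * ε) := by nlinarith only [hε0, hε2]
    have h5 : 0 ≤ t ^ q := by positivity
    have h6 := mul_le_mul_of_nonneg_right h4 h5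
    linarith
  have hmono : ∀ t, R ≤ t → (1 - ε / 50) * meanDist p q ε R s N R ≤
      (1 - ε / 50) * meanDist p q ε R s N t := fun t ht =>
    mul_le_mul_of_nonneg_left (h.meanDist_mono h1 h2 hq1 (by linarith) hR (by linarith) ht)
      (by linarith)
  refine ⟨fun v hv w hw => ?_, fun v hv w hw ht => ?_, fun hlt v hv w hw ht => ?_,
    fun _ v hv w hw ht => ?_, fun v hv w hw ht htR => ?_, fun v hv w hw ht => ?_⟩
  · have hg := hgood v hv w hw
    have h3 := h.meanDist_le_threshold h1 h2 hq1 hR ‖v - w‖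
    -- For `t < 1` the deviation is additive; it fits under the threshold because the threshold is
    -- at least `1` and the mean uses only `24/25` of it.
    have h4 : 1 ≤ s ^ q / thresholdNormalizer p q ε R s := (one_le_div hQ).2 h.normalizer_le
    rcases le_or_gt 1 ‖v - w‖ with ht | ht
    · refine (hg.1 ht).1.trans ?_
      have h5 := mul_le_mul_of_nonneg_left h3 (show 0 ≤ 1 + ε / 50 by positivity)
      have h6 : (1 + ε / 50) * (24 / 25) ≤ 1 := by linarith
      have h7 := mul_le_mul_of_nonneg_right h6 (zero_le_one.trans h4)
      linarith
    · have := hg.2 ht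
      linarith
  · have hg := hgood v hv w hw
    refine (hg.1 (by linarith)).1.trans ((hup _ (by linarith)).trans ?_)
    have h5 : 0 ≤ ‖v - w‖ ^ q := by positivity
    exact mul_le_mul_of_nonneg_right (by linarith) h5
  · refine le_trans ?_ (((hmono _ ht.le)).trans ((hgood v hv w hw).1 (by linarith)).2)
    have h3 := mul_le_mul_of_nonneg_left (h.le_meanDist_of_lt h1 h2 hlt)
      (show 0 ≤ 1 - ε / 50 by linarith)
    have h4 : 1 + ε / 2 ≤ (1 - ε / 50) * (1 + 3 / 5 * ε) := by nlinarith only [hε0, hε2]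
    have h5 : 0 ≤ R ^ q := by positivity
    have h6 := mul_le_mul_of_nonneg_right h4 h5
    linarith
  · exact (hlow R hR.le le_rfl).trans
      ((hmono _ ht.le).trans ((hgood v hv w hw).1 (by linarith)).2)
  · have hg := (hgood v hv w hw).1 ht
    exact ⟨(hlow _ ht htR).trans hg.2, hg.1.trans (hup _ ht)⟩
  · have hg := (hgood v hv w hw).2 ht
    have h3 := h.meanDist_mono h1 h2 hq1 (by linarith) hR (norm_nonneg (v - w)) ht.le
    have h4 := h.meanDist_le h1 h2 (t := 1) le_rfl
    rw [Real.one_rpow] at h4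
    linarith

end Mean

/-! ### Concentration for one pair and the union bound. -/

/-- The exponent available in Bernstein's inequality for a pair of points, in terms of the
dimension factor. -/
theorem bernstein_rate {p q ε s c c' K x d V : ℝ} (hpq : 0 < q) (hs : 1 ≤ s) (hε0 : 0 < ε)
    (hε1 : ε ≤ 1) (hc0 : 0 < c) (hc'0 : 0 < c') (hK : 1 ≤ K) (hcc : 2 * c' ≤ c)
    (hcc' : 4 * c' * K ≤ c ^ 2) (hx0 : 1 / s ≤ x) (hd : c * (ε * x ^ q) ≤ d) (hV1 : V ≤ 1)
    (hV : p < 2 * q → V ≤ K * (x ^ p / (2 * q - p))) :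
    2 * (c' * (ε ^ 2 / dimFactor p q ε s)) ≤ d ∧
      4 * (c' * (ε ^ 2 / dimFactor p q ε s)) * V ≤ d ^ 2 := by
  have hs0 : 0 < s := by linarith
  have hx : 0 < x := lt_of_lt_of_le (by positivity) hx0
  have hd0 : 0 < d := lt_of_lt_of_le (by positivity) hd
  have hsx : 1 ≤ s * x := by rwa [div_le_iff₀ hs0, mul_comm] at hx0
  have hsxq : 1 ≤ s ^ q * x ^ q := by
    rw [← Real.mul_rpow hs0.le hx.le]; exact Real.one_le_rpow hsx hpq.le
  have hsq : 1 ≤ s ^ q := Real.one_le_rpow hs hpq.le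
  have hs2 : s ^ (2 * q) = s ^ q * s ^ q := by rw [two_mul, Real.rpow_add hs0]
  have hd2 : c ^ 2 * (ε * x ^ q) ^ 2 ≤ d ^ 2 := by
    rw [← mul_pow]; exact pow_le_pow_left₀ (by positivity) hd 2
  have hxq : 0 < x ^ q := by positivity
  -- The branch `s^(2q)` uses only the trivial variance bound `V ≤ 1`, so it is also available for
  -- `2q = p`.
  have caseA : 2 * (c' * (ε ^ 2 / s ^ (2 * q))) ≤ d ∧ 4 * (c' * (ε ^ 2 / s ^ (2 * q))) * V ≤ d ^ 2 := by
    have e1 : ε ^ 2 / s ^ (2 * q) ≤ (ε * x ^ q) ^ 2 := by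
      rw [div_le_iff₀ (by positivity), hs2]
      have h3 : 1 ≤ (s ^ q * x ^ q) ^ 2 := one_le_pow₀ hsxq
      have h4 := mul_le_mul_of_nonneg_left h3 (sq_nonneg ε)
      linarith
    have e2 : ε ^ 2 / s ^ (2 * q) ≤ ε * x ^ q := by
      rw [div_le_iff₀ (by positivity), hs2]
      have h4 : ε * (1 * ε) ≤ ε * ((s ^ q * x ^ q) * s ^ q) := by
        gcongr
        exact hε1.trans hsq
      linarith
    constructor
    · calc 2 * (c' * (ε ^ 2 / s ^ (2 * q))) ≤ 2 * (c' * (ε * x ^ q)) := by gcongr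
        _ = (2 * c') * (ε * x ^ q) := by ring
        _ ≤ c * (ε * x ^ q) := by gcongr
        _ ≤ d := hd
    · calc 4 * (c' * (ε ^ 2 / s ^ (2 * q))) * V ≤ 4 * (c' * (ε ^ 2 / s ^ (2 * q))) * 1 := by gcongr
        _ ≤ 4 * (c' * (ε * x ^ q) ^ 2) * 1 := by gcongr
        _ ≤ 4 * (c' * (ε * x ^ q) ^ 2) * K := by gcongr
        _ = (4 * c' * K) * (ε * x ^ q) ^ 2 := by ring
        _ ≤ c ^ 2 * (ε * x ^ q) ^ 2 := by gcongr
        _ ≤ d ^ 2 := hd2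
  unfold dimFactor
  split_ifs with h
  · rcases min_choice (s ^ (2 * q)) (max (s ^ (2 * q - p) / (2 * q - p)) (ε * s ^ q)) with h3 | h3
    · rw [h3]; exact caseA
    rw [h3]
    have hδ : 0 < 2 * q - p := by linarith
    have hV := hV h
    set D := max (s ^ (2 * q - p) / (2 * q - p)) (ε * s ^ q) with hD
    have hD1 : s ^ (2 * q - p) / (2 * q - p) ≤ D := le_max_left _ _
    have hD2 : ε * s ^ q ≤ D := le_max_right _ _
    have hD0 : 0 < D := lt_of_lt_of_le (by positivity) hD2
    constructor
    · have e1 : ε ^ 2 / D ≤ ε * x ^ q := by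
        rw [div_le_iff₀ hD0]
        calc ε ^ 2 = ε * ε * 1 := by ring
          _ ≤ ε * ε * (s ^ q * x ^ q) := by gcongr
          _ = ε * x ^ q * (ε * s ^ q) := by ring
          _ ≤ _ := by gcongr
      calc 2 * (c' * (ε ^ 2 / D)) ≤ 2 * (c' * (ε * x ^ q)) := by gcongr
        _ = (2 * c') * (ε * x ^ q) := by ring
        _ ≤ c * (ε * x ^ q) := by gcongr
        _ ≤ d := hd
    -- The ratio of variance to squared mean is of order `x^(p-2q) / (2q-p)`, worst at `x = 1 / s`,
    -- where it equals `s^(2q-p) / (2q-p)`.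
    · have e1 : x ^ p / (2 * q - p) ≤ D * (x ^ q) ^ 2 := by
        have h4 : 1 ≤ s ^ (2 * q - p) * x ^ (2 * q - p) := by
          rw [← Real.mul_rpow hs0.le hx.le]; exact Real.one_le_rpow hsx hδ.le
        have h5 : (x ^ q) ^ 2 = x ^ p * x ^ (2 * q - p) := by
          rw [← Real.rpow_natCast, ← Real.rpow_mul hx.le, ← Real.rpow_add hx]
          congr 1; push_cast; ring
        calc x ^ p / (2 * q - p) = 1 * (x ^ p / (2 * q - p)) := (one_mul _).symm
          _ ≤ (s ^ (2 * q - p) * x ^ (2 * q - p)) * (x ^ p / (2 * q - p)) := by gcongr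
          _ = s ^ (2 * q - p) / (2 * q - p) * (x ^ q) ^ 2 := by rw [h5]; ring
          _ ≤ _ := by gcongr
      have e2 : V ≤ K * (D * (x ^ q) ^ 2) := hV.trans (by gcongr)
      calc 4 * (c' * (ε ^ 2 / D)) * V ≤ 4 * (c' * (ε ^ 2 / D)) * (K * (D * (x ^ q) ^ 2)) := by
            gcongr
        _ = (4 * c' * K) * (ε * x ^ q) ^ 2 := by field_simp
        _ ≤ c ^ 2 * (ε * x ^ q) ^ 2 := by gcongr
        _ ≤ d ^ 2 := hd2
  · exact caseA

/-- The quotient is at least `1/2` because `2q - p ≤ 2`. This keeps the real-valued dimension above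
`1` for `n ≥ 2`, so that rounding it down costs little. -/
theorem half_le_dimFactor {p q ε s : ℝ} (hp2 : p ≤ 2) (hq : 1 ≤ q) (hqp : q ≤ p)
    (hs : 1 ≤ s) :
    1 / 2 ≤ dimFactor p q ε s := by
  have h3 : 1 ≤ s ^ (2 * q) := Real.one_le_rpow hs (by linarith)
  unfold dimFactor
  split_ifs with h
  · refine le_min (by linarith) (le_max_of_le_left ?_)
    have h4 : 1 ≤ s ^ (2 * q - p) := Real.one_le_rpow hs (by linarith)
    rw [le_div_iff₀ (by linarith)]
    linarith
  · linarith

section SketchDist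

variable {m k : ℕ} {p q : ℝ}

theorem toReal_ofReal_of_one_le (h : 1 ≤ q) : (ENNReal.ofReal q).toReal = q :=
  ENNReal.toReal_ofReal (by linarith)

theorem ellP_norm_eq (h : 1 ≤ p) (v : EllP p m) : ‖v‖ = (∑ i, |v i| ^ p) ^ (1 / p) := by
  rw [PiLp.norm_eq_sum (by rw [toReal_ofReal_of_one_le h]; linarith), toReal_ofReal_of_one_le h]
  rfl

theorem ellP_norm_rpow (h : 1 ≤ p) (v : EllP p m) : ‖v‖ ^ p = ∑ i, |v i| ^ p := by
  rw [ellP_norm_eq h, ← Real.rpow_mul (Finset.sum_nonneg fun _ _ => by positivity),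
    one_div_mul_cancel (by linarith), Real.rpow_one]

/-- The identity for a difference of sines halves both arguments, so the scale `2 / s` in the
program becomes `1 / s` here. -/
theorem sketchProgram_norm_sub_rpow (hm : m ≠ 0) (hq : 1 ≤ q) (s : ℝ) {β : ℝ} (hβ : 0 ≤ β)
    (ω : Fin (k * (m + 1)) → ℝ) (v w : EllP p m) :
    ‖(sketchProgram m k (2 / s) β).toMap p q ω v - (sketchProgram m k (2 / s) β).toMap p q ω w‖ ^ q =
      (2 * β) ^ q * ∑ j : Fin k, blockDist q (1 / s) (fun i => (v - w) i) (fun i => (v + w) i)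
        fun i => ω (finProdFinEquiv (j, i)) := by
  rw [ellP_norm_rpow hq, Finset.mul_sum]
  refine Finset.sum_congr rfl fun j _ => ?_
  rw [PiLp.sub_apply, sketchProgram_toMap hm, sketchProgram_toMap hm, ← sub_mul, Real.sin_sub_sin,
    blockDist, ← Real.mul_rpow (abs_nonneg _) (abs_nonneg _),
    ← Real.mul_rpow (by positivity) (by positivity), ← abs_mul, ← abs_of_nonneg hβ]
  rw [← abs_two, abs_of_nonneg hβ, abs_two]
  congr 1
  conv_rhs => rw [← abs_of_nonneg (show 0 ≤ 2 * β by positivity), ← abs_mul]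
  congr 1
  have e1 : ((∑ i, v i * ω (finProdFinEquiv (j, i.succ))) * (2 / s) + ω (finProdFinEquiv (j, 0)) -
      ((∑ i, w i * ω (finProdFinEquiv (j, i.succ))) * (2 / s) + ω (finProdFinEquiv (j, 0)))) / 2 =
      1 / s * ∑ i, (v - w) i * ω (finProdFinEquiv (j, i.succ)) := by
    simp only [PiLp.sub_apply, sub_mul, Finset.sum_sub_distrib]
    ring
  have e2 : ((∑ i, v i * ω (finProdFinEquiv (j, i.succ))) * (2 / s) + ω (finProdFinEquiv (j, 0)) +
      ((∑ i, w i * ω (finProdFinEquiv (j, i.succ))) * (2 / s) + ω (finProdFinEquiv (j, 0)))) / 2 =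
      ω (finProdFinEquiv (j, 0)) + 1 / s * ∑ i, (v + w) i * ω (finProdFinEquiv (j, i.succ)) := by
    simp only [PiLp.add_apply, add_mul, Finset.sum_add_distrib]
    ring
  rw [e1, e2]
  ring

theorem isProbabilityMeasure_seedLaw (h1 : 1 ≤ p) (h2 : p ≤ 2) (P : RandProgram m k) :
    IsProbabilityMeasure (P.seedLaw p) := by
  have := isProbabilityMeasure_law h1 h2
  unfold RandProgram.seedLaw
  infer_instance

/-- Two-sided concentration for one pair of points. -/
theorem sketchProgram_not_pairGood_le (h1 : 1 ≤ p) (h2 : p ≤ 2) (hm : m ≠ 0) (hq : 1 ≤ q)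
    {s β ε X V d ρ : ℝ} (hβ : 0 ≤ β) {v w : EllP p m}
    (hX : X = (2 * β) ^ q * k * (cosMoment q * sinMoment p q (‖v - w‖ / s)))
    (hV : sinMoment p (2 * q) (‖v - w‖ / s) ≤ V) (hd0 : 0 ≤ d)
    (hd1 : 1 ≤ ‖v - w‖ → d = ε / 50 * (cosMoment q * sinMoment p q (‖v - w‖ / s)))
    (hd2 : ‖v - w‖ < 1 → (2 * β) ^ q * k * d = ε / 50)
    (hρ1 : 2 * ρ ≤ d) (hρ2 : 4 * ρ * V ≤ d ^ 2) :
    ((sketchProgram m k (2 / s) β).seedLaw p).real {ω | ¬ PairGood ε ‖v - w‖ X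
      (‖(sketchProgram m k (2 / s) β).toMap p q ω v -
        (sketchProgram m k (2 / s) β).toMap p q ω w‖ ^ q)} ≤ 2 * Real.exp (-(k * ρ)) := by
  have hlaw := isProbabilityMeasure_law h1 h2
  have hseed := isProbabilityMeasure_seedLaw h1 h2 (sketchProgram m k (2 / s) β)
  have hq0 : 0 ≤ q := by linarith
  set F : (Fin (m + 1) → ℝ) → ℝ :=
    blockDist q (1 / s) (fun i => (v - w) i) (fun i => (v + w) i) with hF
  set ν : Measure (Fin (m + 1) → ℝ) := Measure.pi fun i => (blockKind m i).law p with hν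
  have ht : 1 / s * (∑ i, |(v - w) i| ^ p) ^ (1 / p) = ‖v - w‖ / s := by
    rw [← ellP_norm_eq h1]; ring
  have hmean : ∫ y, F y ∂ν = cosMoment q * sinMoment p q (‖v - w‖ / s) := by
    rw [← ht]; exact integral_blockDist h1 h2 hq0 _ _ _
  have hsq : ∫ y, F y ^ 2 ∂ν ≤ V := by
    refine le_trans ?_ hV
    rw [← ht]; exact integral_blockDist_sq_le h1 h2 hq0 _ _ _
  have hV0 : 0 ≤ V := (integral_nonneg fun _ => sq_nonneg _).trans hsq
  obtain ⟨hU, hL⟩ := bernstein_pi (measurable_blockDist q _ _ _) (blockDist_nonneg q _ _ _)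
    (blockDist_le_one hq0 _ _ _) hV0 hsq hd0 hρ1 hρ2 k
  have hmp := measurePreserving_blocks k (m + 1) fun i => (blockKind m i).law p
  have hFm : Measurable F := measurable_blockDist q _ _ _
  have hsum : Measurable fun x : Fin k → Fin (m + 1) → ℝ => ∑ j, F (x j) := by fun_prop
  have hmU : MeasurableSet {x : Fin k → Fin (m + 1) → ℝ | k * (∫ y, F y ∂ν + d) ≤ ∑ j, F (x j)} :=
    measurableSet_le measurable_const hsum
  have hmL : MeasurableSet {x : Fin k → Fin (m + 1) → ℝ | ∑ j, F (x j) ≤ k * (∫ y, F y ∂ν - d)} :=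
    measurableSet_le hsum measurable_const
  rw [← hmp.measureReal_preimage hmU.nullMeasurableSet] at hU
  rw [← hmp.measureReal_preimage hmL.nullMeasurableSet] at hL
  rw [two_mul]
  refine le_trans ?_ (add_le_add hU hL)
  refine le_trans (measureReal_mono ?_ (measure_ne_top _ _)) (measureReal_union_le _ _)
  intro ω hω
  by_contra hcon
  have hcL : ∑ j : Fin k, F (fun i => ω (finProdFinEquiv (j, i))) < k * (∫ y, F y ∂ν + d) :=
    not_le.1 fun h => hcon (Or.inl h)
  have hcU : k * (∫ y, F y ∂ν - d) < ∑ j : Fin k, F (fun i => ω (finProdFinEquiv (j, i))) :=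
    not_le.1 fun h => hcon (Or.inr h)
  rw [hmean] at hcL hcU
  refine hω ?_
  have hW := sketchProgram_norm_sub_rpow (k := k) hm hq s hβ ω v w
  have hγ : 0 ≤ (2 * β) ^ q := by positivity
  have hcL' := mul_le_mul_of_nonneg_left hcL.le hγ
  have hcU' := mul_le_mul_of_nonneg_left hcU.le hγ
  refine ⟨fun ht1 => ?_, fun ht1 => ?_⟩
  · rw [hW, hX]
    rw [hd1 ht1] at hcL' hcU'
    exact ⟨hcL'.trans_eq (by ring), le_trans (by apply le_of_eq; ring) hcU'⟩
  · rw [hW, hX, ← hd2 ht1]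
    exact hcL'.trans_eq (by ring)

end SketchDist

/-- The deviation that is allowed for a pair at distance `t`, its size and the variance bound, in
the form in which `bernstein_rate` uses them. -/
theorem ScaleEstimate.exists_deviation {p q ε R s N K : ℝ} (h : ScaleEstimate p q ε R s N)
    (h1 : 1 ≤ p) (h2 : p ≤ 2) (hq1 : 1 ≤ q) (hqp : q ≤ p) (hε0 : 0 < ε) (hR : 1 < R)
    (hK0 : 0 < K) (hK : ∀ u, 0 < u → stableDensity p u ≤ K * u ^ (-1 - p)) {t g : ℝ} (ht : 0 < t)
    (hg : g = N * s ^ q / thresholdNormalizer p q ε R s / cosMoment q) :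
    ∃ d x V, 0 ≤ d ∧ (1 ≤ t → d = ε / 50 * (cosMoment q * sinMoment p q (t / s))) ∧
      (t < 1 → g * d = ε / 50) ∧ 1 / s ≤ x ∧ partialMoment p 2 1 / 400 * (ε * x ^ q) ≤ d ∧
      V ≤ 1 ∧ (p < 2 * q → V ≤ (6 * K + 2) * (x ^ p / (2 * q - p))) ∧
      sinMoment p (2 * q) (t / s) ≤ V := by
  have hs1 : 1 < s := hR.trans_le h.scale_ge
  have hs0 : 0 < s := by linarith
  have hQ := h.normalizer_pos h1 h2
  have hN : 0 < N := by linarith [h.norm_ge]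
  obtain ⟨hκ, -⟩ := cosMoment_mem (q := q) (by linarith) (by linarith)
  have hκ0 : 0 < cosMoment q := by linarith
  have hm0 := partialMoment_pos h1 h2 (q := 2) (by norm_num) one_pos
  have hts : 0 < t / s := by positivity
  have hG := min_rpow_le_sinMoment h1 h2 hq1 (by linarith) hts
  have hV1 : sinMoment p (2 * q) (t / s) ≤ 1 := by
    refine (sinMoment_le_inv_sqrt_two h1 h2 (by linarith) _).trans ?_
    exact one_div_sqrt_two_le.trans (by norm_num)
  have hV2 : p < 2 * q → sinMoment p (2 * q) (t / s) ≤ 6 * K * ((t / s) ^ p / (2 * q - p)) :=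
    fun hpq => sinMoment_two_mul_le h1 h2 hqp hpq hK0.le hK hts
  rcases le_or_gt 1 t with ht1 | ht1
  -- A relative deviation of `ε / 50`; the mean saturates once `t ≥ s`, hence the minimum.
  · refine ⟨ε / 50 * (cosMoment q * sinMoment p q (t / s)), min 1 (t / s),
      sinMoment p (2 * q) (t / s), ?_, fun _ => rfl, fun h' => absurd h' (by linarith), ?_, ?_, hV1,
      fun hpq => ?_, le_rfl⟩
    · have : 0 ≤ sinMoment p q (t / s) := integral_nonneg fun _ => by positivity
      positivity
    · refine le_min ?_ (by gcongr)
      rw [div_le_iff₀ hs0]; linarith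
    · have h3 : 0 ≤ (min 1 (t / s)) ^ q := by positivity
      calc partialMoment p 2 1 / 400 * (ε * min 1 (t / s) ^ q) =
            ε / 50 * (1 / 2 * (partialMoment p 2 1 / 4 * (min 1 (t / s)) ^ q)) := by ring
        _ ≤ ε / 50 * (cosMoment q * sinMoment p q (t / s)) := by gcongr
    · have hδ : 0 < 2 * q - p := by linarith
      rcases le_total 1 (t / s) with h3 | h3
      · rw [min_eq_left h3, Real.one_rpow]
        refine hV1.trans ?_
        rw [mul_one_div, le_div_iff₀ hδ]
        linarith
      · rw [min_eq_right h3]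
        refine (hV2 hpq).trans ?_
        gcongr
        linarith
  -- Below scale `1` the mean may be arbitrarily small, so an absolute deviation `ε / 50` of the
  -- image distance is allowed instead; the rate is then that of scale `1`, with `x = 1 / s`.
  · refine ⟨ε / 50 / g, 1 / s, sinMoment p (2 * q) (t / s), ?_, fun h' => absurd h' (by linarith),
      fun _ => ?_, le_rfl, ?_, hV1, fun hpq => ?_, le_rfl⟩
    · have : 0 < g := by rw [hg]; positivity
      positivity
    · have : 0 < g := by rw [hg]; positivity
      field_simp
    · rw [hg, Real.div_rpow zero_le_one hs0.le, Real.one_rpow]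
      have hsq : 0 < s ^ q := by positivity
      have h3 : partialMoment p 2 1 * N ≤ thresholdNormalizer p q ε R s * (27 / 20) :=
        mul_le_mul h.normalizer_ge h.norm_le hN.le hQ.le
      have h4 : thresholdNormalizer p q ε R s * (1 / 2) ≤
          thresholdNormalizer p q ε R s * cosMoment q := by gcongr
      rw [div_div_eq_mul_div, div_div_eq_mul_div, le_div_iff₀ (by positivity)]
      have e : partialMoment p 2 1 / 400 * (ε * (1 / s ^ q)) * (N * s ^ q) =
          ε / 400 * (partialMoment p 2 1 * N) := by field_simp
      rw [e]
      have h5 : partialMoment p 2 1 * N ≤ 8 * (thresholdNormalizer p q ε R s * cosMoment q) := by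
        linarith
      calc ε / 400 * (partialMoment p 2 1 * N) ≤
            ε / 400 * (8 * (thresholdNormalizer p q ε R s * cosMoment q)) := by gcongr
        _ = _ := by ring
    · have hδ : 0 < 2 * q - p := by linarith
      refine (hV2 hpq).trans ?_
      have h3 : (t / s) ^ p ≤ (1 / s) ^ p := by gcongr
      gcongr
      linarith

theorem sq_mul_two_mul_exp_neg_le {n : ℕ} (hn : 2 ≤ n) {y : ℝ} (hy : 5 * Real.log n ≤ y) :
    (n : ℝ) * (n * (2 * Real.exp (-y))) ≤ 1 / 3 := by
  have hn' : (2 : ℝ) ≤ n := by exact_mod_cast hn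
  have hn0 : (0 : ℝ) < n := by linarith
  have h3 : (n : ℝ) ^ 5 ≤ Real.exp y := by
    rw [← Real.exp_log (show (0 : ℝ) < n ^ 5 by positivity), Real.log_pow]
    exact Real.exp_le_exp.2 (by exact_mod_cast hy)
  have h4 : (2 : ℝ) ^ 3 ≤ n ^ 3 := by gcongr
  rw [Real.exp_neg]
  have h5 : (Real.exp y)⁻¹ ≤ ((n : ℝ) ^ 5)⁻¹ := by gcongr
  calc (n : ℝ) * (n * (2 * (Real.exp y)⁻¹)) ≤ n * (n * (2 * ((n : ℝ) ^ 5)⁻¹)) := by gcongr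
    _ = 2 / n ^ 3 := by field_simp
    _ ≤ 2 / 2 ^ 3 := by gcongr
    _ ≤ 1 / 3 := by norm_num

theorem two_thirds_le_measure {Ω : Type*} [MeasurableSpace Ω] {μ : Measure Ω}
    [IsProbabilityMeasure μ] {s : Set Ω} (h : μ.real sᶜ ≤ 1 / 3) : 2 / 3 ≤ μ s := by
  have h3 : 1 ≤ μ.real s + μ.real sᶜ := by
    have := measureReal_union_le (μ := μ) s sᶜ
    rwa [Set.union_compl_self, probReal_univ] at this
  have h4 : (2 / 3 : ENNReal) = ENNReal.ofReal (2 / 3) := by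
    rw [ENNReal.ofReal_div_of_pos (by norm_num)]; simp
  rw [h4, ENNReal.ofReal_le_iff_le_toReal (measure_ne_top _ _)]
  change 2 / 3 ≤ μ.real s
  linarith

/-- A union bound over the `n²` ordered pairs: each fails with probability at most `2 n^(-5)`. The
factor `β` is fixed before `S`, which is the obliviousness. -/
theorem ScaleEstimate.two_thirds_le_seedLaw {p q ε R s N K c' : ℝ} (h : ScaleEstimate p q ε R s N)
    (h1 : 1 ≤ p) (h2 : p ≤ 2) (hq1 : 1 ≤ q) (hqp : q ≤ p) (hε0 : 0 < ε) (hε2 : ε < 1 / 2)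
    (hR : 1 < R) (hK0 : 0 < K) (hK : ∀ u, 0 < u → stableDensity p u ≤ K * u ^ (-1 - p))
    (hc'0 : 0 < c') (hcc : 2 * c' ≤ partialMoment p 2 1 / 400)
    (hcc' : 4 * c' * (6 * K + 2) ≤ (partialMoment p 2 1 / 400) ^ 2) {C : ℝ} (hC : 2 ≤ C)
    {n k m : ℕ} (hn : 2 ≤ n) (hm : m ≠ 0) (hk : k ≠ 0)
    (hkn : 5 * Real.log n ≤ k * (c' * (ε ^ 2 / dimFactor p q ε s))) :
    ∃ β : ℝ, ∀ S : Finset (EllP p m), S.card = n →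
      2 / 3 ≤ (sketchProgram m k (2 / s) β).seedLaw p
        {ω | IsRangeEmbedding p q ε R s C S ((sketchProgram m k (2 / s) β).toMap p q ω)} := by
  have : Fact (1 ≤ ENNReal.ofReal p) := ⟨by rwa [ENNReal.one_le_ofReal]⟩
  have : Fact (1 ≤ ENNReal.ofReal q) := ⟨by rwa [ENNReal.one_le_ofReal]⟩
  have hs1 : 1 < s := hR.trans_le h.scale_ge
  have hs0 : 0 < s := by linarith
  have hQ := h.normalizer_pos h1 h2
  have hN : 0 < N := by linarith [h.norm_ge]
  obtain ⟨hκ, -⟩ := cosMoment_mem (q := q) (by linarith) (by linarith)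
  have hκ0 : 0 < cosMoment q := by linarith
  have hk0 : (0 : ℝ) < k := by positivity
  obtain ⟨β, hβ0, hβ⟩ : ∃ β : ℝ, 0 ≤ β ∧
      (2 * β) ^ q * k = N * s ^ q / thresholdNormalizer p q ε R s / cosMoment q := by
    -- Solved from the requirement that the mean of the sum over `k` coordinates be `meanDist`; this
    -- needs `k ≠ 0`.
    refine ⟨(N * s ^ q / thresholdNormalizer p q ε R s / cosMoment q / k) ^ (1 / q) / 2,
      by positivity, ?_⟩
    rw [mul_div_cancel₀ _ two_ne_zero, ← Real.rpow_mul (by positivity),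
      one_div_mul_cancel (by linarith), Real.rpow_one, div_mul_cancel₀ _ hk0.ne']
  refine ⟨β, fun S hS => ?_⟩
  have hprob := isProbabilityMeasure_seedLaw h1 h2 (sketchProgram m k (2 / s) β)
  set ρ := c' * (ε ^ 2 / dimFactor p q ε s) with hρ
  set bad : EllP p m → EllP p m → Set (Fin (sketchProgram m k (2 / s) β).r → ℝ) := fun v w =>
    {ω | ¬ PairGood ε ‖v - w‖ (meanDist p q ε R s N ‖v - w‖)
      (‖(sketchProgram m k (2 / s) β).toMap p q ω v -
        (sketchProgram m k (2 / s) β).toMap p q ω w‖ ^ q)} with hbad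
  have hX : ∀ t, meanDist p q ε R s N t =
      (2 * β) ^ q * k * (cosMoment q * sinMoment p q (t / s)) := fun t => by
    rw [hβ, meanDist]
    field_simp
  have hpair : ∀ v w, ((sketchProgram m k (2 / s) β).seedLaw p).real (bad v w) ≤
      2 * Real.exp (-(k * ρ)) := by
    intro v w
    rcases eq_or_ne v w with rfl | hvw
    · have : bad v v = ∅ := by
        refine Set.eq_empty_of_forall_notMem fun ω hω => hω ⟨fun ht => ?_, fun _ => ?_⟩
        · rw [sub_self, norm_zero] at ht; linarith
        · have h3 : 0 ≤ sinMoment p q (0 / s) := integral_nonneg fun _ => by positivity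
          rw [sub_self, sub_self, norm_zero, norm_zero, Real.zero_rpow (by linarith), hX]
          positivity
      rw [this, measureReal_empty]
      positivity
    · have ht : 0 < ‖v - w‖ := norm_pos_iff.2 (sub_ne_zero.2 hvw)
      obtain ⟨d, x, V, hd0, hd1, hd2, hx, hxd, hV1, hV, hsV⟩ :=
        h.exists_deviation h1 h2 hq1 hqp hε0 hR hK0 hK ht rfl
      have hm0 := partialMoment_pos h1 h2 (q := 2) (by norm_num) one_pos
      obtain ⟨hρ1, hρ2⟩ := bernstein_rate (c' := c') (by linarith) hs1.le hε0 (by linarith)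
        (by positivity) hc'0 (by linarith) hcc hcc' hx hxd hV1 hV
      exact sketchProgram_not_pairGood_le h1 h2 hm hq1 hβ0 (hX _) hsV hd0 hd1
        (fun h' => by rw [hβ]; exact hd2 h') hρ1 hρ2
  refine two_thirds_le_measure ?_
  have hsub : {ω | IsRangeEmbedding p q ε R s C S ((sketchProgram m k (2 / s) β).toMap p q ω)}ᶜ ⊆
      ⋃ v ∈ S, ⋃ w ∈ S, bad v w := by
    intro ω hω
    by_contra hcon
    simp only [Set.mem_iUnion, not_exists] at hcon
    exact hω (h.isRangeEmbedding h1 h2 hq1 hqp hε0 hε2 hR hC fun v hv w hw =>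
      not_not.1 (hcon v hv w hw))
  calc ((sketchProgram m k (2 / s) β).seedLaw p).real _ ≤
        ((sketchProgram m k (2 / s) β).seedLaw p).real (⋃ v ∈ S, ⋃ w ∈ S, bad v w) :=
        measureReal_mono hsub (measure_ne_top _ _)
    _ ≤ ∑ v ∈ S, ∑ w ∈ S, 2 * Real.exp (-(k * ρ)) := by
        refine (measureReal_biUnion_finset_le S _).trans (Finset.sum_le_sum fun v _ => ?_)
        exact (measureReal_biUnion_finset_le S _).trans (Finset.sum_le_sum fun w _ => hpair v w)
    _ = n * (n * (2 * Real.exp (-(k * ρ)))) := by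
        simp only [Finset.sum_const, hS, nsmul_eq_mul]
    _ ≤ 1 / 3 := sq_mul_two_mul_exp_neg_le hn hkn

end

/-! ### Choice of the constants and of the dimension. -/

theorem theorem3p2 (p : ℝ) (hp1 : 1 ≤ p) (hp2 : p ≤ 2) :
    ∃ C : ℝ, 0 < C ∧ ∀ q : ℝ, 1 ≤ q → q ≤ p →
      ∃ A : ℝ, 1 ≤ A ∧ ∀ ε : ℝ, 0 < ε → ε < 1 / 2 → ∀ R : ℝ, 1 < R →
        ∀ s : ℝ, s = A * thresholdScale p q ε R →
        ∀ n : ℕ, ∃ k : ℕ,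
          (k : ℝ) ≤ C * (Real.log n / ε ^ 2 * dimFactor p q ε s) ∧
          ∀ m : ℕ, ∃ P : RandProgram m k,
            (P.steps : ℝ) ≤ C * (m * k) ∧
            ∀ S : Finset (EllP p m), S.card = n →
              2 / 3 ≤ P.seedLaw p {ω | IsRangeEmbedding p q ε R s C S (P.toMap p q ω)} := by
  have hm0 := partialMoment_pos hp1 hp2 (q := 2) (by norm_num) one_pos
  obtain ⟨K, hK0, -, hK⟩ := exists_stableDensity_bound hp1 hp2
  -- The rate constant of Bernstein's inequality, fixed before `q`. The denominator `400` is `50 · 2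
  -- · 4`: deviation, lower bound for the cosine mean, and lower bound for the sine moment.
  obtain ⟨c', hc'0, hcc, hcc'⟩ : ∃ c' : ℝ, 0 < c' ∧ 2 * c' ≤ partialMoment p 2 1 / 400 ∧
      4 * c' * (6 * K + 2) ≤ (partialMoment p 2 1 / 400) ^ 2 := by
    generalize partialMoment p 2 1 / 400 = c, (show 0 < partialMoment p 2 1 / 400 by positivity) = hc
    refine ⟨min (c / 2) (c ^ 2 / (4 * (6 * K + 2))), lt_min (by positivity) (by positivity), ?_, ?_⟩
    · linarith [min_le_left (c / 2) (c ^ 2 / (4 * (6 * K + 2)))]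
    · have := min_le_right (c / 2) (c ^ 2 / (4 * (6 * K + 2)))
      rw [le_div_iff₀ (by positivity)] at this
      linarith
  -- `16` bounds the number of steps and leaves a unit for rounding `k` down; `5 / c'` produces the
  -- exponent `5 log n`.
  refine ⟨16 + 5 / c', by positivity, fun q hq1 hqp => ?_⟩
  have hC16 : 16 ≤ 16 + 5 / c' := le_add_of_nonneg_right (by positivity)
  obtain ⟨A, hA1, hA⟩ := exists_scaleEstimate hp2 hq1 hqp
  refine ⟨A, hA1, fun ε hε0 hε2 R hR s hs n => ?_⟩
  obtain ⟨N, hE⟩ := hA ε hε0 hε2 R hR s hs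
  have hs1 : 1 < s := hR.trans_le hE.scale_ge
  have hD := half_le_dimFactor (ε := ε) hp2 hq1 hqp hs1.le
  have hD0 : 0 < dimFactor p q ε s := by linarith
  have hT : 0 ≤ s ^ q / thresholdNormalizer p q ε R s :=
    div_nonneg (by positivity) (hE.normalizer_pos hp1 hp2).le
  set L := Real.log n / ε ^ 2 * dimFactor p q ε s with hL
  have hL0 : 0 ≤ L := by positivity
  set k := ⌊(16 + 5 / c') * L⌋₊ with hk
  have hsteps : ∀ (m : ℕ) (β : ℝ), ((sketchProgram m k (2 / s) β).steps : ℝ) ≤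
      (16 + 5 / c') * (m * k) := fun m β => by
    have h3 : ((sketchProgram m k (2 / s) β).steps : ℝ) ≤ 16 * (m * k) := by
      exact_mod_cast sketchProgram_steps_le m k (2 / s) β
    exact h3.trans (by gcongr)
  have htriv : ∀ m β, ∀ S : Finset (EllP p m), (∀ v ∈ S, ∀ w ∈ S, v = w) →
      2 / 3 ≤ (sketchProgram m k (2 / s) β).seedLaw p {ω | IsRangeEmbedding p q ε R s
        (16 + 5 / c') S ((sketchProgram m k (2 / s) β).toMap p q ω)} := fun m β S hS => by
    have := isProbabilityMeasure_seedLaw hp1 hp2 (sketchProgram m k (2 / s) β)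
    have huniv : {ω | IsRangeEmbedding p q ε R s (16 + 5 / c') S
        ((sketchProgram m k (2 / s) β).toMap p q ω)} = Set.univ :=
      Set.eq_univ_of_forall fun ω => isRangeEmbedding_of_subsingleton hq1 hε0 hR hT hS _ hp1
    rw [huniv]
    refine two_thirds_le_measure ?_
    rw [Set.compl_univ, measureReal_empty]
    norm_num
  refine ⟨k, Nat.floor_le (by positivity), fun m => ?_⟩
  -- For `n ≤ 1`, as for `m = 0` below, there are no two distinct points; `k` may then be zero.
  rcases Nat.lt_or_ge n 2 with hn | hn
  · exact ⟨_, hsteps m 0, fun S hS => htriv m 0 S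
      (Finset.card_le_one.1 (by omega))⟩
  rcases eq_or_ne m 0 with rfl | hm
  · exact ⟨_, hsteps 0 0, fun S _ => htriv 0 0 S fun v _ w _ => by
      ext i; exact i.elim0⟩
  have hlog : 1 / 2 ≤ Real.log n := by
    have h3 : Real.log 2 ≤ Real.log n := Real.log_le_log (by norm_num) (by exact_mod_cast hn)
    linarith [Real.log_two_gt_d9]
  have hεD : ε ^ 2 / dimFactor p q ε s ≤ Real.log n := by
    rw [div_le_iff₀ hD0]
    nlinarith
  have hkL : (15 + 5 / c') * L ≤ k := by
    have h3 : (16 + 5 / c') * L < k + 1 := Nat.lt_floor_add_one _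
    have h4 : 1 ≤ L := by
      rw [hL, div_mul_eq_mul_div, le_div_iff₀ (by positivity)]
      nlinarith
    linarith
  have hkn : 5 * Real.log n ≤ k * (c' * (ε ^ 2 / dimFactor p q ε s)) := by
    calc 5 * Real.log n ≤ (15 * c' + 5) * Real.log n := by gcongr; linarith
      _ = (15 + 5 / c') * L * (c' * (ε ^ 2 / dimFactor p q ε s)) := by
          rw [hL]; field_simp
      _ ≤ _ := by gcongr
  have hk0 : k ≠ 0 := by
    intro h0
    rw [h0, Nat.cast_zero, zero_mul] at hkn
    linarith
  obtain ⟨β, hβ⟩ := hE.two_thirds_le_seedLaw hp1 hp2 hq1 hqp hε0 hε2 hR hK0 hK hc'0 hcc hcc'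
    (show 2 ≤ 16 + 5 / c' by linarith) hn hm hk0 hkn
  exact ⟨_, hsteps m β, hβ⟩
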